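/- Let $G$ be a finite directed acyclic network (parallel links allowed) with distinct source nodes $S_1,\dots,S_s$ and a nonempty set of sink nodes, none of which is a source. A link carries one symbol of a fixed finite field $\mathbb F_p$ ($p$ a prime power) per unit time. Each source has a message that every sink has to recover; source $i$ shares a uniformly random secret, independent of everything else, with the sinks, and every node has private uniform randomness. For a nonempty set $S'$ of sources let $m_{S'}$ be the minimum over the sinks $t$ of the capacity of a minimum cut between $S'$ and $t$, let $\mathcal I(S')$ be the set of indices of the sources in $S'$, and let $\mathcal S$ be the set of all sources. An adversary knows the network, the code and the messages, observes the randomness of all nodes and the transmissions, but not the secrets, and replaces the contents of up to $z$ links by arbitrary values that depend on what he knows; which links he attacks is fixed. A tuple $(R_1,\dots,R_s)$ of nonnegative reals is achievable if there is a sequence of codes of length $\ell=1,2,\dots$ (each link carries $\ell$ symbols) such that for all $\epsilon,\delta>0$ and all sufficiently large $\ell$, the message set $\mathcal J^i_\ell$ of each source $i$ satisfies $\frac1\ell\log_p|\mathcal J^i_\ell|\ge R_i-\epsilon$, and the probability that some sink does not recover all messages is less than $\delta$ for all messages and all attacks. The capacity region is the closure of the set of achievable tuples. (a) If $z\le m_{\{S_i\}}$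 for every source $S_i$, then the capacity region is $$\Bigl\{R\in\mathbb R_{\ge0}^s:\ \sum_{i\in\mathcal I(S')}R_i\le m_{S'}-z\ \text{ for every nonempty } S'\subseteq\mathcal S\Bigr\}.$$ (b) Every point $R$ of this region is achieved by a polynomial-time code of the following form, with integer parameters $T,n,k\ge1$ such that $Tnk\le\ell$ (for all sufficiently large $\ell$) and $n\ge\alpha$, where $\alpha=(Tm_{\mathcal S})^2+1$. In a block every link carries $T$ packets of $n$ symbols of $\mathbb F_q$, $q=p^k$. Put $r_i=\lfloor TR_i\rfloor$. The secret of source $i$ consists of a uniform vector $w\in\mathbb F_q^\alpha$ and a uniform matrix $H\in\mathbb F_q^{r_i\times\alpha}$; let $P$ be the $n\times\alpha$ matrix with entries $P_{ab}=w_b^{\,a}$. Source $i$ arranges its message into $X\in\mathbb F_q^{r_i\times(n-\alpha)}$ and forms $M=[L\ X]$, where $L$ is the solution of $[L\ X]P=H$ if the first $\alpha$ rows of $P$ form an invertible matrix, and $L=0$ otherwise. Each of the $T$ packets that a node sends on an outgoing link is an independent uniformly random $\mathbb F_q$-linear combination of all packets that it receives and, at source $i$, of the rows of $M$. A sink that receives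 the packets $Y$ (as rows) finds, for each $i$, the unique solution $M$ of the linear system $MP=H$ among the matrices with all rows in the row space of $Y$ (and outputs $0$ if there is no unique solution). Encoding at a source, forming linear combinations at a node, and decoding at a sink are carried out by fixed programs for a random access machine with unit-cost operations in $\mathbb F_q$, in a number of steps that is polynomial in the numbers of rows and columns of the matrices involved (Gaussian elimination). The parameters $T,n,k$ as functions of $\ell$ depend only on $p$, $s$, $z$, $R$ and $m_{\mathcal S}$, so that the network may be unknown; only how large $\ell$ has to be for given $\epsilon,\delta$ depends on the network. The code achieves $R$ even if the adversary chooses the at most $z$ links depending on what he observes. -/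

import Mathlib

open Set Matrix

/-! ### Networks and cuts -/

/-- A finite directed acyclic multigraph with node set `V` and link set `E` (parallel links allowed),
distinct source nodes indexed by `ι`, and sink nodes indexed by `τ`; no node is both a source
and a sink. -/
structure Network (V E ι τ : Type) where
  tail : E → V
  head : E → V
  src : ι → V
  snk : τ → V
  src_injective : Function.Injective src
  src_ne_snk : ∀ i t, src i ≠ snk t
  acyclic : ∀ v, ¬ Relation.TransGen (fun u u' => ∃ e, tail e = u ∧ head e = u') v v

namespace Network

variable {V E ι τ : Type}

/-- Link `e'` enters the node that link `e` leaves. -/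
def Feeds (N : Network V E ι τ) (e' e : E) : Prop := N.head e' = N.tail e

theorem wellFounded_feeds [Finite V] (N : Network V E ι τ) : WellFounded N.Feeds := by
  let r : V → V → Prop := Relation.TransGen (fun u u' => ∃ e, N.tail e = u ∧ N.head e = u')
  have hr : WellFounded r := by
    have : IsTrans V r := ⟨fun _ _ _ h h' => h.trans h'⟩
    have : Std.Irrefl r := ⟨N.acyclic⟩
    exact Finite.wellFounded_of_trans_of_irrefl r
  refine Subrelation.wf ?_ (InvImage.wf N.tail hr)
  intro e' e h
  exact Relation.TransGen.single ⟨e', rfl, h⟩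

/-- The number of links that leave the node set `U`. -/
def cutCapacity [Fintype E] [DecidableEq V] (N : Network V E ι τ) (U : Finset V) : ℕ :=
  (Finset.univ.filter fun e => N.tail e ∈ U ∧ N.head e ∉ U).card

/-- The minimum cut capacity between the sources in `S` and the sink `t`. -/
noncomputable def minCutTo [Fintype E] [DecidableEq V] (N : Network V E ι τ) (S : Finset ι)
    (t : τ) : ℕ :=
  sInf {c | ∃ U : Finset V, (∀ i ∈ S, N.src i ∈ U) ∧ N.snk t ∉ U ∧ c = N.cutCapacity U}

/-- `m_S`: the minimum, over all sinks, of the min-cut capacity between the sources in `S` and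
that sink. -/
noncomputable def minCut [Fintype E] [DecidableEq V] (N : Network V E ι τ) (S : Finset ι) : ℕ :=
  ⨅ t, N.minCutTo S t

/-- The rate tuples with `∑_{i ∈ S} R_i ≤ m_S - z` for every nonempty set `S` of sources. -/
def rateRegion [Fintype E] [DecidableEq V] (N : Network V E ι τ) (z : ℕ) : Set (ι → ℝ) :=
  {R | (∀ i, 0 ≤ R i) ∧
    ∀ S : Finset ι, S.Nonempty → ∑ i ∈ S, R i ≤ (N.minCut S : ℝ) - (z : ℝ)}

/-! ### Codes with shared secrets, and the adversary -/

/-- A code on the network `N` in which every link carries one element of `A` per block.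
Source `i` has a message in `Msg i` and a secret in `Key i` that all sinks share; every node `v` has
its own randomness in `Seed v`.  What a node sends on an outgoing link is a function of its
randomness, of the messages and the secrets available to it, and of what it receives. -/
structure Code (N : Network V E ι τ) (A : Type) where
  Msg : ι → Type
  Key : ι → Type
  Seed : V → Type
  finite_msg : ∀ i, Finite (Msg i)
  finite_key : ∀ i, Finite (Key i)
  finite_seed : ∀ v, Finite (Seed v)
  nonempty_msg : ∀ i, Nonempty (Msg i)
  nonempty_key : ∀ i, Nonempty (Key i)
  nonempty_seed : ∀ v, Nonempty (Seed v)
  enc : ∀ e : E, Seed (N.tail e) →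
    (∀ i, N.src i = N.tail e → Msg i) →
    (∀ i, (N.src i = N.tail e ∨ ∃ t, N.snk t = N.tail e) → Key i) →
    ({e' // N.head e' = N.tail e} → A) → A
  dec : ∀ t : τ, Seed (N.snk t) → (∀ i, Key i) → ({e // N.head e = N.snk t} → A) → ∀ i, Msg i

namespace Code

variable {N : Network V E ι τ} {A : Type}

/-- What arrives at the end of every link when the adversary replaces the content of link `e` by
`b` if `x e = some b`, and leaves it alone if `x e = none`. -/
noncomputable def received [Finite V] (c : Code N A) (w : ∀ i, c.Msg i) (g : ∀ v, c.Seed v)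
    (κ : ∀ i, c.Key i) (x : E → Option A) : E → A :=
  N.wellFounded_feeds.fix fun e y =>
    (x e).getD (c.enc e (g (N.tail e)) (fun i _ => w i) (fun i _ => κ i) fun e' => y e'.1 e'.2)

theorem received_eq [Finite V] (c : Code N A) (w : ∀ i, c.Msg i) (g : ∀ v, c.Seed v)
    (κ : ∀ i, c.Key i) (x : E → Option A) (e : E) :
    c.received w g κ x e = (x e).getD (c.enc e (g (N.tail e)) (fun i _ => w i) (fun i _ => κ i)
      fun e' => c.received w g κ x e'.1) := by
  unfold received
  rw [WellFounded.fix_eq]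

/-- What the adversary sees in addition to the network, the code and the messages: the randomness
of all nodes and all transmissions (those that the honest nodes produce as long as nothing is
tampered with), but not the secrets. -/
abbrev Observation (c : Code N A) : Type := (∀ v, c.Seed v) × (E → A)

/-- An attack: the links to be tampered with and their new contents, as a function of what the
adversary observes. -/
abbrev Attack (c : Code N A) : Type := c.Observation → E → Option A

/-- The attack is confined to a fixed set of at most `z` links. -/
def Attack.Fixed {c : Code N A} (a : c.Attack) (z : ℕ) : Prop :=
  ∃ Z : Finset E, Z.card ≤ z ∧ ∀ o, ∀ e, e ∉ Z → a o e = none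

/-- The attack touches at most `z` links, which may depend on what the adversary observes. -/
def Attack.Adaptive {c : Code N A} (a : c.Attack) (z : ℕ) : Prop :=
  ∀ o, ∃ Z : Finset E, Z.card ≤ z ∧ ∀ e, e ∉ Z → a o e = none

/-- Some sink fails to recover all the messages. -/
def Fails [Finite V] (c : Code N A) (w : ∀ i, c.Msg i) (a : c.Attack) (g : ∀ v, c.Seed v)
    (κ : ∀ i, c.Key i) : Prop :=
  ∃ t, c.dec t (g (N.snk t)) κ
    (fun e => c.received w g κ (a (g, c.received w g κ fun _ => none)) e.1) ≠ w

/-- The probability, over independent uniform node randomness and secrets, that some sink fails to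
recover the messages `w` under the attack `a`. -/
noncomputable def errorProb [Finite V] (c : Code N A) (w : ∀ i, c.Msg i) (a : c.Attack) : ℝ :=
  (Nat.card {x : (∀ v, c.Seed v) × (∀ i, c.Key i) // c.Fails w a x.1 x.2} : ℝ) /
    (Nat.card ((∀ v, c.Seed v) × (∀ i, c.Key i)) : ℝ)

end Code

/-- The rate tuple `R` is attained by a sequence of codes of block length `ℓ → ∞`, in which
every link carries `ℓ` symbols of the field `K`, under every attack on at most `z` links; rates are
measured in symbols of `K`. -/
def Achievable [Finite V] (N : Network V E ι τ) (K : Type) [Field K] (z : ℕ) (R : ι → ℝ) : Prop :=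
  ∃ c : ∀ ℓ : ℕ, Code N (Fin ℓ → K), ∀ ε > (0 : ℝ), ∀ δ > (0 : ℝ), ∃ L : ℕ, ∀ ℓ > L,
    (∀ i, R i - ε ≤ Real.logb (Nat.card K) (Nat.card ((c ℓ).Msg i)) / ℓ) ∧
    ∀ (w : ∀ i, (c ℓ).Msg i) (a : (c ℓ).Attack), a.Fixed z → (c ℓ).errorProb w a < δ

/-- The capacity region: the closure of the set of achievable (nonnegative) rate tuples. -/
def capacityRegion [Finite V] (N : Network V E ι τ) (K : Type) [Field K] (z : ℕ) :
    Set (ι → ℝ) :=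
  closure {R | (∀ i, 0 ≤ R i) ∧ N.Achievable K z R}

end Network

/-! ### The Vandermonde hash -/

namespace HashCode

/-- The parity-check matrix: its `(m, n)`-th entry is `(w_n)^m`, rows numbered from `1`.  The rows
are split into the first `α` and the last `d`. -/
def parity {F : Type} [Field F] {α : ℕ} (d : ℕ) (w : Fin α → F) :
    Matrix (Fin α ⊕ Fin d) (Fin α) F :=
  Matrix.of fun m n => w n ^ ((finSumFinEquiv m : ℕ) + 1)

/-- The packets `[L X]` of a source with data `X` and secret `(w, H)`, where `L` is the solution of
`[L X] * P = H` if the square block `V` formed by the first `α` rows of `P` is invertible, and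
`L = 0` otherwise (the convention for `V⁻¹`). -/
noncomputable def encode {F : Type} [Field F] {r α d : ℕ} (w : Fin α → F)
    (H : Matrix (Fin r) (Fin α) F) (X : Matrix (Fin r) (Fin d) F) :
    Matrix (Fin r) (Fin α ⊕ Fin d) F :=
  Matrix.fromCols ((H - X * (parity d w).toRows₂) * (parity d w).toRows₁⁻¹) X

open Classical in
/-- The decoder: the solution `M` of the linear system `M * P = H` in matrices `M` whose rows are
linear combinations of the received packets (the rows of `Y`), if there is exactly one solution, and
`0` otherwise. -/
noncomputable def decode {F : Type} [Field F] {B : Type} {r α d : ℕ}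
    (Y : Matrix B (Fin α ⊕ Fin d) F) (w : Fin α → F) (H : Matrix (Fin r) (Fin α) F) :
    Matrix (Fin r) (Fin α ⊕ Fin d) F :=
  if h : ∃! M : Matrix (Fin r) (Fin α ⊕ Fin d) F,
      (∀ a, M.row a ∈ Submodule.span F (Set.range Y.row)) ∧ M * parity d w = H
  then h.choose else 0

/-- The hash code.  In one block every link carries `T` packets of `α + d` symbols of `F`.
Source `i` has `r i` packets, made from its data by `encode`.  The `T` packets that a node sends on an
outgoing link are independent uniformly random linear combinations of all the packets that it
receives and of its own packets if it is a source.  Sinks apply `decode`, for each source. -/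
noncomputable def code {V E ι τ : Type} [Fintype E] [Fintype ι] [DecidableEq V]
    (N : Network V E ι τ) (F : Type) [Field F] [Finite F] (T α d : ℕ) (r : ι → ℕ) :
    N.Code (Matrix (Fin T) (Fin α ⊕ Fin d) F) where
  Msg i := Matrix (Fin (r i)) (Fin d) F
  Key i := (Fin α → F) × Matrix (Fin (r i)) (Fin α) F
  Seed v := ∀ _ : {e // N.tail e = v}, Matrix (Fin T)
    (({e' // N.head e' = v} × Fin T) ⊕ (Σ i : {i // N.src i = v}, Fin (r i))) F
  finite_msg _ := inferInstance
  finite_key _ := inferInstance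
  finite_seed _ := inferInstance
  nonempty_msg _ := inferInstance
  nonempty_key _ := inferInstance
  nonempty_seed _ := inferInstance
  enc e g X κ y := g ⟨e, rfl⟩ * Matrix.fromRows
    (Matrix.of fun p : {e' // N.head e' = N.tail e} × Fin T => (y p.1).row p.2)
    (Matrix.of fun p : (Σ i : {i // N.src i = N.tail e}, Fin (r i)) =>
      (encode (κ p.1 (Or.inl p.1.2)).1 (κ p.1 (Or.inl p.1.2)).2 (X p.1 p.1.2)).row p.2)
  dec t _ κ y := fun i =>
    (decode (Matrix.of fun p : {e // N.head e = N.snk t} × Fin T => (y p.1).row p.2)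
      (κ i).1 (κ i).2).toCols₂

end HashCode

/-! ### A machine model with a step count -/

/-- Index expressions (the machine has no multiplication of indices). -/
inductive IdxExpr where
  | const (n : ℕ)
  | var (x : ℕ)
  | add (a b : IdxExpr)
  | sub (a b : IdxExpr)

/-- A memory cell: row and column in a two-dimensional array of field elements. -/
structure Cell where
  array : ℕ
  row : IdxExpr
  col : IdxExpr

/-- Programs of a random access machine with integer index registers and two-dimensional arrays of
field elements.  A program does not mention the field. -/
inductive Program where
  | skip
  | setIdx (x : ℕ) (a : IdxExpr)
  | setZero (p : Cell)
  | setOne (p : Cell)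
  | add (p q s : Cell)
  | sub (p q s : Cell)
  | mul (p q s : Cell)
  | inv (p q : Cell)
  | seq (P Q : Program)
  | ifZero (p : Cell) (P Q : Program)
  | ifLt (a b : IdxExpr) (P Q : Program)
  | forLt (x : ℕ) (a : IdxExpr) (P : Program)

structure Memory (F : Type) where
  idx : ℕ → ℕ
  arr : ℕ → ℕ → ℕ → F

namespace Memory

variable {F : Type}

def eval (s : Memory F) : IdxExpr → ℕ
  | .const n => n
  | .var x => s.idx x
  | .add a b => s.eval a + s.eval b
  | .sub a b => s.eval a - s.eval b

def get (s : Memory F) (p : Cell) : F := s.arr p.array (s.eval p.row) (s.eval p.col)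

def setIdx (s : Memory F) (x n : ℕ) : Memory F :=
  { s with idx := Function.update s.idx x n }

def set (s : Memory F) (p : Cell) (a : F) : Memory F :=
  { s with arr := fun k i j =>
      if k = p.array ∧ i = s.eval p.row ∧ j = s.eval p.col then a else s.arr k i j }

/-- Index register `j` holds `n[j]`, array `j + 1` holds `A[j]`, everything else is zero. -/
def load [Zero F] (n : List ℕ) (A : List (ℕ → ℕ → F)) : Memory F where
  idx j := n.getD j 0
  arr k := match k with
    | 0 => fun _ _ => 0
    | j + 1 => A.getD j fun _ _ => 0

end Memory

namespace Program

/-- The final memory and the number of steps.  Assignments, field operations, tests and loop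
iterations cost one step each.  `forLt x a P` runs `P` with `x = 0, 1, …`, up to the
value that `a` has at the start of the loop, exclusively. -/
def run {F : Type} [Field F] [DecidableEq F] : Program → Memory F → Memory F × ℕ
  | .skip, s => (s, 1)
  | .setIdx x a, s => (s.setIdx x (s.eval a), 1)
  | .setZero p, s => (s.set p 0, 1)
  | .setOne p, s => (s.set p 1, 1)
  | .add p q t, s => (s.set p (s.get q + s.get t), 1)
  | .sub p q t, s => (s.set p (s.get q - s.get t), 1)
  | .mul p q t, s => (s.set p (s.get q * s.get t), 1)
  | .inv p q, s => (s.set p (s.get q)⁻¹, 1)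
  | .seq P Q, s => ((Q.run (P.run s).1).1, (P.run s).2 + (Q.run (P.run s).1).2)
  | .ifZero p P Q, s =>
      if s.get p = 0 then ((P.run s).1, (P.run s).2 + 1) else ((Q.run s).1, (Q.run s).2 + 1)
  | .ifLt a b P Q, s =>
      if s.eval a < s.eval b then ((P.run s).1, (P.run s).2 + 1)
      else ((Q.run s).1, (Q.run s).2 + 1)
  | .forLt x a P, s =>
      Nat.rec (s, 1)
        (fun j acc => ((P.run (acc.1.setIdx x j)).1, acc.2 + (P.run (acc.1.setIdx x j)).2 + 1))
        (s.eval a)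

/-- A matrix as the content of an array. -/
def ofMatrix {F : Type} [Zero F] {a b : ℕ} (M : Matrix (Fin a) (Fin b) F) : ℕ → ℕ → F :=
  fun i j => if h : i < a ∧ j < b then M ⟨i, h.1⟩ ⟨j, h.2⟩ else 0

/-- The same for a matrix whose columns are split into two groups. -/
def ofMatrix₂ {F : Type} [Zero F] {a b c : ℕ} (M : Matrix (Fin a) (Fin b ⊕ Fin c) F) :
    ℕ → ℕ → F :=
  ofMatrix (M.submatrix id finSumFinEquiv.symm)

/-- Started on the sizes `n` and the arrays `A`, the program `P` stops after at most `t` steps, with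
the `a × b` matrix stored in `M` as the upper left part of array `0`. -/
def Computes {F : Type} [Field F] [DecidableEq F] (P : Program) (n : List ℕ)
    (A : List (ℕ → ℕ → F)) (a b : ℕ) (M : ℕ → ℕ → F) (t : ℕ) : Prop :=
  (∀ i < a, ∀ j < b, (P.run (Memory.load n A)).1.arr 0 i j = M i j) ∧
    (P.run (Memory.load n A)).2 ≤ t

end Program

/-- There are three programs, the same for all fields and all sizes, that carry out the hash
encoding at a source, the linear combination of packets at a node, and the decoding at a sink, in a
number of steps that is polynomial in the numbers of rows and columns of the matrices involved. -/
def HashCode.PolynomialTime : Prop :=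
  ∃ (pEnc pMix pDec : Program) (C k : ℕ), ∀ (F : Type) [Field F] [Finite F] [DecidableEq F],
    (∀ (r α d : ℕ) (w : Fin α → F) (H : Matrix (Fin r) (Fin α) F) (X : Matrix (Fin r) (Fin d) F),
      pEnc.Computes [r, α, d]
        [Program.ofMatrix (Matrix.of fun _ : Fin 1 => w), Program.ofMatrix H, Program.ofMatrix X]
        r (α + d) (Program.ofMatrix₂ (HashCode.encode w H X)) (C * (r + α + d + 1) ^ k)) ∧
    (∀ (a b c : ℕ) (G : Matrix (Fin a) (Fin b) F) (Q : Matrix (Fin b) (Fin c) F),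
      pMix.Computes [a, b, c] [Program.ofMatrix G, Program.ofMatrix Q]
        a c (Program.ofMatrix (G * Q)) (C * (a + b + c + 1) ^ k)) ∧
    (∀ (B r α d : ℕ) (Y : Matrix (Fin B) (Fin α ⊕ Fin d) F) (w : Fin α → F)
        (H : Matrix (Fin r) (Fin α) F),
      pDec.Computes [B, r, α, d]
        [Program.ofMatrix₂ Y, Program.ofMatrix (Matrix.of fun _ : Fin 1 => w), Program.ofMatrix H]
        r (α + d) (Program.ofMatrix₂ (HashCode.decode Y w H)) (C * (B + r + α + d + 1) ^ k))

/-! ### Uniform probability on a finite type -/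

/-! Converse. Take a minimum cut between `S` and a worst sink, and let the adversary overwrite `z`
of its links by a constant. For fixed randomness and secrets, and fixed messages outside `S`, the
sink then sees a function of the other `m_S - z` cut links, so at most `|A| ^ (m_S - z)` message
tuples are decoded correctly. Every tuple must be decoded with probability at least `1 / 2`; double
counting bounds the number of tuples by `2 * |A| ^ (m_S - z)`, and logarithms together with passage
to the closure give the region (`card_msg_le`, `Achievable.sum_le`).

Achievability rests on three events, each of probability close to `1`.

(1) Every source packet lies in the span of what a sink receives (`row_mem_receivedSpan`). Otherwise
a linear functional kills all received packets but not some source packet. Applied to all packets in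
the network it yields a scalar configuration: nonzero source scalars, zeros at the sink, and the
honest coding rule on all links outside the attacked set `Z`. Sort these configurations by the set
`U` of nodes with a nonzero input. An honest link leaving `U` obeys the rule with probability at
most `q ^ (-T)`, and comparing the free links with the cut `U` shows that the number of
configurations times this probability is at most `1`. Since nonzero multiples of a configuration are
configurations, the probability that one exists is at most `2 ^ |V| / (q - 1)`
(`uniformProb_confusable_le`). The set `Z` may depend on the observation, which is paid for by a
union bound over all link sets.

(2) The square Vandermonde block of every source is invertible, as it is when the evaluation points
are nonzero and distinct (`uniformProb_not_isUnit_le`).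

(3) No nonzero received combination has zero hash. The received space has dimension at most `D = T *
m`. For an invertible block, `H` and the check block `L` determine each other when the points `w`
are fixed, so `(w, L)` can be treated as uniform (`secretEquiv`). The adversary acts on node
randomness and on `[L X]` only, hence the received space does not depend on `w`. A fixed nonzero
vector has zero hash with probability at most `(n / q) ^ α`, since a nonzero polynomial must vanish
at `α` independent points; the exponent `α = D ^ 2 + 1 ≥ 2 * D` beats the `q ^ D` vectors of the
space.

On these events the true packets are the only solution of the decoder's system (`decode_eq`). With
`T = k = ⌊ℓ ^ (1/5)⌋` the field size is exponential and the packet length polynomial in `T`, so the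
errors vanish, while the check symbols occupy only a fraction of order `1 / T` of a block. These
parameters involve the network only through `m`.

Running time. Each task is reduced to products of matrices, powers and Gauss–Jordan elimination. The
second component of each row in the elimination remembers which combination of received packets it
is, so the solution can be read off; all loop bounds are linear expressions in the input sizes,
which gives polynomial time (`Bounded.exists_run_le`, `solve_spec`). -/

/-- The probability of the event `p` under the uniform distribution on `Ω`. -/
noncomputable def uniformProb {Ω : Type} (p : Ω → Prop) : ℝ :=
  (Nat.card {x // p x} : ℝ) / (Nat.card Ω : ℝ)

namespace uniformProb

variable {Ω : Type}

open Classical in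
theorem eq_sum [Fintype Ω] (p : Ω → Prop) :
    uniformProb p = (∑ x, if p x then (1 : ℝ) else 0) / (Fintype.card Ω : ℝ) := by
  rw [uniformProb, Nat.card_eq_fintype_card, Nat.card_eq_fintype_card, Fintype.card_subtype,
    Finset.sum_boole]

theorem nonneg (p : Ω → Prop) : 0 ≤ uniformProb p := by
  unfold uniformProb; positivity

theorem mono [Finite Ω] {p q : Ω → Prop} (h : ∀ x, p x → q x) :
    uniformProb p ≤ uniformProb q := by
  unfold uniformProb
  gcongr
  exact Nat.card_le_card_of_injective (fun x : {x // p x} => (⟨x.1, h _ x.2⟩ : {x // q x}))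
    fun a b hab => Subtype.ext (congrArg (fun y : {x // q x} => y.1) hab)

theorem le_one [Finite Ω] (p : Ω → Prop) : uniformProb p ≤ 1 := by
  unfold uniformProb
  refine div_le_one_of_le₀ ?_ (by positivity)
  exact_mod_cast Nat.card_le_card_of_injective (fun x : {x // p x} => x.1)
    Subtype.val_injective

theorem eq_zero {p : Ω → Prop} (h : ∀ x, ¬ p x) : uniformProb p = 0 := by
  have : IsEmpty {x // p x} := ⟨fun x => h _ x.2⟩
  simp [uniformProb]

theorem exists_le [Finite Ω] {Y : Type} [Fintype Y] (p : Y → Ω → Prop) :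
    uniformProb (fun x => ∃ y, p y x) ≤ ∑ y, uniformProb (p y) := by
  classical
  have := Fintype.ofFinite Ω
  simp_rw [eq_sum, ← Finset.sum_div]
  rw [Finset.sum_comm]
  gcongr with x
  split_ifs with h
  · obtain ⟨y, hy⟩ := h
    calc (1 : ℝ) = if p y x then 1 else 0 := by simp [hy]
      _ ≤ _ := Finset.single_le_sum (f := fun y => if p y x then (1 : ℝ) else 0)
        (fun y _ => by positivity) (Finset.mem_univ y)
  · positivity

theorem or_le [Finite Ω] (p q : Ω → Prop) :
    uniformProb (fun x => p x ∨ q x) ≤ uniformProb p + uniformProb q := by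
  have := exists_le (fun (b : Bool) => if b then p else q)
  simp only [Fintype.sum_bool, Bool.exists_bool] at this
  simpa [or_comm] using this

theorem not_eq [Finite Ω] [Nonempty Ω] (p : Ω → Prop) :
    uniformProb (fun x => ¬ p x) = 1 - uniformProb p := by
  classical
  have := Fintype.ofFinite Ω
  rw [eq_sum, eq_sum, eq_sub_iff_add_eq, ← add_div, ← Finset.sum_add_distrib,
    div_eq_one_iff_eq (by simp)]
  rw [Finset.sum_congr rfl (g := fun _ => (1 : ℝ)) (fun x _ => by by_cases h : p x <;> simp [h])]
  simp

theorem equiv {Ω' : Type} (e : Ω ≃ Ω') (p : Ω → Prop) :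
    uniformProb (fun y => p (e.symm y)) = uniformProb p := by
  unfold uniformProb
  rw [Nat.card_congr e]
  congr 2
  exact Nat.card_congr (e.subtypeEquiv fun x => by simp).symm

theorem pi_eq {κ : Type} [Fintype κ] {W : κ → Type} (p : ∀ i, W i → Prop) :
    uniformProb (fun f : ∀ i, W i => ∀ i, p i (f i)) = ∏ i, uniformProb (p i) := by
  unfold uniformProb
  rw [Finset.prod_div_distrib, Nat.card_pi, Nat.card_congr (Equiv.subtypePiEquivPi), Nat.card_pi]
  push_cast
  rfl

/-- Expected number of `y` with `b x y`, bounded above. -/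
theorem sum_le_of_card_le [Finite Ω] [Nonempty Ω] {Y : Type} [Fintype Y] (b : Ω → Y → Prop) (c : ℝ)
    (h : ∀ x, (Nat.card {y // b x y} : ℝ) ≤ c) : ∑ y, uniformProb (fun x => b x y) ≤ c := by
  classical
  have := Fintype.ofFinite Ω
  simp_rw [eq_sum, ← Finset.sum_div]
  rw [Finset.sum_comm, div_le_iff₀ (by simp [Fintype.card_pos])]
  calc _ ≤ ∑ _x : Ω, c := by
        gcongr with x
        have := h x
        rw [Nat.card_eq_fintype_card, Fintype.card_subtype] at this
        simpa [Finset.sum_boole] using this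
    _ = _ := by simp [mul_comm]

/-- Markov's inequality for the number of `y` with `b x y`. -/
theorem mul_le_sum [Finite Ω] [Nonempty Ω] {Y : Type} [Fintype Y] (p : Ω → Prop) (b : Ω → Y → Prop)
    (c : ℝ) (h : ∀ x, p x → c ≤ (Nat.card {y // b x y} : ℝ)) :
    c * uniformProb p ≤ ∑ y, uniformProb (fun x => b x y) := by
  classical
  have := Fintype.ofFinite Ω
  simp_rw [eq_sum, ← Finset.sum_div]
  rw [Finset.sum_comm, ← mul_div_assoc]
  gcongr
  rw [Finset.mul_sum]
  gcongr with x
  split_ifs with hx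
  · have := h x hx
    rw [Nat.card_eq_fintype_card, Fintype.card_subtype] at this
    simpa [Finset.sum_boole] using this
  · simp only [mul_zero]
    positivity

/-- A conditional bound for one component `get x` of a uniform `x` bounds the total probability. -/
theorem le_of_resample [Finite Ω] [Nonempty Ω] {W : Type} [Finite W] [Nonempty W] (get : Ω → W)
    (set : Ω → W → Ω) (get_set : ∀ x w, get (set x w) = w)
    (set_set : ∀ x w w', set (set x w) w' = set x w') (set_get : ∀ x, set x (get x) = x)
    (p : Ω → Prop) (c : ℝ) (h : ∀ x, uniformProb (fun w => p (set x w)) ≤ c) :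
    uniformProb p ≤ c := by
  classical
  have := Fintype.ofFinite Ω
  have := Fintype.ofFinite W
  -- The involution exchanging the component of `x.1` with the fresh value `x.2`: for independent
  -- uniform `x` and `w`, the point `set x w` is again uniform.
  let e : Ω × W ≃ Ω × W :=
    { toFun := fun x => (set x.1 x.2, get x.1)
      invFun := fun x => (set x.1 x.2, get x.1)
      left_inv := fun x => by simp [get_set, set_set, set_get]
      right_inv := fun x => by simp [get_set, set_set, set_get] }
  have hΩ : (0 : ℝ) < Fintype.card Ω := by simp [Fintype.card_pos]
  have hW : (0 : ℝ) < Fintype.card W := by simp [Fintype.card_pos]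
  have h1 : (∑ x : Ω, if p x then (1 : ℝ) else 0) * Fintype.card W
      = ∑ x : Ω, ∑ w : W, if p (set x w) then (1 : ℝ) else 0 := by
    rw [← Fintype.sum_prod_type', ← Equiv.sum_comp e.symm, Fintype.sum_prod_type]
    simp only [Finset.sum_mul, e, Equiv.coe_fn_symm_mk, set_set, set_get]
    simp [mul_comm]
  have h2 : ∀ x : Ω, (∑ w : W, if p (set x w) then (1 : ℝ) else 0) ≤ c * Fintype.card W := by
    intro x
    have := h x
    rwa [eq_sum, div_le_iff₀ hW] at this
  rw [eq_sum, div_le_iff₀ hΩ]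
  refine le_of_mul_le_mul_right ?_ hW
  rw [h1]
  calc _ ≤ ∑ _x : Ω, c * Fintype.card W := Finset.sum_le_sum fun x _ => h2 x
    _ = _ := by simp; ring

end uniformProb

/-! ### Cuts and the converse -/

namespace Network

variable {V E ι τ : Type}

theorem minCutTo_le [Fintype E] [DecidableEq V] (N : Network V E ι τ) {S : Finset ι} {t : τ}
    {U : Finset V} (hS : ∀ i ∈ S, N.src i ∈ U) (ht : N.snk t ∉ U) :
    N.minCutTo S t ≤ N.cutCapacity U :=
  Nat.sInf_le ⟨U, hS, ht, rfl⟩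

theorem minCut_le_minCutTo [Fintype E] [DecidableEq V] (N : Network V E ι τ) (S : Finset ι) (t : τ) :
    N.minCut S ≤ N.minCutTo S t :=
  ciInf_le (OrderBot.bddBelow _) t

theorem minCut_le_cutCapacity [Fintype E] [DecidableEq V] (N : Network V E ι τ) {S : Finset ι}
    {t : τ} {U : Finset V} (hS : ∀ i ∈ S, N.src i ∈ U) (ht : N.snk t ∉ U) :
    N.minCut S ≤ N.cutCapacity U :=
  (N.minCut_le_minCutTo S t).trans (N.minCutTo_le hS ht)

theorem exists_minCut_eq [Fintype V] [Fintype E] [DecidableEq V] [Nonempty τ]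
    (N : Network V E ι τ) (S : Finset ι) :
    ∃ (t : τ) (U : Finset V), (∀ i ∈ S, N.src i ∈ U) ∧ N.snk t ∉ U ∧
      N.minCut S = N.cutCapacity U := by
  obtain ⟨t, ht⟩ := ciInf_mem (fun t => N.minCutTo S t)
  -- Over an empty set the infimum would be the default `0`. Separating the sink alone from all
  -- other nodes is always an admissible cut, because no source is a sink.
  have hne : {c | ∃ U : Finset V, (∀ i ∈ S, N.src i ∈ U) ∧ N.snk t ∉ U ∧
      c = N.cutCapacity U}.Nonempty :=
    ⟨_, Finset.univ.erase (N.snk t), fun i _ => by simp [N.src_ne_snk], by simp, rfl⟩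
  obtain ⟨U, hU, htU, h⟩ := Nat.sInf_mem hne
  exact ⟨t, U, hU, htU, ht.symm.trans h⟩

theorem minCut_mono [Fintype V] [Fintype E] [DecidableEq V] [Nonempty τ]
    (N : Network V E ι τ) {S S' : Finset ι} (h : S ⊆ S') : N.minCut S ≤ N.minCut S' := by
  obtain ⟨t, U, hU, ht, e⟩ := N.exists_minCut_eq S'
  exact e ▸ N.minCut_le_cutCapacity (fun i hi => hU i (h hi)) ht

theorem isClosed_rateRegion [Fintype E] [DecidableEq V] (N : Network V E ι τ) (z : ℕ) :
    IsClosed (N.rateRegion z) := by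
  simp only [rateRegion, ofPred_and, ofPred_forall]
  refine IsClosed.inter (isClosed_iInter fun i => isClosed_le continuous_const
    (continuous_apply i)) (isClosed_iInter fun S => isClosed_iInter fun _ => isClosed_le
    (continuous_finsetSum _ fun i _ => continuous_apply i) continuous_const)

/-! ### Converse: counting messages across a cut. -/

namespace Code

variable {N : Network V E ι τ} {A : Type}

/-- What happens behind a cut depends only on the messages behind the cut and on what crosses it. -/
theorem received_congr_of_cut [Finite V] (c : Code N A) {w w' : ∀ i, c.Msg i} (g : ∀ v, c.Seed v)
    (κ : ∀ i, c.Key i) (x : E → Option A) (U : Set V) (hw : ∀ i, N.src i ∉ U → w i = w' i)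
    (hcut : ∀ e, N.tail e ∈ U → N.head e ∉ U → c.received w g κ x e = c.received w' g κ x e)
    (e : E) (he : N.head e ∉ U) : c.received w g κ x e = c.received w' g κ x e := by
  induction e using N.wellFounded_feeds.induction with
  | _ e ih =>
    by_cases ht : N.tail e ∈ U
    · exact hcut e ht he
    · rw [received_eq, received_eq c w']
      congr 2
      · funext i hi
        exact hw i (hi ▸ ht)
      · funext e'
        exact ih e'.1 e'.2 (by rw [e'.2]; exact ht)

/-- With the links in `Z` frozen, the contents of the remaining cut links determine everything
behind the cut, since the messages that may vary belong to sources in `U`. The sink lies behind the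
cut, so two correctly decoded tuples with the same contents there coincide. -/
theorem card_not_fails_le [Fintype V] [Fintype E] [DecidableEq V] [Finite A] (c : Code N A)
    (a₀ : A) (S : Finset ι) (t : τ) (U : Finset V) (hS : ∀ i ∈ S, N.src i ∈ U)
    (ht : N.snk t ∉ U) (Z : Finset E)
    (hZ : Z ⊆ Finset.univ.filter fun e => N.tail e ∈ U ∧ N.head e ∉ U) (a : c.Attack)
    (ha : ∀ o e, e ∈ Z → a o e = some a₀) (ha' : ∀ o e, e ∉ Z → a o e = none)
    (w : (∀ i : S, c.Msg i) → ∀ i, c.Msg i) (hwS : ∀ u (i : S), w u i = u i)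
    (hw : ∀ u u' i, i ∉ S → w u i = w u' i) (g : ∀ v, c.Seed v) (κ : ∀ i, c.Key i) :
    Nat.card {u : ∀ i : S, c.Msg i // ¬ c.Fails (w u) a g κ} ≤
      Nat.card A ^ (N.cutCapacity U - Z.card) := by
  classical
  have := Fintype.ofFinite A
  let x : E → Option A := fun e => if e ∈ Z then some a₀ else none
  have hx : ∀ o, a o = x := by
    intro o
    funext e
    by_cases h : e ∈ Z
    · simp [x, h, ha]
    · simp [x, h, ha']
  let D := (Finset.univ.filter fun e => N.tail e ∈ U ∧ N.head e ∉ U) \ Z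
  have hD : Nat.card (D → A) = Nat.card A ^ (N.cutCapacity U - Z.card) := by
    rw [Nat.card_fun, Nat.card_eq_fintype_card (α := D), Fintype.card_coe, Finset.card_sdiff_of_subset hZ]
    rfl
  rw [← hD]
  refine Nat.card_le_card_of_injective
    (fun u => fun e : D => c.received (w u.1) g κ x e.1) ?_
  rintro ⟨u, hu⟩ ⟨u', hu'⟩ h
  have hr : ∀ e, N.head e ∉ (U : Set V) →
      c.received (w u) g κ x e = c.received (w u') g κ x e := by
    refine c.received_congr_of_cut g κ x U (fun i hi => hw u u' i fun hiS => hi (hS i hiS)) ?_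
    intro e h1 h2
    by_cases heZ : e ∈ Z
    · rw [received_eq, received_eq c (w u')]
      simp [x, heZ]
    · exact congrFun h ⟨e, by simp [D, heZ]; exact ⟨h1, h2⟩⟩
  simp only [Fails, hx, not_exists, not_not] at hu hu'
  have key : w u = w u' := by
    rw [← hu t, ← hu' t]
    congr 1
    funext e
    exact hr e.1 (by rw [e.2]; exact ht)
  ext i
  change u i = u' i
  rw [← hwS u, ← hwS u', key]

/-- A code that survives the loss of `Z.card` links of a cut cannot have more messages than the rest
of the cut has transmissions, up to the error probability. -/
theorem card_msg_le [Fintype V] [Fintype E] [DecidableEq V] [Nonempty A] [Finite A]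
    (c : Code N A) [Finite ι] (z : ℕ)
    (S : Finset ι) (t : τ) (U : Finset V) (hS : ∀ i ∈ S, N.src i ∈ U)
    (ht : N.snk t ∉ U) (hz : z ≤ N.cutCapacity U)
    (h : ∀ (w : ∀ i, c.Msg i) (a : c.Attack), a.Fixed z → c.errorProb w a < 1 / 2) :
    ∏ i ∈ S, (Nat.card (c.Msg i) : ℝ) ≤ 2 * (Nat.card A : ℝ) ^ (N.cutCapacity U - z) := by
  classical
  have i1 := c.finite_msg
  have i2 := c.finite_key
  have i3 := c.finite_seed
  have i4 := c.nonempty_msg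
  have i5 := c.nonempty_key
  have i6 := c.nonempty_seed
  have a₀ : A := Classical.arbitrary A
  obtain ⟨Z, hZ, rfl⟩ := Finset.exists_subset_card_eq hz
  let a : c.Attack := fun _ e => if e ∈ Z then some a₀ else none
  let w₀ : ∀ i, c.Msg i := fun i => Classical.arbitrary _
  let w : (∀ i : S, c.Msg i) → ∀ i, c.Msg i := fun u i => if hi : i ∈ S then u ⟨i, hi⟩ else w₀ i
  have hfix : a.Fixed Z.card := ⟨Z, le_rfl, fun o e he => by simp [a, he]⟩
  have := Fintype.ofFinite (∀ i : S, c.Msg i)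
  have hlow : ∀ u, (1 : ℝ) / 2 ≤
      uniformProb fun x : (∀ v, c.Seed v) × (∀ i, c.Key i) => ¬ c.Fails (w u) a x.1 x.2 := by
    intro u
    rw [uniformProb.not_eq]
    have : uniformProb (fun x : (∀ v, c.Seed v) × (∀ i, c.Key i) => c.Fails (w u) a x.1 x.2)
      < 1 / 2 := h (w u) a hfix
    linarith
  -- The same incidences counted the other way: each outcome of the randomness lets few messages
  -- through, whereas by `hlow` each message gets through for at least half of the outcomes.
  have hup := uniformProb.sum_le_of_card_le
    (fun (x : (∀ v, c.Seed v) × (∀ i, c.Key i)) u => ¬ c.Fails (w u) a x.1 x.2)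
    ((Nat.card A : ℝ) ^ (N.cutCapacity U - Z.card)) (fun x => by
      exact_mod_cast c.card_not_fails_le a₀ S t U hS ht Z hZ a (fun o e he => by simp [a, he])
        (fun o e he => by simp [a, he]) w (fun u i => by simp [w])
        (fun u u' i hi => by simp [w, hi]) x.1 x.2)
  have hsum := (Finset.sum_le_sum fun u (_ : u ∈ Finset.univ) => hlow u).trans hup
  have hcard : ∏ i ∈ S, (Nat.card (c.Msg i) : ℝ) = Fintype.card (∀ i : S, c.Msg i) := by
    rw [← Nat.card_eq_fintype_card, Nat.card_pi, ← Finset.prod_coe_sort]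
    push_cast
    rfl
  rw [hcard]
  simp at hsum
  linarith

end Code

-- Taking logarithms in `card_msg_le` leaves the error term `logb 2`, which disappears after
-- division by `ℓ`.
open Filter Topology in
theorem Achievable.sum_le [Fintype V] [Fintype E] [DecidableEq V] [Fintype ι] [Nonempty τ]
    {N : Network V E ι τ} {K : Type} [Field K] [Finite K] {z : ℕ} {R : ι → ℝ}
    (hR : N.Achievable K z R) (S : Finset ι) (hz : z ≤ N.minCut S) :
    ∑ i ∈ S, R i ≤ (N.minCut S : ℝ) - z := by
  obtain ⟨c, hc⟩ := hR
  obtain ⟨t, U, hU, ht, hcut⟩ := N.exists_minCut_eq S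
  rw [hcut] at hz ⊢
  have hK : (1 : ℝ) < Nat.card K := by exact_mod_cast Finite.one_lt_card
  -- One `ε` for each rate in `S`, and one more for the factor `2`.
  have key : ∀ ε > (0 : ℝ), ∑ i ∈ S, R i ≤ (N.cutCapacity U : ℝ) - z + (S.card + 1) * ε := by
    intro ε hε
    obtain ⟨L, hL⟩ := hc ε hε (1 / 2) (by norm_num)
    obtain ⟨n, hn⟩ := exists_nat_gt (Real.logb (Nat.card K) 2 / ε)
    set ℓ := max (L + 1) n with hℓdef
    have hℓ0 : (0 : ℝ) < ℓ := by
      have : 0 < ℓ := by omega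
      exact_mod_cast this
    obtain ⟨h1, h2⟩ := hL ℓ (by omega)
    have i1 := (c ℓ).finite_msg
    have i4 := (c ℓ).nonempty_msg
    have h3 := (c ℓ).card_msg_le z S t U hU ht hz h2
    have h4 := Real.logb_le_logb_of_le hK (Finset.prod_pos fun i _ => by
      exact_mod_cast Nat.card_pos (α := (c ℓ).Msg i)) h3
    rw [Real.logb_prod _ _ (fun i _ => by
      exact_mod_cast Nat.card_pos.ne'), Real.logb_mul (by norm_num)
      (by have := Nat.card_pos (α := Fin ℓ → K); positivity), Real.logb_pow, Nat.card_fun] at h4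
    rw [Nat.card_fin] at h4
    push_cast at h4
    rw [Real.logb_pow, Real.logb_self_eq_one hK, Nat.cast_sub hz] at h4
    have h5 : Real.logb (Nat.card K) 2 ≤ ε * ℓ := by
      rw [div_lt_iff₀ hε] at hn
      have : (n : ℝ) ≤ ℓ := by exact_mod_cast le_max_right _ _
      nlinarith
    have h6 : (∑ i ∈ S, (R i - ε)) * ℓ ≤ ∑ i ∈ S, Real.logb (Nat.card K) (Nat.card ((c ℓ).Msg i)) := by
      rw [Finset.sum_mul]
      exact Finset.sum_le_sum fun i _ => (le_div_iff₀ hℓ0).1 (h1 i)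
    rw [Finset.sum_sub_distrib, Finset.sum_const, nsmul_eq_mul] at h6
    have : (∑ i ∈ S, R i - S.card * ε) * ℓ ≤ (ε + (N.cutCapacity U - z)) * ℓ := by
      nlinarith
    have := le_of_mul_le_mul_right this hℓ0
    linarith
  refine le_of_forall_pos_le_add fun ε hε => ?_
  have := key (ε / (S.card + 1)) (by positivity)
  rwa [mul_div_cancel₀ _ (by positivity)] at this

theorem capacityRegion_subset [Fintype V] [Fintype E] [DecidableEq V] [Fintype ι] [Nonempty τ]
    (N : Network V E ι τ) (K : Type) [Field K] [Finite K] (z : ℕ) (hz : ∀ i, z ≤ N.minCut {i}) :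
    N.capacityRegion K z ⊆ N.rateRegion z := by
  refine closure_minimal ?_ (N.isClosed_rateRegion z)
  rintro R ⟨h0, hR⟩
  refine ⟨h0, fun S hS => hR.sum_le S ?_⟩
  obtain ⟨i, hi⟩ := hS
  exact (hz i).trans (N.minCut_mono (by simpa using hi))

end Network

/-! ### Random linear network coding -/

namespace uniformProb

theorem le_div_card {Ω : Type} (p : Ω → Prop) (n : ℕ) (h : Nat.card {x // p x} ≤ n) :
    uniformProb p ≤ n / (Nat.card Ω : ℝ) := by
  unfold uniformProb
  gcongr

/-- Once the other coordinates of `ρ` are fixed, the equation determines the coordinate at an index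
where `a` is nonzero. -/
theorem dotProduct_eq_le {F : Type} [Field F] [Finite F] {J : Type} [Fintype J] (a : J → F)
    (ha : a ≠ 0) (c : F) : uniformProb (fun ρ : J → F => c = ρ ⬝ᵥ a) ≤ (Nat.card F : ℝ)⁻¹ := by
  classical
  obtain ⟨j, hj⟩ := Function.ne_iff.1 ha
  refine le_of_resample (fun ρ => ρ j) (fun ρ s => Function.update ρ j s) (by simp) (by simp)
    (by simp) _ _ fun ρ => ?_
  rw [← one_div]
  refine (le_div_card _ 1 ?_).trans (by simp)
  rw [Finite.card_le_one_iff_subsingleton]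
  refine ⟨fun s s' => Subtype.ext ?_⟩
  have h : ∀ s : F, Function.update ρ j s ⬝ᵥ a = s * a j + ∑ k ∈ Finset.univ.erase j, ρ k * a k := by
    intro s
    rw [dotProduct, ← Finset.add_sum_erase _ _ (Finset.mem_univ j), Function.update_self]
    congr 1
    refine Finset.sum_congr rfl fun k hk => ?_
    rw [Function.update_of_ne (Finset.ne_of_mem_erase hk)]
  have h1 := s.2.symm.trans s'.2
  rw [h, h] at h1
  exact mul_right_cancel₀ hj (add_right_cancel h1)

theorem mulVec_eq_le {F : Type} [Field F] [Finite F] {J : Type} [Fintype J] {T : ℕ} (a : J → F)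
    (ha : a ≠ 0) (c : Fin T → F) :
    uniformProb (fun G : Matrix (Fin T) J F => c = G *ᵥ a) ≤ ((Nat.card F : ℝ) ^ T)⁻¹ := by
  have h := pi_eq (fun (t : Fin T) (ρ : J → F) => c t = ρ ⬝ᵥ a)
  have : uniformProb (fun G : Matrix (Fin T) J F => c = G *ᵥ a) =
      uniformProb (fun G : Fin T → J → F => ∀ t, c t = G t ⬝ᵥ a) := by
    congr 1
    funext G
    rw [funext_iff]
    rfl
  rw [this, h]
  calc _ ≤ ∏ _t : Fin T, (Nat.card F : ℝ)⁻¹ :=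
        Finset.prod_le_prod (fun _ _ => nonneg _) fun t _ => dotProduct_eq_le a ha _
    _ = _ := by simp

end uniformProb

namespace RandomCoding

variable {V E ι τ : Type}

/-- The packets available at the node `v`: those that arrive and those of the sources at `v`. -/
abbrev Inputs (N : Network V E ι τ) (T : ℕ) (r : ι → ℕ) (v : V) : Type :=
  ({e' // N.head e' = v} × Fin T) ⊕ (Σ i : {i // N.src i = v}, Fin (r i))

/-- The coefficients of the linear combinations formed at all nodes. -/
abbrev Coeff (N : Network V E ι τ) (F : Type) (T : ℕ) (r : ι → ℕ) : Type :=
  ∀ v, ∀ _ : {e // N.tail e = v}, Matrix (Fin T) (Inputs N T r v) F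

/-- The scalars available at `v` when the sources have the scalars `x` and the links carry `y`. -/
def input (N : Network V E ι τ) {F : Type} {T : ℕ} {r : ι → ℕ} (x : ∀ i, Fin (r i) → F)
    (y : E → Fin T → F) (v : V) : Inputs N T r v → F :=
  Sum.elim (fun p => y p.1.1 p.2) (fun p => x p.1.1 p.2)

variable (N : Network V E ι τ) {F : Type} [Field F] {T : ℕ} {r : ι → ℕ}

open Classical in
/-- The links on which scalars are unconstrained are few compared with the constraints. -/
theorem exponent_le [Fintype E] [DecidableEq V] {z : ℕ} (Z : Finset E) (hZ : Z.card ≤ z) (U : Finset V) (t : τ)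
    (ht : N.snk t ∉ U) (S : Finset ι) (hSU : ∀ i ∈ S, N.src i ∈ U)
    (hr : ∑ i ∈ S, r i + T * z ≤ T * N.minCut S) :
    ∑ i ∈ S, r i + T * (Finset.univ.filter fun e => N.head e ∈ U ∧
      (e ∉ Z → N.tail e ∈ U)).card ≤
      T * (Finset.univ.filter fun e => e ∉ Z ∧ N.tail e ∈ U).card := by
  have h1 := N.minCut_le_cutCapacity hSU ht
  -- Links leaving `U` and free links end on different sides of `U`, so they are disjoint; each of
  -- them lies in `Z` or is an honest link leaving a node of `U`.
  have h2 : N.cutCapacity U + (Finset.univ.filter fun e => N.head e ∈ U ∧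
      (e ∉ Z → N.tail e ∈ U)).card ≤
      Z.card + (Finset.univ.filter fun e => e ∉ Z ∧ N.tail e ∈ U).card := by
    unfold Network.cutCapacity
    rw [← Finset.card_union_of_disjoint, ← Finset.card_union_of_disjoint]
    · refine Finset.card_le_card fun e => ?_
      simp only [Finset.mem_union, Finset.mem_filter, Finset.mem_univ, true_and]
      tauto
    · rw [Finset.disjoint_left]
      intro e he
      simp [he]
    · rw [Finset.disjoint_left]
      intro e he
      simp at he ⊢
      tauto
  have h3 := Nat.mul_le_mul_left T h1
  have h4 := Nat.mul_le_mul_left T h2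
  have h5 := Nat.mul_le_mul_left T hZ
  rw [mul_add, mul_add] at h4
  omega

/-! ### Scalar configurations that hide source data from a sink. -/

section

variable [Fintype E] [Fintype ι] [DecidableEq V]

/-- The scalars `y` on the links outside `Z` are produced by the coefficients `g`. -/
def Consistent (g : Coeff N F T r) (Z : Finset E) (x : ∀ i, Fin (r i) → F) (y : E → Fin T → F) :
    Prop :=
  ∀ e, e ∉ Z → y e = g (N.tail e) ⟨e, rfl⟩ *ᵥ input N x y (N.tail e)

/-- Some nonzero scalars of the sources can be made to vanish at the sink `t` by controlling the
links in `Z`. -/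
def Confusable (g : Coeff N F T r) (t : τ) (Z : Finset E) : Prop :=
  ∃ p : (∀ i, Fin (r i) → F) × (E → Fin T → F),
    p.1 ≠ 0 ∧ (∀ e, N.head e = N.snk t → p.2 e = 0) ∧ Consistent N g Z p.1 p.2

/-- Coefficients may be listed link by link. -/
def coeffEquiv : Coeff N F T r ≃ ∀ e, Matrix (Fin T) (Inputs N T r (N.tail e)) F where
  toFun g e := g (N.tail e) ⟨e, rfl⟩
  invFun h _ e := e.2 ▸ h e.1
  left_inv g := by
    funext v ⟨e, he⟩
    subst he
    rfl
  right_inv h := rfl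

theorem uniformProb_consistent [Finite F] (Z : Finset E) (x : ∀ i, Fin (r i) → F)
    (y : E → Fin T → F) :
    uniformProb (fun g : Coeff N F T r => Consistent N g Z x y) =
      ∏ e, uniformProb (fun G : Matrix (Fin T) (Inputs N T r (N.tail e)) F =>
        e ∉ Z → y e = G *ᵥ input N x y (N.tail e)) := by
  rw [← uniformProb.pi_eq, ← uniformProb.equiv (coeffEquiv N)]
  rfl

-- The coefficients on different links are independent. An honest link leaving a node with nonzero
-- input has to hit a prescribed vector of `T` scalars. One leaving a node with zero input carries
-- zero for certain, so a nonzero prescription there is impossible.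
open Classical in
theorem uniformProb_consistent_le [Finite F] (Z : Finset E) (x : ∀ i, Fin (r i) → F)
    (y : E → Fin T → F) (U : Finset V) (hU : ∀ v, v ∈ U ↔ input N x y v ≠ 0) :
    uniformProb (fun g : Coeff N F T r => Consistent N g Z x y) ≤
      if ∀ e, e ∉ Z → N.tail e ∉ U → y e = 0 then
        (((Nat.card F : ℝ) ^ T)⁻¹) ^ (Finset.univ.filter fun e => e ∉ Z ∧ N.tail e ∈ U).card
      else 0 := by
  rw [uniformProb_consistent]
  split_ifs with h
  · rw [← Finset.prod_const, Finset.prod_filter]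
    refine Finset.prod_le_prod (fun _ _ => uniformProb.nonneg _) fun e _ => ?_
    split_ifs with he
    · refine le_trans (uniformProb.mono fun G hG => hG he.1) ?_
      exact uniformProb.mulVec_eq_le _ ((hU _).1 he.2) _
    · exact uniformProb.le_one _
  · push Not at h
    obtain ⟨e, he, hU', hy⟩ := h
    refine (Finset.prod_eq_zero (Finset.mem_univ e) (uniformProb.eq_zero fun G hG => hy ?_)).le
    have := hG he
    rw [hU, not_not] at hU'
    rwa [hU', mulVec_zero] at this

open Classical in
/-- Source scalars that vanish outside `S` and link scalars that vanish outside `D`. -/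
theorem card_support_le [Finite F] (S : Finset ι) (D : Finset E) :
    Nat.card {p : (∀ i, Fin (r i) → F) × (E → Fin T → F) //
      (∀ i, i ∉ S → p.1 i = 0) ∧ (∀ e, e ∉ D → p.2 e = 0)} ≤
      Nat.card F ^ (∑ i ∈ S, r i + T * D.card) := by
  have h : Nat.card ((∀ i : S, Fin (r i) → F) × (D → Fin T → F)) =
      Nat.card F ^ (∑ i ∈ S, r i + T * D.card) := by
    rw [Nat.card_prod, Nat.card_pi, Nat.card_fun, pow_add]
    simp only [Nat.card_fun, Nat.card_eq_fintype_card (α := Fin _), Fintype.card_fin]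
    rw [Finset.prod_coe_sort S fun i => Nat.card F ^ r i, Finset.prod_pow_eq_pow_sum, ← pow_mul]
    simp
  rw [← h]
  refine Nat.card_le_card_of_injective (fun p => (fun i => p.1.1 i, fun e => p.1.2 e)) ?_
  rintro ⟨⟨x, y⟩, hx, hy⟩ ⟨⟨x', y'⟩, hx', hy'⟩ hp
  simp only [Prod.mk.injEq, Subtype.mk.injEq] at hp ⊢
  constructor
  · funext i
    by_cases hi : i ∈ S
    · exact congrFun hp.1 ⟨i, hi⟩
    · exact (hx i hi).trans (hx' i hi).symm
  · funext e
    by_cases he : e ∈ D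
    · exact congrFun hp.2 ⟨e, he⟩
    · exact (hy e he).trans (hy' e he).symm

/-- First-moment bound. For each set `U` of active nodes, the number of configurations times the
probability of one is at most `1` by `card_support_le` and `exponent_le`, so the expected number of
consistent configurations is at most `2 ^ |V|`. Consistency is homogeneous: one configuration brings
all its `q - 1` nonzero multiples, and Markov's inequality gains the factor `q - 1`. -/
theorem uniformProb_confusable_le [Fintype V] [Finite F] {z : ℕ}
    (hr : ∀ S : Finset ι, S.Nonempty → ∑ i ∈ S, r i + T * z ≤ T * N.minCut S)
    (t : τ) (Z : Finset E) (hZ : Z.card ≤ z) :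
    uniformProb (fun g : Coeff N F T r => Confusable N g t Z) ≤
      2 ^ Fintype.card V / ((Nat.card F : ℝ) - 1) := by
  classical
  have := Fintype.ofFinite F
  have hF : (1 : ℝ) < Nat.card F := by exact_mod_cast Finite.one_lt_card
  rw [le_div_iff₀ (by linarith), mul_comm]
  refine (uniformProb.mul_le_sum (Y := (∀ i, Fin (r i) → F) × (E → Fin T → F)) _
    (fun g p => p.1 ≠ 0 ∧ (∀ e, N.head e = N.snk t → p.2 e = 0) ∧ Consistent N g Z p.1 p.2)
    _ ?_).trans ?_
  · rintro g ⟨p, hp, hpt, hg⟩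
    have hc : (Nat.card F : ℝ) - 1 = Nat.card {c : F // c ≠ 0} := by
      have h := Fintype.card_subtype_compl (fun c : F => c = 0)
      rw [Fintype.card_subtype_eq] at h
      have h' := Fintype.one_lt_card (α := F)
      rw [Nat.card_eq_fintype_card, Nat.card_eq_fintype_card, h, Nat.cast_sub h'.le]
      simp
    rw [hc]
    have hi : ∀ (c : F) v, input N (c • p.1) (c • p.2) v = c • input N p.1 p.2 v := by
      intro c v
      funext j
      rcases j with j | j <;> rfl
    exact_mod_cast Nat.card_le_card_of_injective
      (fun c : {c : F // c ≠ 0} => (⟨c.1 • p, by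
        refine ⟨smul_ne_zero c.2 hp, fun e he => ?_, fun e he => ?_⟩
        · simp [hpt e he]
        · simp only [Prod.smul_fst, Prod.smul_snd, Pi.smul_apply, hi, mulVec_smul]
          rw [← hg e he]⟩ : {p : (∀ i, Fin (r i) → F) × (E → Fin T → F) //
            p.1 ≠ 0 ∧ (∀ e, N.head e = N.snk t → p.2 e = 0) ∧ Consistent N g Z p.1 p.2}))
      (fun c c' h => by
        have h1 := congrArg (fun y => y.1.1) h
        exact Subtype.ext (smul_left_injective F hp h1))
  · let act : (∀ i, Fin (r i) → F) × (E → Fin T → F) → Finset V :=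
      fun p => Finset.univ.filter fun v => input N p.1 p.2 v ≠ 0
    rw [← Finset.sum_fiberwise (s := Finset.univ) (g := act)]
    calc _ ≤ ∑ _U : Finset V, (1 : ℝ) := Finset.sum_le_sum fun U _ => ?_
      _ = _ := by simp
    set S : Finset ι := Finset.univ.filter fun i => N.src i ∈ U with hS
    -- A link into an inactive node carries zero, and so does an honest link from an inactive node.
    -- Only the links in `D` are free.
    set D : Finset E := Finset.univ.filter fun e => N.head e ∈ U ∧ (e ∉ Z → N.tail e ∈ U) with hD
    set n := (Finset.univ.filter fun e => e ∉ Z ∧ N.tail e ∈ U).card with hn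
    have hfib : ∀ p, act p = U →
        uniformProb (fun g : Coeff N F T r =>
          p.1 ≠ 0 ∧ (∀ e, N.head e = N.snk t → p.2 e = 0) ∧ Consistent N g Z p.1 p.2) ≤
        if N.snk t ∉ U ∧ S.Nonempty ∧ (∀ i, i ∉ S → p.1 i = 0) ∧ (∀ e, e ∉ D → p.2 e = 0) then
          (((Nat.card F : ℝ) ^ T)⁻¹) ^ n else 0 := by
      rintro p rfl
      have hact : ∀ v, v ∈ act p ↔ input N p.1 p.2 v ≠ 0 := by simp [act]
      have hact_src : ∀ i, p.1 i ≠ 0 → N.src i ∈ act p := by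
        intro i hi
        rw [hact]
        intro h
        apply hi
        funext a
        exact congrFun h (Sum.inr ⟨⟨i, rfl⟩, a⟩)
      have hact_head : ∀ e, p.2 e ≠ 0 → N.head e ∈ act p := by
        intro e he
        rw [hact]
        intro h
        apply he
        funext a
        exact congrFun h (Sum.inl ⟨⟨e, rfl⟩, a⟩)
      by_cases h1 : p.1 ≠ 0 ∧ (∀ e, N.head e = N.snk t → p.2 e = 0)
      · have hprob := uniformProb_consistent_le N Z p.1 p.2 (act p) hact
        refine le_trans (uniformProb.mono fun g hg => hg.2.2) (hprob.trans ?_)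
        split_ifs with h2 h3 h3
        · exact le_rfl
        · refine absurd ⟨?_, ?_, ?_, ?_⟩ h3
          -- The sink is inactive: its inputs are link scalars that vanish, as no source sits at a
          -- sink.
          · rw [hact, not_not]
            funext j
            rcases j with ⟨⟨e, he⟩, a⟩ | ⟨⟨i, hi⟩, a⟩
            · exact congrFun (h1.2 e he) a
            · exact absurd hi (N.src_ne_snk i t)
          · obtain ⟨i, hi⟩ := Function.ne_iff.1 h1.1
            exact ⟨i, by simpa [hS] using hact_src i hi⟩
          · intro i hi
            by_contra h
            exact hi (by simpa [hS] using hact_src i h)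
          · intro e he
            by_contra h
            refine he ?_
            simp only [hD, Finset.mem_filter, Finset.mem_univ, true_and]
            refine ⟨hact_head e h, fun heZ => ?_⟩
            by_contra h'
            exact h (h2 e heZ h')
        · positivity
        · exact le_rfl
      · rw [uniformProb.eq_zero fun g hg => h1 ⟨hg.1, hg.2.1⟩]
        positivity
    refine (Finset.sum_le_sum fun p hp => hfib p (by simpa using hp)).trans ?_
    refine (Finset.sum_le_sum_of_subset_of_nonneg (Finset.filter_subset _ _)
      fun _ _ _ => by positivity).trans ?_
    by_cases hU : N.snk t ∉ U ∧ S.Nonempty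
    · simp only [hU.1, hU.2, not_false_eq_true, true_and]
      rw [← Finset.sum_filter, Finset.sum_const, nsmul_eq_mul, inv_pow, ← div_eq_mul_inv,
        div_le_one (by positivity), ← pow_mul]
      have h1 := card_support_le (F := F) (T := T) (r := r) S D
      rw [Nat.card_eq_fintype_card, Fintype.card_subtype] at h1
      have h2 := exponent_le N (r := r) (T := T) Z hZ U t hU.1 S (by simp [hS]) (hr S hU.2)
      have h3 := h1.trans (Nat.pow_le_pow_right Nat.card_pos h2)
      exact_mod_cast h3
    · rw [Finset.sum_eq_zero]
      · exact zero_le_one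
      · intro p _
        rw [if_neg]
        tauto

end

/-- The packets that arrive at the end of every link when the sources have the packets `M`, and the
contents of the links are replaced as prescribed by `x`. -/
noncomputable def packets [Finite V] [Fintype E] [Fintype ι] [DecidableEq V] {n : Type}
    (g : Coeff N F T r) (M : ∀ i, Matrix (Fin (r i)) n F)
    (x : E → Option (Matrix (Fin T) n F)) : E → Matrix (Fin T) n F :=
  N.wellFounded_feeds.fix fun e y =>
    (x e).getD (g (N.tail e) ⟨e, rfl⟩ * Matrix.fromRows
      (Matrix.of fun p : {e' // N.head e' = N.tail e} × Fin T => (y p.1.1 p.1.2).row p.2)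
      (Matrix.of fun p : (Σ i : {i // N.src i = N.tail e}, Fin (r i)) => (M p.1.1).row p.2))

/-! ### Vector packets and the space received by a sink. -/

section

variable [Finite V] [Fintype E] [Fintype ι] [DecidableEq V] {n : Type}

theorem packets_eq (g : Coeff N F T r) (M : ∀ i, Matrix (Fin (r i)) n F)
    (x : E → Option (Matrix (Fin T) n F)) (e : E) :
    packets N g M x e = (x e).getD (g (N.tail e) ⟨e, rfl⟩ * Matrix.fromRows
      (Matrix.of fun p : {e' // N.head e' = N.tail e} × Fin T => (packets N g M x p.1.1).row p.2)
      (Matrix.of fun p : (Σ i : {i // N.src i = N.tail e}, Fin (r i)) => (M p.1.1).row p.2)) := by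
  unfold packets
  rw [WellFounded.fix_eq]

/-- The span of the packets that arrive at the sink `t`. -/
def receivedSpan (t : τ) (y : E → Matrix (Fin T) n F) : Submodule F (n → F) :=
  Submodule.span F (Set.range (Matrix.of fun p : {e // N.head e = N.snk t} × Fin T =>
    (y p.1).row p.2).row)

/-- Duality: a functional that vanishes on the received span but not on a source packet turns the
packets into scalars that witness `Confusable`, because the coding rule is linear and commutes with
the functional. -/
theorem row_mem_receivedSpan (g : Coeff N F T r) (t : τ) (Z : Finset E)
    (hg : ¬ Confusable N g t Z) (M : ∀ i, Matrix (Fin (r i)) n F)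
    (x : E → Option (Matrix (Fin T) n F)) (hx : ∀ e, e ∉ Z → x e = none) (i : ι)
    (a : Fin (r i)) : (M i).row a ∈ receivedSpan N t (packets N g M x) := by
  by_contra h
  obtain ⟨φ, hφ, hφ'⟩ := Submodule.exists_le_ker_of_notMem h
  refine hg ⟨(fun j b => φ ((M j).row b), fun e b => φ ((packets N g M x e).row b)), ?_, ?_, ?_⟩
  · intro h0
    exact hφ (congrFun (congrFun h0 i) a)
  · intro e he
    funext b
    exact hφ' (Submodule.subset_span ⟨(⟨e, he⟩, b), rfl⟩)
  · intro e he
    funext b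
    simp only
    rw [packets_eq, hx e he, Option.getD_none]
    have : ∀ (I : Type) [Fintype I] (G : Matrix (Fin T) I F) (Q : Matrix I n F),
        φ ((G * Q).row b) = (G *ᵥ fun j => φ (Q.row j)) b := by
      intro I _ G Q
      have : (G * Q).row b = ∑ j, G b j • Q.row j := by
        funext k
        simp [Matrix.mul_apply, Matrix.row]
      rw [this, map_sum]
      simp [mulVec, dotProduct]
    rw [this]
    congr 2
    funext j
    rcases j with j | j <;> rfl

/-- By induction along the network, every packet is a combination of source packets and of the
packets present on the links in `Z`. The bound therefore holds whatever is injected. -/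
theorem finrank_receivedSpan_le [Finite n] (g : Coeff N F T r) (t : τ) (Z : Finset E)
    (M : ∀ i, Matrix (Fin (r i)) n F)
    (x : E → Option (Matrix (Fin T) n F)) (hx : ∀ e, e ∉ Z → x e = none) :
    Module.finrank F (receivedSpan N t (packets N g M x)) ≤ ∑ i, r i + T * Z.card := by
  have := Fintype.ofFinite n
  let gen : (Σ i, Fin (r i)) ⊕ (Z × Fin T) → n → F :=
    Sum.elim (fun p => (M p.1).row p.2) fun p => (packets N g M x p.1).row p.2
  have hmem : ∀ e b, (packets N g M x e).row b ∈ Submodule.span F (Set.range gen) := by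
    intro e
    induction e using N.wellFounded_feeds.induction with
    | _ e ih =>
      intro b
      by_cases he : e ∈ Z
      · exact Submodule.subset_span ⟨Sum.inr (⟨e, he⟩, b), rfl⟩
      · rw [packets_eq, hx e he, Option.getD_none]
        have : ∀ (I : Type) [Fintype I] (G : Matrix (Fin T) I F) (Q : Matrix I n F),
            (G * Q).row b = ∑ j, G b j • Q.row j := by
          intro I _ G Q
          funext k
          simp [Matrix.mul_apply, Matrix.row]
        rw [this]
        refine Submodule.sum_mem _ fun j _ => Submodule.smul_mem _ _ ?_
        rcases j with ⟨e', a⟩ | ⟨i, a⟩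
        · exact ih e'.1 e'.2 a
        · exact Submodule.subset_span ⟨Sum.inl ⟨i.1, a⟩, rfl⟩
  calc _ ≤ Module.finrank F (Submodule.span F (Set.range gen)) := by
        apply Submodule.finrank_mono
        rw [receivedSpan, Submodule.span_le]
        rintro _ ⟨p, rfl⟩
        exact hmem p.1 p.2
    _ ≤ _ := (finrank_range_le_card gen).trans (by simp [mul_comm])

end

end RandomCoding

/-! ### The hash -/

namespace HashCode

variable {F : Type} [Field F] {α d : ℕ}

theorem vecMul_parity_apply (v : Fin α ⊕ Fin d → F) (w : Fin α → F) (b : Fin α) :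
    (v ᵥ* parity d w) b = ∑ m, v m * w b ^ ((finSumFinEquiv m : ℕ) + 1) := rfl

/-- The hash at the point `s` is a polynomial in `s` whose coefficients are the entries of `v`,
shifted by one degree; it is nonzero and has at most `α + d` roots. -/
theorem uniformProb_sum_pow_eq_zero_le [Finite F] {v : Fin α ⊕ Fin d → F} (hv : v ≠ 0) :
    uniformProb (fun s : F => ∑ m, v m * s ^ ((finSumFinEquiv m : ℕ) + 1) = 0) ≤
      (α + d : ℕ) / (Nat.card F : ℝ) := by
  classical
  have := Fintype.ofFinite F
  refine uniformProb.le_div_card _ _ ?_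
  let p : Polynomial F := ∑ m, Polynomial.C (v m) * Polynomial.X ^ ((finSumFinEquiv m : ℕ) + 1)
  obtain ⟨m₀, hm₀⟩ := Function.ne_iff.1 hv
  have hp : p ≠ 0 := by
    intro h
    apply hm₀
    have := congrArg (fun p => p.coeff ((finSumFinEquiv m₀ : ℕ) + 1)) h
    simp only [p, Polynomial.finsetSum_coeff, Polynomial.coeff_C_mul_X_pow, Polynomial.coeff_zero,
      add_left_inj, Fin.val_inj, EmbeddingLike.apply_eq_iff_eq] at this
    simpa using this
  have hdeg : p.natDegree ≤ α + d := by
    refine Polynomial.natDegree_sum_le_of_forall_le _ _ fun m _ => ?_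
    exact (Polynomial.natDegree_C_mul_X_pow_le _ _).trans (by omega)
  have hroot : ∀ s, (∑ m, v m * s ^ ((finSumFinEquiv m : ℕ) + 1) = 0) ↔ s ∈ p.roots.toFinset := by
    intro s
    rw [Multiset.mem_toFinset, Polynomial.mem_roots hp, Polynomial.IsRoot.def]
    simp [p, Polynomial.eval_finsetSum]
  rw [Nat.card_eq_fintype_card, Fintype.card_subtype]
  simp only [hroot, Finset.filter_univ_mem]
  exact (Multiset.toFinset_card_le _).trans ((Polynomial.card_roots' p).trans hdeg)

theorem uniformProb_vecMul_parity_eq_zero_le [Finite F] {v : Fin α ⊕ Fin d → F} (hv : v ≠ 0) :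
    uniformProb (fun w : Fin α → F => v ᵥ* parity d w = 0) ≤
      ((α + d : ℕ) / (Nat.card F : ℝ)) ^ α := by
  have h := uniformProb.pi_eq (fun (_ : Fin α) (s : F) =>
    ∑ m, v m * s ^ ((finSumFinEquiv m : ℕ) + 1) = 0)
  have h' : (fun w : Fin α → F => v ᵥ* parity d w = 0) = fun w : Fin α → F =>
      ∀ b, ∑ m, v m * w b ^ ((finSumFinEquiv m : ℕ) + 1) = 0 := by
    funext w
    rw [funext_iff]
    rfl
  rw [h', h]
  calc _ ≤ ∏ _b : Fin α, ((α + d : ℕ) / (Nat.card F : ℝ)) :=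
        Finset.prod_le_prod (fun _ _ => uniformProb.nonneg _)
          fun _ _ => uniformProb_sum_pow_eq_zero_le hv
    _ = _ := by rw [Finset.prod_const, Finset.card_univ, Fintype.card_fin]

/-- A fixed small subspace contains no nonzero vector with zero hash, with high probability. -/
theorem uniformProb_exists_mem_le [Finite F] (W : Submodule F (Fin α ⊕ Fin d → F)) {D : ℕ}
    (hW : Module.finrank F W ≤ D) :
    uniformProb (fun w : Fin α → F => ∃ v ∈ W, v ≠ 0 ∧ v ᵥ* parity d w = 0) ≤
      (Nat.card F : ℝ) ^ D * ((α + d : ℕ) / (Nat.card F : ℝ)) ^ α := by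
  have := Fintype.ofFinite W
  have hF : (1 : ℝ) ≤ Nat.card F := by exact_mod_cast Nat.card_pos
  have h1 : uniformProb (fun w : Fin α → F => ∃ v ∈ W, v ≠ 0 ∧ v ᵥ* parity d w = 0) ≤
      ∑ v : W, uniformProb (fun w : Fin α → F => (v : Fin α ⊕ Fin d → F) ≠ 0 ∧
        (v : Fin α ⊕ Fin d → F) ᵥ* parity d w = 0) := by
    refine le_trans (uniformProb.mono ?_) (uniformProb.exists_le _)
    rintro w ⟨v, hv, h⟩
    exact ⟨⟨v, hv⟩, h⟩
  refine h1.trans ?_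
  calc _ ≤ ∑ _v : W, ((α + d : ℕ) / (Nat.card F : ℝ)) ^ α := Finset.sum_le_sum fun v _ => ?_
    _ = (Nat.card W : ℝ) * ((α + d : ℕ) / (Nat.card F : ℝ)) ^ α := by
      simp [Nat.card_eq_fintype_card]
    _ ≤ _ := by
      gcongr
      rw [Module.natCard_eq_pow_finrank (K := F) (V := W)]
      push_cast
      exact pow_le_pow_right₀ hF hW
  by_cases hv : (v : Fin α ⊕ Fin d → F) = 0
  · rw [uniformProb.eq_zero fun w hw => hw.1 hv]
    positivity
  · exact (uniformProb.mono fun w hw => hw.2).trans (uniformProb_vecMul_parity_eq_zero_le hv)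

theorem det_toRows₁_parity (w : Fin α → F) :
    (parity d w).toRows₁.det = (vandermonde w).det * ∏ b, w b := by
  have : (parity d w).toRows₁ = (vandermonde w)ᵀ * diagonal w := by
    ext a b
    simp [parity, toRows₁, mul_diagonal, vandermonde_apply, pow_succ]
  rw [this, det_mul, det_transpose, det_diagonal]

/-- The block is a transposed Vandermonde matrix times a diagonal matrix, so it is singular only if
one of `α` points is zero or two of them coincide. The term `α ^ 2` counts all ordered pairs; the
diagonal ones contribute nothing. -/
theorem uniformProb_not_isUnit_le [Finite F] :
    uniformProb (fun w : Fin α → F => ¬ IsUnit (parity d w).toRows₁.det) ≤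
      ((α + α ^ 2 : ℕ) : ℝ) / (Nat.card F : ℝ) := by
  have h1 : ∀ (b : Fin α) (f : (Fin α → F) → F)
      (_ : ∀ w s, f (Function.update w b s) = f w),
      uniformProb (fun w : Fin α → F => w b = f w) ≤ 1 / (Nat.card F : ℝ) := by
    intro b f hf
    refine uniformProb.le_of_resample (fun w => w b) (fun w s => Function.update w b s) (by simp)
      (by simp) (by simp) _ _ fun w => ?_
    simp only [Function.update_self, hf]
    refine (uniformProb.le_div_card _ 1 ?_).trans (by simp)
    rw [Finite.card_le_one_iff_subsingleton]
    exact ⟨fun s s' => Subtype.ext (s.2.trans s'.2.symm)⟩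
  have h2 : uniformProb (fun w : Fin α → F => ¬ IsUnit (parity d w).toRows₁.det) ≤
      uniformProb (fun w : Fin α → F => (∃ b, w b = 0) ∨
        ∃ p : Fin α × Fin α, p.1 ≠ p.2 ∧ w p.1 = w p.2) := by
    refine uniformProb.mono fun w hw => ?_
    rw [isUnit_iff_ne_zero, not_not, det_toRows₁_parity, mul_eq_zero, Finset.prod_eq_zero_iff] at hw
    rcases hw with h | ⟨b, _, h⟩
    · right
      by_contra hc
      push Not at hc
      refine det_vandermonde_ne_zero_iff.2 (fun i j hij => ?_) h
      by_contra hne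
      exact hc (i, j) hne hij
    · exact Or.inl ⟨b, h⟩
  refine h2.trans ((uniformProb.or_le _ _).trans ?_)
  have h3 : uniformProb (fun w : Fin α → F => ∃ b, w b = 0) ≤ α * (1 / (Nat.card F : ℝ)) := by
    refine (uniformProb.exists_le _).trans ?_
    calc _ ≤ ∑ _b : Fin α, (1 / (Nat.card F : ℝ)) :=
          Finset.sum_le_sum fun b _ => h1 b (fun _ => 0) (by simp)
      _ = _ := by simp
  have h4 : uniformProb (fun w : Fin α → F => ∃ p : Fin α × Fin α, p.1 ≠ p.2 ∧ w p.1 = w p.2) ≤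
      α ^ 2 * (1 / (Nat.card F : ℝ)) := by
    refine (uniformProb.exists_le _).trans ?_
    calc _ ≤ ∑ _b : Fin α × Fin α, (1 / (Nat.card F : ℝ)) := Finset.sum_le_sum fun b _ => ?_
      _ = _ := by simp [sq]
    by_cases hb : b.1 = b.2
    · rw [uniformProb.eq_zero fun w hw => hw.1 hb]
      positivity
    · refine (uniformProb.mono fun w hw => hw.2).trans (h1 b.1 (fun w => w b.2) ?_)
      intro w s
      rw [Function.update_of_ne (Ne.symm hb)]
  refine (add_le_add h3 h4).trans (le_of_eq ?_)
  push_cast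
  ring

theorem encode_mul_parity {r : ℕ} {w : Fin α → F} (hw : IsUnit (parity d w).toRows₁.det)
    (H : Matrix (Fin r) (Fin α) F) (X : Matrix (Fin r) (Fin d) F) :
    encode w H X * parity d w = H := by
  conv_lhs => rw [← fromRows_toRows (parity d w)]
  rw [encode, fromCols_mul_fromRows]
  rw [Matrix.mul_assoc, nonsing_inv_mul _ hw, Matrix.mul_one, sub_add_cancel]

/-- The difference of two solutions has rows in the received span with zero hash, and these vanish
by `hY`. -/
theorem decode_eq {B : Type} {r : ℕ} {Y : Matrix B (Fin α ⊕ Fin d) F} {w : Fin α → F}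
    {H : Matrix (Fin r) (Fin α) F} {M : Matrix (Fin r) (Fin α ⊕ Fin d) F}
    (hM : ∀ a, M.row a ∈ Submodule.span F (Set.range Y.row)) (hH : M * parity d w = H)
    (hY : ∀ v ∈ Submodule.span F (Set.range Y.row), v ᵥ* parity d w = 0 → v = 0) :
    decode Y w H = M := by
  have huniq : ∀ M' : Matrix (Fin r) (Fin α ⊕ Fin d) F,
      (∀ a, M'.row a ∈ Submodule.span F (Set.range Y.row)) ∧ M' * parity d w = H → M' = M := by
    rintro M' ⟨h1, h2⟩
    ext a j
    have := hY (M'.row a - M.row a) (Submodule.sub_mem _ (h1 a) (hM a)) (by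
      have h3 : (M' - M) * parity d w = 0 := by rw [Matrix.sub_mul, h2, hH, sub_self]
      exact congrFun h3 a)
    exact sub_eq_zero.1 (congrFun this j)
  have h : ∃! M : Matrix (Fin r) (Fin α ⊕ Fin d) F,
      (∀ a, M.row a ∈ Submodule.span F (Set.range Y.row)) ∧ M * parity d w = H :=
    ⟨M, ⟨hM, hH⟩, huniq⟩
  rw [decode, dif_pos h]
  exact huniq _ h.choose_spec.1

open Classical in
/-- For an invertible square block, the secret and the check packets determine each other. -/
noncomputable def secretEquiv {r : ℕ} (X : Matrix (Fin r) (Fin d) F) :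
    (Fin α → F) × Matrix (Fin r) (Fin α) F ≃ (Fin α → F) × Matrix (Fin r) (Fin α) F :=
  Equiv.prodShear (Equiv.refl _) fun w =>
    if hw : IsUnit (parity d w).toRows₁.det then
      { toFun := fun H => (H - X * (parity d w).toRows₂) * (parity d w).toRows₁⁻¹
        invFun := fun L => L * (parity d w).toRows₁ + X * (parity d w).toRows₂
        left_inv := fun H => by
          simp only [Matrix.mul_assoc, nonsing_inv_mul _ hw, Matrix.mul_one, sub_add_cancel]
        right_inv := fun L => by
          simp only [add_sub_cancel_right, Matrix.mul_assoc, mul_nonsing_inv _ hw,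
            Matrix.mul_one] }
    -- For a singular block any bijection will do: this event is accounted for separately.
    else Equiv.refl _

theorem fromCols_secretEquiv_snd {r : ℕ} (X : Matrix (Fin r) (Fin d) F)
    (κ : (Fin α → F) × Matrix (Fin r) (Fin α) F) (h : IsUnit (parity d κ.1).toRows₁.det) :
    fromCols (secretEquiv X κ).2 X = encode κ.1 κ.2 X := by
  simp only [secretEquiv, Equiv.prodShear_apply, Equiv.refl_apply, dif_pos h]
  rfl

/-! ### Error probability of the hash code. -/

open RandomCoding

variable {V E ι τ : Type} [Fintype V] [Fintype E] [Fintype ι] [DecidableEq V]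
  (N : Network V E ι τ) [Finite F] {T : ℕ} {r : ι → ℕ}

/-- The secrets enter the transmissions only through the encoded packets, which makes it possible to
use these packets as variables in place of `H`. -/
theorem received_code (w : ∀ i, Matrix (Fin (r i)) (Fin d) F) (g : Coeff N F T r)
    (κ : ∀ i, (Fin α → F) × Matrix (Fin (r i)) (Fin α) F)
    (x : E → Option (Matrix (Fin T) (Fin α ⊕ Fin d) F)) :
    (code N F T α d r).received w g κ x =
      packets N g (fun i => encode (κ i).1 (κ i).2 (w i)) x := by
  funext e
  induction e using N.wellFounded_feeds.induction with
  | _ e ih =>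
    refine (Network.Code.received_eq _ _ _ _ _ _).trans (Eq.trans ?_ (packets_eq N g _ x e).symm)
    have : (fun e' : {e' // N.head e' = N.tail e} => (code N F T α d r).received w g κ x e'.1) =
        fun e' => packets N g (fun i => encode (κ i).1 (κ i).2 (w i)) x e'.1 := by
      funext e'
      exact ih e'.1 e'.2
    exact congrArg (fun y => (x e).getD ((code N F T α d r).enc e (g (N.tail e)) (fun i _ => w i)
      (fun i _ => κ i) y)) this

/-- `hg` puts the true packets into the received span, `hκ` makes them satisfy the hash equation,
and `hY` makes the solution unique. `hg` ranges over all small link sets because the attacked set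
may depend on the observation. -/
theorem not_fails {z : ℕ} (w : ∀ i, Matrix (Fin (r i)) (Fin d) F)
    (a : Coeff N F T r × (E → Matrix (Fin T) (Fin α ⊕ Fin d) F) →
      E → Option (Matrix (Fin T) (Fin α ⊕ Fin d) F))
    (ha : ∀ o, ∃ Z : Finset E, Z.card ≤ z ∧ ∀ e, e ∉ Z → a o e = none) (g : Coeff N F T r)
    (κ : ∀ i, (Fin α → F) × Matrix (Fin (r i)) (Fin α) F)
    (hg : ∀ t, ∀ Z : Finset E, Z.card ≤ z → ¬ Confusable N g t Z)
    (hκ : ∀ i, IsUnit (parity d (κ i).1).toRows₁.det)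
    (hY : ∀ t i, ∀ v ∈ receivedSpan N t (packets N g (fun i => encode (κ i).1 (κ i).2 (w i))
      (a (g, packets N g (fun i => encode (κ i).1 (κ i).2 (w i)) fun _ => none))),
      v ᵥ* parity d (κ i).1 = 0 → v = 0) :
    ¬ (code N F T α d r).Fails w a g κ := by
  rintro ⟨t, ht⟩
  apply ht
  obtain ⟨Z, hZ, hx⟩ := ha (g, packets N g (fun i => encode (κ i).1 (κ i).2 (w i)) fun _ => none)
  have hrec : (code N F T α d r).received w g κ
      (a (g, (code N F T α d r).received w g κ fun _ => none)) =
      packets N g (fun i => encode (κ i).1 (κ i).2 (w i))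
        (a (g, packets N g (fun i => encode (κ i).1 (κ i).2 (w i)) fun _ => none)) :=
    (received_code N w g κ _).trans (congrArg (fun y =>
      packets N g (fun i => encode (κ i).1 (κ i).2 (w i)) (a (g, y))) (received_code N w g κ _))
  refine (congrArg (fun y : E → Matrix (Fin T) (Fin α ⊕ Fin d) F =>
    (code N F T α d r).dec t (g (N.snk t)) κ fun e => y e.1) hrec).trans ?_
  funext i
  have hdec := decode_eq (B := {e // N.head e = N.snk t} × Fin T)
    (Y := Matrix.of fun p : {e // N.head e = N.snk t} × Fin T =>
      (packets N g (fun i => encode (κ i).1 (κ i).2 (w i))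
        (a (g, packets N g (fun i => encode (κ i).1 (κ i).2 (w i)) fun _ => none)) p.1).row p.2)
    (fun b => row_mem_receivedSpan N g t Z (hg t Z hZ) (fun i => encode (κ i).1 (κ i).2 (w i))
      _ hx i b) (encode_mul_parity (hκ i) (κ i).2 (w i)) (hY t i)
  exact (congrArg toCols₂ hdec).trans (toCols₂_fromCols _ _)

theorem uniformProb_exists_confusable_le [Fintype τ] {Ω : Type} [Finite Ω] [Nonempty Ω] {z : ℕ}
    (hr : ∀ S : Finset ι, S.Nonempty → ∑ i ∈ S, r i + T * z ≤ T * N.minCut S) :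
    uniformProb (fun x : Coeff N F T r × Ω =>
      ∃ t : τ, ∃ Z : Finset E, Z.card ≤ z ∧ Confusable N x.1 t Z) ≤
      Fintype.card τ * (2 ^ Fintype.card E * (2 ^ Fintype.card V / ((Nat.card F : ℝ) - 1))) := by
  have hF : (1 : ℝ) < Nat.card F := by exact_mod_cast Finite.one_lt_card
  have hF' : (0 : ℝ) ≤ (Nat.card F : ℝ) - 1 := by linarith
  refine (uniformProb.exists_le _).trans ?_
  calc _ ≤ ∑ _t : τ, (2 ^ Fintype.card E * (2 ^ Fintype.card V / ((Nat.card F : ℝ) - 1))) :=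
        Finset.sum_le_sum fun t _ => ?_
    _ = _ := by simp
  refine (uniformProb.exists_le _).trans ?_
  calc _ ≤ ∑ _Z : Finset E, (2 ^ Fintype.card V / ((Nat.card F : ℝ) - 1)) :=
        Finset.sum_le_sum fun Z _ => ?_
    _ = _ := by simp
  by_cases hZ : Z.card ≤ z
  · refine uniformProb.le_of_resample (fun x => x.1) (fun x g => (g, x.2)) (by simp) (by simp)
      (by simp) _ _ fun x => ?_
    exact (uniformProb.mono fun g hg => hg.2).trans (uniformProb_confusable_le N hr t Z hZ)
  · rw [uniformProb.eq_zero fun x hx => hZ hx.1]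
    positivity

/-- Replacing the evaluation points of source `i`. -/
theorem uniformProb_le_of_points [DecidableEq ι] {Ω : Type} [Finite Ω] [Nonempty Ω] (i : ι)
    (p : Ω × (∀ i, (Fin α → F) × Matrix (Fin (r i)) (Fin α) F) → Prop) (c : ℝ)
    (h : ∀ x : Ω × (∀ i, (Fin α → F) × Matrix (Fin (r i)) (Fin α) F),
      uniformProb (fun s => p (x.1, Function.update x.2 i (s, (x.2 i).2))) ≤ c) :
    uniformProb p ≤ c := by
  refine uniformProb.le_of_resample (Ω := Ω × (∀ i, (Fin α → F) × Matrix (Fin (r i)) (Fin α) F))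
    (W := Fin α → F) (fun x => (x.2 i).1)
    (fun x s => (x.1, Function.update x.2 i (s, (x.2 i).2))) ?_ ?_ ?_ p c h
  · intro x s
    exact congrArg Prod.fst (Function.update_self i _ x.2)
  · intro x s s'
    refine Prod.ext rfl ?_
    change Function.update (Function.update x.2 i _) i
      (s', (Function.update x.2 i (s, (x.2 i).2) i).2) = _
    rw [Function.update_self, Function.update_idem]
  · intro x
    exact Prod.ext rfl (Function.update_eq_self i x.2)

theorem uniformProb_exists_not_isUnit_le {Ω : Type} [Finite Ω] [Nonempty Ω] :
    uniformProb (fun x : Ω × (∀ i, (Fin α → F) × Matrix (Fin (r i)) (Fin α) F) =>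
      ∃ i, ¬ IsUnit (parity d (x.2 i).1).toRows₁.det) ≤
      Fintype.card ι * (((α + α ^ 2 : ℕ) : ℝ) / (Nat.card F : ℝ)) := by
  classical
  refine (uniformProb.exists_le _).trans ?_
  calc _ ≤ ∑ _i : ι, (((α + α ^ 2 : ℕ) : ℝ) / (Nat.card F : ℝ)) :=
        Finset.sum_le_sum fun i _ => ?_
    _ = _ := by simp
  refine uniformProb_le_of_points i _ _ fun x => ?_
  simpa only [Function.update_self] using uniformProb_not_isUnit_le

/-- The packets that reach the sinks do not depend on the evaluation points, and hence rarely span a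
nonzero vector with zero hash. -/
theorem uniformProb_exists_receivedSpan_le [Fintype τ] {z D : ℕ} (hD : ∑ i, r i + T * z ≤ D)
    (X : ∀ i, Matrix (Fin (r i)) (Fin d) F)
    (x : Coeff N F T r → (∀ i, Matrix (Fin (r i)) (Fin α ⊕ Fin d) F) →
      E → Option (Matrix (Fin T) (Fin α ⊕ Fin d) F))
    (hx : ∀ g M, ∃ Z : Finset E, Z.card ≤ z ∧ ∀ e, e ∉ Z → x g M e = none) :
    uniformProb (fun ω : Coeff N F T r × (∀ i, (Fin α → F) × Matrix (Fin (r i)) (Fin α) F) =>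
      ∃ t i, ∃ v ∈ receivedSpan N t (packets N ω.1 (fun i => fromCols (ω.2 i).2 (X i))
        (x ω.1 fun i => fromCols (ω.2 i).2 (X i))), v ≠ 0 ∧ v ᵥ* parity d (ω.2 i).1 = 0) ≤
      Fintype.card τ * (Fintype.card ι *
        ((Nat.card F : ℝ) ^ D * ((α + d : ℕ) / (Nat.card F : ℝ)) ^ α)) := by
  classical
  refine (uniformProb.exists_le _).trans ?_
  calc _ ≤ ∑ _t : τ, (Fintype.card ι *
      ((Nat.card F : ℝ) ^ D * ((α + d : ℕ) / (Nat.card F : ℝ)) ^ α)) :=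
        Finset.sum_le_sum fun t _ => ?_
    _ = _ := by rw [Finset.sum_const, Finset.card_univ, nsmul_eq_mul]
  refine (uniformProb.exists_le _).trans ?_
  calc _ ≤ ∑ _i : ι, ((Nat.card F : ℝ) ^ D * ((α + d : ℕ) / (Nat.card F : ℝ)) ^ α) :=
        Finset.sum_le_sum fun i _ => ?_
    _ = _ := by rw [Finset.sum_const, Finset.card_univ, nsmul_eq_mul]
  refine uniformProb_le_of_points i _ _ fun ω => ?_
  -- The second component of the secret stands for the check block here, so new evaluation points
  -- leave all packets and the attack unchanged.
  have hM : ∀ s : Fin α → F, (fun j => fromCols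
      (Function.update ω.2 i (s, (ω.2 i).2) j).2 (X j)) = fun j => fromCols (ω.2 j).2 (X j) := by
    intro s
    funext j
    by_cases hj : j = i
    · subst hj
      simp
    · rw [Function.update_of_ne hj]
  simp only [hM, Function.update_self]
  refine uniformProb_exists_mem_le _ ?_
  obtain ⟨Z, hZ, hx'⟩ := hx ω.1 fun i => fromCols (ω.2 i).2 (X i)
  refine (finrank_receivedSpan_le N ω.1 t Z _ _ hx').trans (le_trans ?_ hD)
  gcongr

/-- The three summands belong to confusable coefficients, a singular block, and a nonzero received
combination with zero hash. -/
theorem errorProb_code_le [Fintype τ] {z D : ℕ}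
    (hr : ∀ S : Finset ι, S.Nonempty → ∑ i ∈ S, r i + T * z ≤ T * N.minCut S)
    (hD : ∑ i, r i + T * z ≤ D) (w : ∀ i, Matrix (Fin (r i)) (Fin d) F)
    (a : (code N F T α d r).Attack) (ha : a.Adaptive z) :
    (code N F T α d r).errorProb w a ≤
      Fintype.card τ * (2 ^ Fintype.card E * (2 ^ Fintype.card V / ((Nat.card F : ℝ) - 1))) +
      Fintype.card ι * (((α + α ^ 2 : ℕ) : ℝ) / (Nat.card F : ℝ)) +
      Fintype.card τ * (Fintype.card ι *
        ((Nat.card F : ℝ) ^ D * ((α + d : ℕ) / (Nat.card F : ℝ)) ^ α)) := by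
  -- The change of variables from `(w, H)` to `(w, L)` preserves the uniform distribution. The
  -- attack is a function of the coefficients and of `[L X]`.
  let Φ : Coeff N F T r × (∀ i, (Fin α → F) × Matrix (Fin (r i)) (Fin α) F) ≃
      Coeff N F T r × (∀ i, (Fin α → F) × Matrix (Fin (r i)) (Fin α) F) :=
    Equiv.prodCongr (Equiv.refl _) (Equiv.piCongrRight fun i => secretEquiv (w i))
  have b1 := uniformProb_exists_confusable_le N (F := F)
    (Ω := ∀ i, (Fin α → F) × Matrix (Fin (r i)) (Fin α) F) hr
  have b2 := uniformProb_exists_not_isUnit_le (F := F) (α := α) (d := d) (r := r)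
    (Ω := Coeff N F T r)
  have b3 := uniformProb_exists_receivedSpan_le N hD w
    (fun g M => a (g, packets N g M fun _ => none)) (fun g M => ha _)
  -- The third bound, proved with `L` as the variable, is pulled back to the original secrets.
  rw [← uniformProb.equiv Φ.symm] at b3
  refine le_trans ?_ ((uniformProb.or_le _ _).trans (add_le_add ((uniformProb.or_le _ _).trans
    (add_le_add b1 b2)) b3))
  refine uniformProb.mono (Ω := Coeff N F T r × (∀ i, (Fin α → F) × Matrix (Fin (r i)) (Fin α) F))
    (p := fun x => (code N F T α d r).Fails w a x.1 x.2) ?_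
  intro x hx
  by_contra hc
  push Not at hc
  obtain ⟨⟨h1, h2⟩, h3⟩ := hc
  refine not_fails N w a ha x.1 x.2 h1 h2 ?_ hx
  intro t i v hv hv0
  by_contra hne
  have hM : (fun i => fromCols ((Φ x).2 i).2 (w i)) =
      fun i => encode (x.2 i).1 (x.2 i).2 (w i) := by
    funext i
    exact fromCols_secretEquiv_snd (w i) (x.2 i) (h2 i)
  refine h3 t i v ?_ hne hv0
  rw [Equiv.symm_symm, hM]
  exact hv

end HashCode

/-! ### Choice of the parameters -/

namespace HashCode

/-- The integer part of the fifth root. -/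
def fifthRoot (ℓ : ℕ) : ℕ := Nat.findGreatest (fun u => u ^ 5 ≤ ℓ) ℓ

theorem fifthRoot_pow_le (ℓ : ℕ) : fifthRoot ℓ ^ 5 ≤ ℓ :=
  Nat.findGreatest_spec (P := fun u => u ^ 5 ≤ ℓ) (Nat.zero_le ℓ) (by simp)

theorem lt_fifthRoot_succ_pow (ℓ : ℕ) : ℓ < (fifthRoot ℓ + 1) ^ 5 := by
  by_contra! h
  have h1 : fifthRoot ℓ + 1 ≤ ℓ := le_trans (Nat.le_self_pow (by norm_num) _) h
  exact absurd (Nat.le_findGreatest (P := fun u => u ^ 5 ≤ ℓ) h1 h)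
    (by change ¬ fifthRoot ℓ + 1 ≤ fifthRoot ℓ; omega)

theorem le_fifthRoot {u ℓ : ℕ} (h : u ^ 5 ≤ ℓ) : u ≤ fifthRoot ℓ := by
  by_contra! hu
  have := lt_fifthRoot_succ_pow ℓ
  have : (fifthRoot ℓ + 1) ^ 5 ≤ u ^ 5 := Nat.pow_le_pow_left hu 5
  omega

/-- The number of data symbols in a packet, for block length `ℓ`. -/
def dataLength (m ℓ : ℕ) : ℕ :=
  ℓ / (fifthRoot ℓ * fifthRoot ℓ) - ((fifthRoot ℓ * m) ^ 2 + 1)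

/-- The subtraction in `dataLength` is not truncated: with `u = fifthRoot ℓ`, the number of check
symbols is at most `u ^ 2 * (m ^ 2 + 1) ≤ u ^ 3`, and `u ^ 3 * u ^ 2 ≤ ℓ`. -/
theorem hash_add_dataLength {m ℓ : ℕ} (h : m ^ 2 + 1 ≤ fifthRoot ℓ) :
    (fifthRoot ℓ * m) ^ 2 + 1 + dataLength m ℓ = ℓ / (fifthRoot ℓ * fifthRoot ℓ) := by
  unfold dataLength
  apply Nat.add_sub_cancel'
  have h0 := fifthRoot_pow_le ℓ
  generalize fifthRoot ℓ = u at *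
  have hu : 0 < u := by omega
  rw [Nat.le_div_iff_mul_le (by positivity)]
  refine le_trans ?_ h0
  have h1 : (u * m) ^ 2 + 1 ≤ u ^ 2 * (m ^ 2 + 1) := by nlinarith [Nat.one_le_pow 2 u (by omega)]
  calc _ ≤ u ^ 2 * (m ^ 2 + 1) * (u * u) := Nat.mul_le_mul_right _ h1
    _ ≤ u ^ 2 * u * (u * u) := by gcongr
    _ = u ^ 5 := by ring

theorem mul_mul_le {m ℓ : ℕ} (h : m ^ 2 + 1 ≤ fifthRoot ℓ) :
    fifthRoot ℓ * ((fifthRoot ℓ * m) ^ 2 + 1 + dataLength m ℓ) * fifthRoot ℓ ≤ ℓ := by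
  rw [hash_add_dataLength h]
  calc _ = ℓ / (fifthRoot ℓ * fifthRoot ℓ) * (fifthRoot ℓ * fifthRoot ℓ) := by ring
    _ ≤ ℓ := Nat.div_mul_le_self _ _

/-- With `u = fifthRoot ℓ`, rounding `u * ρ` costs a rate of at most `1 / u`. Check symbols and the
rounding of `ℓ / u ^ 2` cost at most `u ^ 4 * (m ^ 2 + 2)` of the `ℓ ≥ u ^ 5` symbols, hence a rate
of at most `ρ * (m ^ 2 + 2) / u`. -/
theorem le_rate {m ℓ : ℕ} (h : m ^ 2 + 1 ≤ fifthRoot ℓ) {ρ ε : ℝ} (hρ : 0 ≤ ρ)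
    (hε : (ρ * (m ^ 2 + 2) + 1) / fifthRoot ℓ ≤ ε) :
    ρ - ε ≤ (fifthRoot ℓ * (⌊(fifthRoot ℓ : ℝ) * ρ⌋₊ * dataLength m ℓ) : ℝ) / ℓ := by
  have h1 := mul_mul_le h
  have h2 := hash_add_dataLength h
  have h3 := fifthRoot_pow_le ℓ
  generalize dataLength m ℓ = d at *
  generalize fifthRoot ℓ = u at *
  have hu : 0 < u := by omega
  have h4 : ℓ < (ℓ / (u * u) + 1) * (u * u) := by
    have := Nat.lt_div_mul_add (a := ℓ) (b := u * u) (by positivity)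
    rwa [add_mul, one_mul]
  rw [← h2] at h4
  have hℓ : 0 < ℓ := lt_of_lt_of_le (by positivity) h3
  have hu' : (0 : ℝ) < u := by exact_mod_cast hu
  have hℓ' : (0 : ℝ) < ℓ := by exact_mod_cast hℓ
  have h1' : (u : ℝ) * ((u * m) ^ 2 + 1 + d) * u ≤ ℓ := by exact_mod_cast h1
  have h3' : (u : ℝ) ^ 5 ≤ ℓ := by exact_mod_cast h3
  have h4' : (ℓ : ℝ) < (((u * m) ^ 2 + 1 + d) + 1) * (u * u) := by exact_mod_cast h4
  have h5 : (u : ℝ) * ρ - 1 ≤ ⌊(u : ℝ) * ρ⌋₊ := (Nat.sub_one_lt_floor _).le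
  have hd : (0 : ℝ) ≤ d := by positivity
  have hu1 : (1 : ℝ) ≤ u := by exact_mod_cast hu
  rw [le_div_iff₀ hℓ']
  have hε' : ρ * (m ^ 2 + 2) + 1 ≤ ε * u := by rwa [div_le_iff₀ hu'] at hε
  have h6 : (u : ℝ) * (u * d) ≤ ℓ := by nlinarith [sq_nonneg ((u : ℝ) * m * u), sq_nonneg (u : ℝ)]
  have h7 : (ℓ : ℝ) - u ^ 4 * (m ^ 2 + 2) ≤ u * (u * d) := by
    have : (u : ℝ) ^ 2 ≤ u ^ 4 := pow_le_pow_right₀ hu1 (by norm_num)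
    nlinarith
  -- The extra factor `u` clears the denominator in the condition on `ε`.
  have h8 : (u : ℝ) * ((ρ - ε) * ℓ) ≤ u * (u * (⌊(u : ℝ) * ρ⌋₊ * d)) := by
    have e1 : (u * ρ - 1) * (u * (u * d)) ≤ (⌊(u : ℝ) * ρ⌋₊ : ℝ) * (u * (u * d)) := by
      gcongr
    have e2 : u * ρ * ((ℓ : ℝ) - u ^ 4 * (m ^ 2 + 2)) ≤ u * ρ * (u * (u * d)) := by gcongr
    have e3 : (ρ * (m ^ 2 + 2) + 1) * ℓ ≤ ε * u * ℓ := by gcongr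
    have e4 : ρ * (m ^ 2 + 2) * u ^ 5 ≤ ρ * (m ^ 2 + 2) * ℓ := by gcongr
    nlinarith
  exact le_of_mul_le_mul_left h8 hu'

/-- The packet length is at most `ℓ < (u + 1) ^ 5`, polynomial in `u = fifthRoot ℓ`, while the field
has `b ^ u` elements. -/
theorem sq_div_le {m ℓ b : ℕ} (h : m ^ 2 + 1 ≤ fifthRoot ℓ) (hb : 2 ≤ b) :
    (((fifthRoot ℓ * m) ^ 2 + 1 + dataLength m ℓ : ℕ) : ℝ) ^ 2 / (b : ℝ) ^ fifthRoot ℓ ≤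
      (fifthRoot ℓ + 1) ^ 10 / 2 ^ fifthRoot ℓ := by
  have h1 := mul_mul_le h
  have h2 := lt_fifthRoot_succ_pow ℓ
  have hb' : (2 : ℝ) ≤ b := by exact_mod_cast hb
  generalize (fifthRoot ℓ * m) ^ 2 + 1 + dataLength m ℓ = n at *
  generalize fifthRoot ℓ = u at *
  have hn : n ≤ (u + 1) ^ 5 := by
    have : n ≤ u * n * u := by
      have hu : 1 ≤ u := by omega
      nlinarith [Nat.mul_le_mul hu hu]
    omega
  have hn' : (n : ℝ) ≤ (u + 1) ^ 5 := by exact_mod_cast hn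
  have : (n : ℝ) ^ 2 ≤ (u + 1) ^ 10 := by
    calc _ ≤ (((u : ℝ) + 1) ^ 5) ^ 2 := by gcongr
      _ = _ := by ring
  gcongr

/-- With `α = D ^ 2 + 1 ≥ 2 * D`, the square of the product is at most `q ^ α * (n / q) ^ (2 * α) =
(n ^ 2 / q) ^ α ≤ β`. This is where the quadratic choice of `α` pays off. -/
theorem pow_mul_div_pow_le {q n β : ℝ} (hq : 0 < q) (h : n ^ 2 / q ≤ β) (hβ : β ≤ 1)
    (D : ℕ) : q ^ D * (n / q) ^ (D ^ 2 + 1) ≤ Real.sqrt β ∨ q < 1 := by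
  rcases lt_or_ge q 1 with h1 | h1
  · exact Or.inr h1
  left
  apply Real.le_sqrt_of_sq_le
  have hD : 2 * D ≤ D ^ 2 + 1 := by
    have := two_mul_le_add_sq D 1
    simpa using this
  calc (q ^ D * (n / q) ^ (D ^ 2 + 1)) ^ 2 = q ^ (2 * D) * ((n / q) ^ 2) ^ (D ^ 2 + 1) := by ring
    _ ≤ q ^ (D ^ 2 + 1) * ((n / q) ^ 2) ^ (D ^ 2 + 1) := by gcongr
    _ = (n ^ 2 / q) ^ (D ^ 2 + 1) := by
      rw [← mul_pow]
      congr 1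
      field_simp
    _ ≤ β ^ (D ^ 2 + 1) := by gcongr
    _ ≤ β ^ 1 := pow_le_pow_of_le_one (le_trans (by positivity) h) hβ (by omega)
    _ = β := pow_one β

open Filter Topology in
theorem tendsto_succ_pow_div_two_pow :
    Tendsto (fun u : ℕ => ((u : ℝ) + 1) ^ 10 / 2 ^ u) atTop (𝓝 0) := by
  have h := (tendsto_pow_const_div_const_pow_of_one_lt 10 (by norm_num : (1 : ℝ) < 2)).comp
    (tendsto_add_atTop_nat 1)
  have h' := h.const_mul 2
  rw [mul_zero] at h'
  refine h'.congr fun u => ?_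
  simp only [Function.comp]
  push_cast
  rw [pow_succ 2]
  field_simp

open Network

variable {K : Type} [Field K] [Finite K] {ι : Type}

theorem sum_floor_add_le {V E τ : Type} [Fintype E] [DecidableEq V] {N : Network V E ι τ} {z : ℕ}
    {R : ι → ℝ} (hR : R ∈ N.rateRegion z) (T : ℕ) (S : Finset ι) (hS : S.Nonempty) :
    ∑ i ∈ S, ⌊(T : ℝ) * R i⌋₊ + T * z ≤ T * N.minCut S := by
  have h1 : (∑ i ∈ S, (⌊(T : ℝ) * R i⌋₊ : ℝ)) ≤ T * ∑ i ∈ S, R i := by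
    rw [Finset.mul_sum]
    exact Finset.sum_le_sum fun i _ => Nat.floor_le (mul_nonneg (by positivity) (hR.1 i))
  have h2 : (T : ℝ) * ∑ i ∈ S, R i ≤ T * ((N.minCut S : ℝ) - z) := by
    gcongr
    exact hR.2 S hS
  have : (∑ i ∈ S, (⌊(T : ℝ) * R i⌋₊ : ℝ)) + T * z ≤ T * N.minCut S := by linarith
  exact_mod_cast this

open Filter Topology in
/-- With these parameters hash codes attain every point of the region, whatever the network. -/
theorem exists_bound [Fintype ι] {V E τ : Type} [Fintype V] [DecidableEq V] [Fintype E] [Fintype τ]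
    (N : Network V E ι τ) {z m : ℕ} (hm : N.minCut Finset.univ = m)
    {R : ι → ℝ} (hR : R ∈ N.rateRegion z) {ε δ : ℝ} (hε : 0 < ε) (hδ : 0 < δ) :
    ∃ L : ℕ, ∀ ℓ > L, 0 < fifthRoot ℓ ∧ 0 < fifthRoot ℓ ∧
      fifthRoot ℓ * (((fifthRoot ℓ * m) ^ 2 + 1) + dataLength m ℓ) * fifthRoot ℓ ≤ ℓ ∧
      ∀ (F : Type) [Field F] [Finite F], Nat.card F = Nat.card K ^ fifthRoot ℓ →
        let c := code N F (fifthRoot ℓ) ((fifthRoot ℓ * m) ^ 2 + 1) (dataLength m ℓ)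
          (fun i => ⌊(fifthRoot ℓ : ℝ) * R i⌋₊)
        (∀ i, R i - ε ≤ Real.logb (Nat.card K) (Nat.card (c.Msg i)) / ℓ) ∧
        ∀ (w : ∀ i, c.Msg i) (a : c.Attack), a.Adaptive z → c.errorProb w a < δ := by
  set A : ℝ := Fintype.card τ * (2 ^ Fintype.card E * 2 ^ Fintype.card V) with hA
  set s : ℝ := ((Fintype.card ι : ℕ) : ℝ) with hs
  set t : ℝ := ((Fintype.card τ : ℕ) : ℝ) with ht
  -- The summands dominate those of `errorProb_code_le`; all of them are expressed through the bound
  -- of `sq_div_le`.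
  have hlim : Tendsto (fun u : ℕ => A * (2 * (((u : ℝ) + 1) ^ 10 / 2 ^ u)) +
      s * (2 * (((u : ℝ) + 1) ^ 10 / 2 ^ u)) +
      t * (s * Real.sqrt (((u : ℝ) + 1) ^ 10 / 2 ^ u))) atTop (𝓝 0) := by
    have h := tendsto_succ_pow_div_two_pow
    have h' := (Real.continuous_sqrt.tendsto 0).comp h
    rw [Real.sqrt_zero] at h'
    have h1 := (((h.const_mul 2).const_mul A).add ((h.const_mul 2).const_mul s)).add
      ((h'.const_mul s).const_mul t)
    simpa using h1
  have hev1 := hlim.eventually_lt_const hδ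
  have hev2 := tendsto_succ_pow_div_two_pow.eventually_le_const zero_lt_one
  have hev3 : ∀ᶠ u : ℕ in atTop, ∀ i, (R i * (m ^ 2 + 2) + 1) / (u : ℝ) ≤ ε := by
    rw [eventually_all]
    intro i
    exact (tendsto_const_div_atTop_nhds_zero_nat _).eventually_le_const hε
  obtain ⟨u₀, hu₀⟩ := (((hev1.and hev2).and hev3).and (eventually_ge_atTop (m ^ 2 + 1))).exists_forall_of_atTop
  refine ⟨u₀ ^ 5, fun ℓ hℓ => ?_⟩
  obtain ⟨⟨⟨h1, h2⟩, h3⟩, h4⟩ := hu₀ (fifthRoot ℓ) (le_fifthRoot (le_of_lt hℓ))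
  have hu : 0 < fifthRoot ℓ := by omega
  refine ⟨hu, hu, mul_mul_le h4, ?_⟩
  intro F _ _ hF c
  have hK : (1 : ℝ) < Nat.card K := by exact_mod_cast Finite.one_lt_card
  constructor
  · intro i
    have hcard : (Nat.card (c.Msg i) : ℝ) =
        (Nat.card K : ℝ) ^ (fifthRoot ℓ * (⌊(fifthRoot ℓ : ℝ) * R i⌋₊ * dataLength m ℓ)) := by
      have : Nat.card (Fin ⌊(fifthRoot ℓ : ℝ) * R i⌋₊ → Fin (dataLength m ℓ) → F) =
        Nat.card K ^ (fifthRoot ℓ * (⌊(fifthRoot ℓ : ℝ) * R i⌋₊ * dataLength m ℓ)) := by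
        rw [Nat.card_fun, Nat.card_fun, hF, Nat.card_fin, Nat.card_fin, ← pow_mul, ← pow_mul]
        congr 1
        ring
      exact_mod_cast this
    rw [hcard, Real.logb_pow, Real.logb_self_eq_one hK, mul_one]
    push_cast
    exact le_rate h4 (hR.1 i) (h3 i)
  · intro w a ha
    -- Without sources there is no constraint for the full source set to use, but the only message
    -- tuple is the empty one and decoding cannot fail.
    rcases isEmpty_or_nonempty ι with hι | hι
    · have : c.errorProb w a = 0 :=
        uniformProb.eq_zero (p := fun x : (∀ v, c.Seed v) × (∀ i, c.Key i) =>
          c.Fails w a x.1 x.2) fun x ⟨t, hx⟩ => hx (funext fun i => hι.elim i)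
      rw [this]
      exact hδ
    have hsum := sum_floor_add_le hR (fifthRoot ℓ)
    -- The rate constraint for the set of all sources gives the dimension bound `D = T * m`, so that
    -- `α = D ^ 2 + 1`.
    refine lt_of_le_of_lt (errorProb_code_le N (D := fifthRoot ℓ * m) hsum
      (by simpa [hm] using hsum Finset.univ Finset.univ_nonempty) w a ha) (lt_of_le_of_lt ?_ h1)
    have hb : 2 ≤ Nat.card K := Finite.one_lt_card
    have h5 := sq_div_le h4 hb
    have hq : (Nat.card F : ℝ) = (Nat.card K : ℝ) ^ fifthRoot ℓ := by exact_mod_cast hF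
    rw [← hq] at h5
    have hF1 : (2 : ℝ) ≤ Nat.card F := by
      have : 2 ≤ Nat.card F := Finite.one_lt_card
      exact_mod_cast this
    set β : ℝ := ((fifthRoot ℓ : ℝ) + 1) ^ 10 / 2 ^ fifthRoot ℓ
    have hα : (fifthRoot ℓ * m) ^ 2 + 1 ≤ (fifthRoot ℓ * m) ^ 2 + 1 + dataLength m ℓ := by omega
    have hα1 : 1 ≤ (fifthRoot ℓ * m) ^ 2 + 1 := by omega
    have h6 := pow_mul_div_pow_le (by linarith) h5 h2 (fifthRoot ℓ * m)
    replace h6 := h6.resolve_right (by linarith)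
    generalize (fifthRoot ℓ * m) ^ 2 + 1 = α at *
    generalize dataLength m ℓ = d at *
    generalize (Nat.card F : ℝ) = q at *
    have hn : (1 : ℝ) ≤ (α + d : ℕ) := by exact_mod_cast hα1.trans hα
    have hαn : (α : ℝ) ≤ (α + d : ℕ) := by exact_mod_cast hα
    have hα0 : (0 : ℝ) ≤ α := by positivity
    -- `q ≥ 2` gives `1 / (q - 1) ≤ 2 / q`, and the packet length is at least `1`.
    have e1 : 1 / (q - 1) ≤ 2 * β := by
      have : 1 / (q - 1) ≤ 2 * (((α + d : ℕ) : ℝ) ^ 2 / q) := by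
        rw [← mul_div_assoc, div_le_div_iff₀ (by linarith) (by linarith)]
        nlinarith [mul_nonneg (sub_nonneg.2 (one_le_pow₀ hn : 1 ≤ (((α + d : ℕ) : ℝ)) ^ 2))
          (by linarith : (0 : ℝ) ≤ q - 1)]
      linarith
    have e2 : ((α + α ^ 2 : ℕ) : ℝ) / q ≤ 2 * β := by
      have : ((α + α ^ 2 : ℕ) : ℝ) / q ≤ 2 * (((α + d : ℕ) : ℝ) ^ 2 / q) := by
        rw [← mul_div_assoc]
        gcongr
        push_cast at *
        nlinarith
      linarith
    have e3 : t * (2 ^ Fintype.card E * (2 ^ Fintype.card V / (q - 1))) = A * (1 / (q - 1)) := by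
      rw [hA]
      ring
    rw [e3]
    gcongr

end HashCode

/-! ### Change of alphabet, and the capacity region -/

namespace Network

variable {V E ι τ : Type} {N : Network V E ι τ} {A B : Type}

namespace Code

/-- Symbols of `A` are transmitted as symbols of `B`. -/
def mapAlphabet (c : Code N A) (f : A → B) (f' : B → A) : Code N B where
  Msg := c.Msg
  Key := c.Key
  Seed := c.Seed
  finite_msg := c.finite_msg
  finite_key := c.finite_key
  finite_seed := c.finite_seed
  nonempty_msg := c.nonempty_msg
  nonempty_key := c.nonempty_key
  nonempty_seed := c.nonempty_seed
  enc e s m k y := f (c.enc e s m k fun e' => f' (y e'))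
  dec t s k y := c.dec t s k fun e => f' (y e)

variable [Finite V] (c : Code N A) {f : A → B} {f' : B → A}

theorem received_mapAlphabet (hf : Function.LeftInverse f' f) (w : ∀ i, c.Msg i) (g : ∀ v, c.Seed v) (κ : ∀ i, c.Key i)
    (x : E → Option B) (e : E) :
    f' ((c.mapAlphabet f f').received w g κ x e) =
      c.received w g κ (fun e => (x e).map f') e := by
  induction e using N.wellFounded_feeds.induction with
  | _ e ih =>
    refine (congrArg f' (received_eq (c.mapAlphabet f f') w g κ x e)).trans
      (Eq.trans ?_ (received_eq c w g κ _ e).symm)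
    cases h : x e with
    | some b => rfl
    | none =>
      refine (hf _).trans ?_
      exact congrArg (c.enc e (g (N.tail e)) (fun i _ => w i) fun i _ => κ i)
        (funext fun e' => ih e'.1 e'.2)

theorem received_mapAlphabet_none (hf : Function.LeftInverse f' f) (w : ∀ i, c.Msg i) (g : ∀ v, c.Seed v) (κ : ∀ i, c.Key i)
    (e : E) :
    (c.mapAlphabet f f').received w g κ (fun _ => none) e =
      f (c.received w g κ (fun _ => none) e) := by
  refine (received_eq (c.mapAlphabet f f') w g κ _ e).trans
    (congrArg f (Eq.trans ?_ (received_eq c w g κ _ e).symm))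
  exact congrArg (c.enc e (g (N.tail e)) (fun i _ => w i) fun i _ => κ i)
    (funext fun e' => received_mapAlphabet c hf w g κ (fun _ => none) e'.1)

/-- An attack on the translated code induces one on the original code: translate the observation by
`f` and the injected symbols by `f'`. It touches the same links, and the two failure events agree.
-/
theorem errorProb_mapAlphabet (hf : Function.LeftInverse f' f) (w : ∀ i, c.Msg i) (a : (c.mapAlphabet f f').Attack) :
    (c.mapAlphabet f f').errorProb w a =
      c.errorProb w fun o e => (a (o.1, fun e => f (o.2 e)) e).map f' := by
  have : ∀ g κ, (c.mapAlphabet f f').Fails w a g κ ↔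
      c.Fails w (fun o e => (a (o.1, fun e => f (o.2 e)) e).map f') g κ := by
    intro g κ
    have h1 : (c.mapAlphabet f f').received w g κ (fun _ => none) =
        fun e => f (c.received w g κ (fun _ => none) e) :=
      funext fun e => received_mapAlphabet_none c hf w g κ e
    have h2 : ∀ t, (fun e : {e // N.head e = N.snk t} => f' ((c.mapAlphabet f f').received w g κ
        (a (g, (c.mapAlphabet f f').received w g κ fun _ => none)) e.1)) =
        fun e => c.received w g κ (fun e => (a (g, fun e =>
          f (c.received w g κ (fun _ => none) e)) e).map f') e.1 := by
      intro t
      funext e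
      exact (received_mapAlphabet c hf w g κ _ e.1).trans (by rw [h1])
    exact exists_congr fun t => not_congr (Eq.congr_left
      (congrArg (c.dec t (g (N.snk t)) κ) (h2 t)))
  change uniformProb _ = uniformProb _
  congr 1
  funext x
  exact propext (this x.1 x.2)

end Code

/-- A filler for the block lengths at which the parameters of the hash code do not fit. -/
theorem nonempty_code [Nonempty A] : Nonempty (Code N A) :=
  ⟨{Msg := fun _ => Unit
    Key := fun _ => Unit
    Seed := fun _ => Unit
    finite_msg := fun _ => inferInstance
    finite_key := fun _ => inferInstance
    finite_seed := fun _ => inferInstance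
    nonempty_msg := fun _ => inferInstance
    nonempty_key := fun _ => inferInstance
    nonempty_seed := fun _ => inferInstance
    enc := fun _ _ _ _ _ => Classical.arbitrary A
    dec := fun _ _ _ _ _ => () }⟩

theorem exists_code_of_card_le [Finite V] [Finite A] [Nonempty A] [Finite B] (c : Code N A)
    (h : Nat.card A ≤ Nat.card B) (z : ℕ) :
    ∃ c' : Code N B, (∀ i, Nat.card (c'.Msg i) = Nat.card (c.Msg i)) ∧
      ∀ δ : ℝ, (∀ (w : ∀ i, c.Msg i) (a : c.Attack), a.Adaptive z → c.errorProb w a < δ) →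
        ∀ (w : ∀ i, c'.Msg i) (a : c'.Attack), a.Fixed z → c'.errorProb w a < δ := by
  have := Fintype.ofFinite A
  have := Fintype.ofFinite B
  rw [Nat.card_eq_fintype_card, Nat.card_eq_fintype_card] at h
  obtain ⟨f⟩ := Function.Embedding.nonempty_of_card_le h
  refine ⟨c.mapAlphabet f (Function.invFun f), fun i => rfl, fun δ hδ w a ha => ?_⟩
  refine lt_of_eq_of_lt
    (Code.errorProb_mapAlphabet c (Function.leftInverse_invFun f.injective) w a)
    (hδ w _ fun o => ?_)
  obtain ⟨Z, hZ, h⟩ := ha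
  exact ⟨Z, hZ, fun e he => by rw [h _ e he]; rfl⟩

theorem exists_field_card_eq_pow (K : Type) [Field K] [Finite K] {k : ℕ} (hk : 0 < k) :
    ∃ (F : Type) (_ : Field F) (_ : Finite F), Nat.card F = Nat.card K ^ k := by
  have := Fintype.ofFinite K
  obtain ⟨p, _, n, hp, h⟩ := FiniteField.card' K
  have : Fact p.Prime := ⟨hp⟩
  refine ⟨GaloisField p (n * k), inferInstance, inferInstance, ?_⟩
  rw [GaloisField.card p _ (Nat.mul_pos n.pos hk).ne', Nat.card_eq_fintype_card, h, pow_mul]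

open HashCode in
theorem achievable_of_mem_rateRegion [Fintype V] [DecidableEq V] [Fintype E] [Fintype ι]
    [Fintype τ] (K : Type) [Field K] [Finite K] {z : ℕ} {R : ι → ℝ} (hR : R ∈ N.rateRegion z) :
    N.Achievable K z R := by
  set m := N.minCut Finset.univ with hm
  -- One sequence of codes has to serve all `ε` and `δ`. Hence the code is chosen first, and the
  -- bounds for the hash code appear as a hypothesis inside the quantifiers.
  have key : ∀ ℓ : ℕ, ∃ c : N.Code (Fin ℓ → K), ∀ ε δ : ℝ,
      (0 < fifthRoot ℓ ∧ 0 < fifthRoot ℓ ∧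
      fifthRoot ℓ * (((fifthRoot ℓ * m) ^ 2 + 1) + dataLength m ℓ) * fifthRoot ℓ ≤ ℓ ∧
      ∀ (F : Type) [Field F] [Finite F], Nat.card F = Nat.card K ^ fifthRoot ℓ →
        let c := code N F (fifthRoot ℓ) ((fifthRoot ℓ * m) ^ 2 + 1) (dataLength m ℓ)
          (fun i => ⌊(fifthRoot ℓ : ℝ) * R i⌋₊)
        (∀ i, R i - ε ≤ Real.logb (Nat.card K) (Nat.card (c.Msg i)) / ℓ) ∧
        ∀ (w : ∀ i, c.Msg i) (a : c.Attack), a.Adaptive z → c.errorProb w a < δ) →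
      (∀ i, R i - ε ≤ Real.logb (Nat.card K) (Nat.card (c.Msg i)) / ℓ) ∧
        ∀ (w : ∀ i, c.Msg i) (a : c.Attack), a.Fixed z → c.errorProb w a < δ := by
    intro ℓ
    by_cases h : 0 < fifthRoot ℓ ∧
      fifthRoot ℓ * (((fifthRoot ℓ * m) ^ 2 + 1) + dataLength m ℓ) * fifthRoot ℓ ≤ ℓ
    · obtain ⟨F, _, _, hF⟩ := exists_field_card_eq_pow K h.1
      have hcard : Nat.card (Matrix (Fin (fifthRoot ℓ))
          (Fin ((fifthRoot ℓ * m) ^ 2 + 1) ⊕ Fin (dataLength m ℓ)) F) ≤ Nat.card (Fin ℓ → K) := by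
        refine le_trans (le_of_eq (b := Nat.card (Fin (fifthRoot ℓ) →
          Fin ((fifthRoot ℓ * m) ^ 2 + 1) ⊕ Fin (dataLength m ℓ) → F)) rfl) ?_
        rw [Nat.card_fun, Nat.card_fun, Nat.card_fun, Nat.card_sum, hF, Nat.card_fin,
          Nat.card_fin, Nat.card_fin, Nat.card_fin, ← pow_mul, ← pow_mul]
        refine Nat.pow_le_pow_right Nat.card_pos (le_trans (le_of_eq ?_) h.2)
        ring
      obtain ⟨c', h1, h2⟩ := exists_code_of_card_le (code N F (fifthRoot ℓ)
        ((fifthRoot ℓ * m) ^ 2 + 1) (dataLength m ℓ) (fun i => ⌊(fifthRoot ℓ : ℝ) * R i⌋₊)) hcard z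
      refine ⟨c', fun ε δ hb => ⟨fun i => ?_, h2 δ (hb.2.2.2 F hF).2⟩⟩
      rw [h1]
      exact (hb.2.2.2 F hF).1 i
    · obtain ⟨c⟩ := nonempty_code (N := N) (A := Fin ℓ → K)
      exact ⟨c, fun ε δ hb => absurd ⟨hb.1, hb.2.2.1⟩ h⟩
  choose c hc using key
  refine ⟨c, fun ε hε δ hδ => ?_⟩
  obtain ⟨L, hL⟩ := exists_bound (K := K) N hm.symm hR hε hδ
  exact ⟨L, fun ℓ hℓ => hc ℓ ε δ (hL ℓ hℓ)⟩

theorem capacityRegion_eq [Fintype V] [DecidableEq V] [Fintype E] [Fintype ι]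
    [Fintype τ] [Nonempty τ] (N : Network V E ι τ) (K : Type) [Field K] [Finite K] (z : ℕ)
    (hz : ∀ i, z ≤ N.minCut {i}) : N.capacityRegion K z = N.rateRegion z :=
  (N.capacityRegion_subset K z hz).antisymm fun _ hR =>
    subset_closure ⟨hR.1, achievable_of_mem_rateRegion K hR⟩

end Network

/-! ### Reasoning about programs -/

namespace IdxExpr

/-- Only registers below `m` occur. -/
def VarsLt (m : ℕ) : IdxExpr → Prop
  | .const _ => True
  | .var x => x < m
  | .add a b => a.VarsLt m ∧ b.VarsLt m
  | .sub a b => a.VarsLt m ∧ b.VarsLt m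

theorem VarsLt.eval_congr {F : Type} {m : ℕ} {a : IdxExpr} (ha : a.VarsLt m) {s t : Memory F}
    (h : ∀ x < m, t.idx x = s.idx x) : t.eval a = s.eval a := by
  induction a with
  | const n => rfl
  | var x => exact h x ha
  | add a b iha ihb => simp only [Memory.eval, iha ha.1, ihb ha.2]
  | sub a b iha ihb => simp only [Memory.eval, iha ha.1, ihb ha.2]

/-- Indices are never multiplied, so an expression grows at most linearly in its registers; this
bounds the number of loop iterations. -/
theorem VarsLt.exists_eval_le {m : ℕ} {a : IdxExpr} (ha : a.VarsLt m) :
    ∃ W : ℕ, ∀ (F : Type) (s : Memory F) (n : ℕ), (∀ x < m, s.idx x ≤ n) →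
      s.eval a ≤ W * (n + 1) := by
  induction a with
  | const c => exact ⟨c, fun F s n _ => Nat.le_mul_of_pos_right _ (by omega)⟩
  | var x => exact ⟨1, fun F s n h => by simpa [Memory.eval] using (h x ha).trans (by omega)⟩
  | add a b iha ihb =>
    obtain ⟨W, hW⟩ := iha ha.1
    obtain ⟨W', hW'⟩ := ihb ha.2
    refine ⟨W + W', fun F s n h => ?_⟩
    rw [add_mul]
    exact add_le_add (hW F s n h) (hW' F s n h)
  | sub a b iha ihb =>
    obtain ⟨W, hW⟩ := iha ha.1
    exact ⟨W, fun F s n h => (Nat.sub_le _ _).trans (hW F s n h)⟩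

end IdxExpr

namespace Program

/-- The index registers that a program may write. -/
def modIdx : Program → List ℕ
  | .skip => []
  | .setIdx x _ => [x]
  | .setZero _ => []
  | .setOne _ => []
  | .add _ _ _ => []
  | .sub _ _ _ => []
  | .mul _ _ _ => []
  | .inv _ _ => []
  | .seq P Q => P.modIdx ++ Q.modIdx
  | .ifZero _ P Q => P.modIdx ++ Q.modIdx
  | .ifLt _ _ P Q => P.modIdx ++ Q.modIdx
  | .forLt x _ P => x :: P.modIdx

/-- The arrays that a program may write. -/
def modArr : Program → List ℕ
  | .skip => []
  | .setIdx _ _ => []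
  | .setZero p => [p.array]
  | .setOne p => [p.array]
  | .add p _ _ => [p.array]
  | .sub p _ _ => [p.array]
  | .mul p _ _ => [p.array]
  | .inv p _ => [p.array]
  | .seq P Q => P.modArr ++ Q.modArr
  | .ifZero _ P Q => P.modArr ++ Q.modArr
  | .ifLt _ _ P Q => P.modArr ++ Q.modArr
  | .forLt _ _ P => P.modArr

/-- The registers below `m` are never written, and all loop bounds are determined by them. -/
def Bounded (m : ℕ) : Program → Prop
  | .skip => True
  | .setIdx x _ => m ≤ x
  | .setZero _ => True
  | .setOne _ => True
  | .add _ _ _ => True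
  | .sub _ _ _ => True
  | .mul _ _ _ => True
  | .inv _ _ => True
  | .seq P Q => P.Bounded m ∧ Q.Bounded m
  | .ifZero _ P Q => P.Bounded m ∧ Q.Bounded m
  | .ifLt _ _ P Q => P.Bounded m ∧ Q.Bounded m
  | .forLt x a P => m ≤ x ∧ a.VarsLt m ∧ P.Bounded m

/-- `t` differs from `s` at most in the registers `X` and the arrays `A`. -/
def Agree {F : Type} (X A : List ℕ) (s t : Memory F) : Prop :=
  (∀ x, x ∉ X → t.idx x = s.idx x) ∧ ∀ k, k ∉ A → t.arr k = s.arr k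

theorem Agree.refl {F : Type} (X A : List ℕ) (s : Memory F) : Agree X A s s :=
  ⟨fun _ _ => rfl, fun _ _ => rfl⟩

theorem Agree.trans {F : Type} {X A : List ℕ} {s t u : Memory F} (h : Agree X A s t)
    (h' : Agree X A t u) : Agree X A s u :=
  ⟨fun x hx => (h'.1 x hx).trans (h.1 x hx), fun k hk => (h'.2 k hk).trans (h.2 k hk)⟩

theorem Agree.mono {F : Type} {X A X' A' : List ℕ} {s t : Memory F} (h : Agree X A s t)
    (hX : X ⊆ X') (hA : A ⊆ A') : Agree X' A' s t :=
  ⟨fun x hx => h.1 x fun h => hx (hX h), fun k hk => h.2 k fun h => hk (hA h)⟩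

theorem agree_setIdx {F : Type} (X A : List ℕ) (s : Memory F) {x : ℕ} (hx : x ∈ X) (n : ℕ) :
    Agree X A s (s.setIdx x n) := by
  refine ⟨fun y hy => ?_, fun k _ => rfl⟩
  have : y ≠ x := fun h => hy (h ▸ hx)
  simp [Memory.setIdx, this]

theorem agree_set {F : Type} (X A : List ℕ) (s : Memory F) {p : Cell} (hp : p.array ∈ A) (a : F) :
    Agree X A s (s.set p a) := by
  refine ⟨fun y _ => rfl, fun k hk => ?_⟩
  have : k ≠ p.array := fun h => hk (h ▸ hp)
  simp [Memory.set, this]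

variable {F : Type} [Field F] [DecidableEq F]

/-- Memory and step count after `n` iterations of a loop. -/
def iterate (x : ℕ) (P : Program) (s : Memory F) : ℕ → Memory F × ℕ
  | 0 => (s, 1)
  | j + 1 => ((P.run ((iterate x P s j).1.setIdx x j)).1,
      (iterate x P s j).2 + (P.run ((iterate x P s j).1.setIdx x j)).2 + 1)

theorem run_forLt (x : ℕ) (a : IdxExpr) (P : Program) (s : Memory F) :
    (forLt x a P).run s = iterate x P s (s.eval a) := by
  simp only [run]
  generalize s.eval a = n
  induction n with
  | zero => rfl
  | succ n ih => simp only [iterate, ← ih]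

/-- The final memory. -/
def exec (P : Program) (s : Memory F) : Memory F := (P.run s).1

theorem exec_seq (P Q : Program) (s : Memory F) : (seq P Q).exec s = Q.exec (P.exec s) := rfl

theorem exec_ifZero (p : Cell) (P Q : Program) (s : Memory F) :
    (ifZero p P Q).exec s = if s.get p = 0 then P.exec s else Q.exec s := by
  simp only [exec, run]
  split_ifs <;> rfl

theorem exec_ifLt (a b : IdxExpr) (P Q : Program) (s : Memory F) :
    (ifLt a b P Q).exec s = if s.eval a < s.eval b then P.exec s else Q.exec s := by
  simp only [exec, run]
  split_ifs <;> rfl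

theorem exec_skip (s : Memory F) : skip.exec s = s := rfl

theorem exec_setIdx (x : ℕ) (a : IdxExpr) (s : Memory F) :
    (setIdx x a).exec s = s.setIdx x (s.eval a) := rfl

theorem exec_setZero (p : Cell) (s : Memory F) : (setZero p).exec s = s.set p 0 := rfl

theorem exec_setOne (p : Cell) (s : Memory F) : (setOne p).exec s = s.set p 1 := rfl

theorem exec_add (p q t : Cell) (s : Memory F) :
    (add p q t).exec s = s.set p (s.get q + s.get t) := rfl

theorem exec_sub (p q t : Cell) (s : Memory F) :
    (sub p q t).exec s = s.set p (s.get q - s.get t) := rfl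

theorem exec_mul (p q t : Cell) (s : Memory F) :
    (mul p q t).exec s = s.set p (s.get q * s.get t) := rfl

theorem exec_inv (p q : Cell) (s : Memory F) :
    (inv p q).exec s = s.set p (s.get q)⁻¹ := rfl

/-- Frame rule: what a program leaves alone can be read off its text. All later specifications carry
values past intermediate programs in this way. -/
theorem agree_exec (P : Program) (s : Memory F) : Agree P.modIdx P.modArr s (P.exec s) := by
  induction P generalizing s with
  | skip => exact Agree.refl _ _ _
  | setIdx x a => exact agree_setIdx _ _ _ (by simp [modIdx]) _
  | setZero p => exact agree_set _ _ _ (by simp [modArr]) _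
  | setOne p => exact agree_set _ _ _ (by simp [modArr]) _
  | add p q t => exact agree_set _ _ _ (by simp [modArr]) _
  | sub p q t => exact agree_set _ _ _ (by simp [modArr]) _
  | mul p q t => exact agree_set _ _ _ (by simp [modArr]) _
  | inv p q => exact agree_set _ _ _ (by simp [modArr]) _
  | seq P Q ihP ihQ =>
    exact ((ihP s).mono (by simp [modIdx]) (by simp [modArr])).trans
      ((ihQ _).mono (by simp [modIdx]) (by simp [modArr]))
  | ifZero p P Q ihP ihQ =>
    rw [exec_ifZero]
    split_ifs
    · exact (ihP s).mono (by simp [modIdx]) (by simp [modArr])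
    · exact (ihQ s).mono (by simp [modIdx]) (by simp [modArr])
  | ifLt a b P Q ihP ihQ =>
    rw [exec_ifLt]
    split_ifs
    · exact (ihP s).mono (by simp [modIdx]) (by simp [modArr])
    · exact (ihQ s).mono (by simp [modIdx]) (by simp [modArr])
  | forLt x a P ih =>
    rw [exec, run_forLt]
    generalize s.eval a = n
    induction n with
    | zero => exact Agree.refl _ _ _
    | succ n ihn =>
      refine (ihn.trans (agree_setIdx _ _ _ (by simp [modIdx]) n)).trans ((ih _).mono ?_ ?_)
      · simp [modIdx]
      · simp [modArr]

/-- Loop invariants. -/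
theorem exec_forLt_induction {x : ℕ} {a : IdxExpr} {P : Program} {s : Memory F}
    (I : ℕ → Memory F → Prop) (h0 : I 0 s)
    (hstep : ∀ j < s.eval a, ∀ t, Agree (x :: P.modIdx) P.modArr s t → I j t →
      I (j + 1) (P.exec (t.setIdx x j))) : I (s.eval a) ((forLt x a P).exec s) := by
  rw [exec, run_forLt]
  generalize s.eval a = n at *
  suffices h : ∀ m ≤ n, Agree (x :: P.modIdx) P.modArr s (iterate x P s m).1 ∧
      I m (iterate x P s m).1 from (h n le_rfl).2
  intro m hm
  induction m with
  | zero => exact ⟨Agree.refl _ _ _, h0⟩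
  | succ m ih =>
    obtain ⟨h1, h2⟩ := ih (by omega)
    exact ⟨(h1.trans (agree_setIdx _ _ _ (by simp) m)).trans
      ((agree_exec P _).mono (by simp) (by simp)), hstep m (by omega) _ h1 h2⟩

theorem Bounded.notMem_modIdx {m : ℕ} {P : Program} (hP : P.Bounded m) {x : ℕ} (hx : x < m) :
    x ∉ P.modIdx := by
  induction P with
  | skip => simp [modIdx]
  | setIdx y a => simp only [Bounded] at hP; simp [modIdx]; omega
  | setZero p => simp [modIdx]
  | setOne p => simp [modIdx]
  | add p q t => simp [modIdx]
  | sub p q t => simp [modIdx]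
  | mul p q t => simp [modIdx]
  | inv p q => simp [modIdx]
  | seq P Q ihP ihQ => simp [modIdx, ihP hP.1, ihQ hP.2]
  | ifZero p P Q ihP ihQ => simp [modIdx, ihP hP.1, ihQ hP.2]
  | ifLt a b P Q ihP ihQ => simp [modIdx, ihP hP.1, ihQ hP.2]
  | forLt y a P ih =>
    have := hP.1
    simp [modIdx, ih hP.2.2]
    omega

theorem Bounded.idx_exec {m : ℕ} {P : Program} (hP : P.Bounded m) (s : Memory F) {x : ℕ}
    (hx : x < m) : (P.exec s).idx x = s.idx x :=
  (agree_exec P s).1 x (hP.notMem_modIdx hx)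

/-- A program whose loop bounds are determined by input sizes takes polynomial time. -/
theorem Bounded.exists_run_le {m : ℕ} {P : Program} (hP : P.Bounded m) :
    ∃ C k : ℕ, ∀ (F : Type) [Field F] [DecidableEq F] (s : Memory F) (n : ℕ),
      (∀ x < m, s.idx x ≤ n) → (P.run s).2 ≤ C * (n + 1) ^ k := by
  induction P with
  | skip => exact ⟨1, 0, fun F _ _ s n _ => by simp [run]⟩
  | setIdx x a => exact ⟨1, 0, fun F _ _ s n _ => by simp [run]⟩
  | setZero p => exact ⟨1, 0, fun F _ _ s n _ => by simp [run]⟩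
  | setOne p => exact ⟨1, 0, fun F _ _ s n _ => by simp [run]⟩
  | add p q t => exact ⟨1, 0, fun F _ _ s n _ => by simp [run]⟩
  | sub p q t => exact ⟨1, 0, fun F _ _ s n _ => by simp [run]⟩
  | mul p q t => exact ⟨1, 0, fun F _ _ s n _ => by simp [run]⟩
  | inv p q => exact ⟨1, 0, fun F _ _ s n _ => by simp [run]⟩
  | seq P Q ihP ihQ =>
    obtain ⟨C, k, h⟩ := ihP hP.1
    obtain ⟨C', k', h'⟩ := ihQ hP.2
    refine ⟨C + C', k + k', fun F _ _ s n hs => ?_⟩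
    have h1 := h F s n hs
    have h2 := h' F (P.exec s) n fun x hx => (hP.1.idx_exec s hx).trans_le (hs x hx)
    have h3 : (n + 1) ^ k ≤ (n + 1) ^ (k + k') := Nat.pow_le_pow_right (by omega) (by omega)
    have h4 : (n + 1) ^ k' ≤ (n + 1) ^ (k + k') := Nat.pow_le_pow_right (by omega) (by omega)
    calc _ ≤ C * (n + 1) ^ k + C' * (n + 1) ^ k' := add_le_add h1 h2
      _ ≤ C * (n + 1) ^ (k + k') + C' * (n + 1) ^ (k + k') := by gcongr
      _ = _ := by ring
  | ifZero p P Q ihP ihQ =>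
    obtain ⟨C, k, h⟩ := ihP hP.1
    obtain ⟨C', k', h'⟩ := ihQ hP.2
    refine ⟨C + C' + 1, k + k', fun F _ _ s n hs => ?_⟩
    have h1 := h F s n hs
    have h2 := h' F s n hs
    have h3 : (n + 1) ^ k ≤ (n + 1) ^ (k + k') := Nat.pow_le_pow_right (by omega) (by omega)
    have h4 : (n + 1) ^ k' ≤ (n + 1) ^ (k + k') := Nat.pow_le_pow_right (by omega) (by omega)
    have h5 : 1 ≤ (n + 1) ^ (k + k') := Nat.one_le_pow _ _ (by omega)
    have h6 := Nat.mul_le_mul_left C h3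
    have h7 := Nat.mul_le_mul_left C' h4
    simp only [run]
    rw [add_mul, add_mul, one_mul]
    split_ifs <;> simp only <;> omega
  | ifLt a b P Q ihP ihQ =>
    obtain ⟨C, k, h⟩ := ihP hP.1
    obtain ⟨C', k', h'⟩ := ihQ hP.2
    refine ⟨C + C' + 1, k + k', fun F _ _ s n hs => ?_⟩
    have h1 := h F s n hs
    have h2 := h' F s n hs
    have h3 : (n + 1) ^ k ≤ (n + 1) ^ (k + k') := Nat.pow_le_pow_right (by omega) (by omega)
    have h4 : (n + 1) ^ k' ≤ (n + 1) ^ (k + k') := Nat.pow_le_pow_right (by omega) (by omega)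
    have h5 : 1 ≤ (n + 1) ^ (k + k') := Nat.one_le_pow _ _ (by omega)
    have h6 := Nat.mul_le_mul_left C h3
    have h7 := Nat.mul_le_mul_left C' h4
    simp only [run]
    rw [add_mul, add_mul, one_mul]
    split_ifs <;> simp only <;> omega
  | forLt x a P ih =>
    obtain ⟨hx, ha, hP'⟩ := hP
    obtain ⟨C, k, h⟩ := ih hP'
    obtain ⟨W, hW⟩ := ha.exists_eval_le
    -- At most `W * (n + 1)` iterations of cost `C * (n + 1) ^ k + 1` each, plus one step for the
    -- loop itself; a loop raises the degree by one.
    refine ⟨1 + W * (C + 1), k + 1, fun F _ _ s n hs => ?_⟩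
    have h1 := hW F s n hs
    rw [run_forLt]
    generalize s.eval a = N at h1
    have key : ∀ N, (∀ y < m, (iterate x P s N).1.idx y ≤ n) ∧
        (iterate x P s N).2 ≤ 1 + N * (C * (n + 1) ^ k + 1) := by
      intro N
      induction N with
      | zero => exact ⟨hs, by simp [iterate]⟩
      | succ N ihN =>
        have hidx : ∀ y < m, ((iterate x P s N).1.setIdx x N).idx y ≤ n := by
          intro y hy
          have : y ≠ x := by omega
          simpa [Memory.setIdx, this] using ihN.1 y hy
        refine ⟨fun y hy => (hP'.idx_exec _ hy).trans_le (hidx y hy), ?_⟩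
        have h2 := h F _ n hidx
        have h3 := ihN.2
        simp only [iterate]
        rw [add_mul, one_mul]
        omega
    refine (key N).2.trans ?_
    have h2 : 1 ≤ (n + 1) ^ k := Nat.one_le_pow _ _ (by omega)
    calc 1 + N * (C * (n + 1) ^ k + 1)
        ≤ (n + 1) ^ (k + 1) + W * (n + 1) * (C * (n + 1) ^ k + (n + 1) ^ k) := by
          gcongr
          exact Nat.one_le_pow _ _ (by omega)
      _ = _ := by ring

/-- A loop that fills a part of one row of an array. -/
theorem exec_fillRow {x : ℕ} {a : IdxExpr} {P : Program} {s : Memory F} (dst ρ co n : ℕ)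
    (f : ℕ → F) (ha : s.eval a = n)
    (hbody : ∀ t j, j < n → Agree (x :: P.modIdx) P.modArr s t →
      (∀ k l, ¬ (k = ρ ∧ co ≤ l ∧ l < co + j) → t.arr dst k l = s.arr dst k l) →
      (P.exec (t.setIdx x j)).arr dst =
        fun k l => if k = ρ ∧ l = co + j then f j else t.arr dst k l) :
    ((forLt x a P).exec s).arr dst =
      fun k l => if k = ρ ∧ co ≤ l ∧ l < co + n then f (l - co) else s.arr dst k l := by
  subst ha
  refine exec_forLt_induction (fun j t => t.arr dst =
    fun k l => if k = ρ ∧ co ≤ l ∧ l < co + j then f (l - co) else s.arr dst k l) ?_ ?_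
  · funext k l
    rw [if_neg (by omega)]
  · intro j hj t ht hI
    rw [hbody t j hj ht fun k l hkl => by rw [hI]; simp only [if_neg hkl], hI]
    funext k l
    by_cases h : k = ρ ∧ l = co + j
    · rw [if_pos h, if_pos (by omega)]
      congr 1
      omega
    · rw [if_neg h]
      exact if_congr (by omega) rfl rfl

/-- A double loop that fills a block of an array. -/
theorem exec_fill {x y : ℕ} {a b : IdxExpr} {P : Program} {s : Memory F} (dst ro co m n : ℕ)
    (f : ℕ → ℕ → F) (hxy : x ≠ y) (hx : x ∉ P.modIdx) (ha : s.eval a = m)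
    (hb : ∀ t, Agree (x :: y :: P.modIdx) P.modArr s t → t.eval b = n)
    (hbody : ∀ t i j, i < m → j < n → Agree (x :: y :: P.modIdx) P.modArr s t → t.idx x = i →
      t.idx y = j → (P.exec t).arr dst =
        fun k l => if k = ro + i ∧ l = co + j then f i j else t.arr dst k l) :
    ((forLt x a (forLt y b P)).exec s).arr dst =
      fun k l => if ro ≤ k ∧ k < ro + m ∧ co ≤ l ∧ l < co + n then f (k - ro) (l - co)
        else s.arr dst k l := by
  subst ha
  refine exec_forLt_induction (fun i t => t.arr dst =
    fun k l => if ro ≤ k ∧ k < ro + i ∧ co ≤ l ∧ l < co + n then f (k - ro) (l - co)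
      else s.arr dst k l) ?_ ?_
  · funext k l
    rw [if_neg (by omega)]
  · intro i hi t ht hI
    have ht' : Agree (x :: y :: P.modIdx) P.modArr s (t.setIdx x i) :=
      ht.trans (agree_setIdx _ _ _ (by simp) _)
    rw [exec_fillRow dst (ro + i) co n (f i) (hb _ ht')]
    · funext k l
      change (if _ then _ else t.arr dst k l) = _
      rw [hI]
      by_cases h : k = ro + i ∧ co ≤ l ∧ l < co + n
      · rw [if_pos h, if_pos (by omega)]
        congr 1
        omega
      · rw [if_neg h]
        exact if_congr (by omega) rfl rfl
    · intro u j hj hu _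
      have hu' : Agree (x :: y :: P.modIdx) P.modArr s (u.setIdx y j) :=
        (ht'.trans (hu.mono (by simp) (by simp))).trans (agree_setIdx _ _ _ (by simp) _)
      refine hbody _ i j hi hj hu' ?_ ?_
      · have h1 := hu.1 x (by simp [hxy, hx])
        simp [Memory.setIdx, hxy, h1]
      · simp [Memory.setIdx]

end Program

/-! ### Elimination -/

namespace Elimination

variable {F : Type} [Field F] {κ J : Type} {B r : ℕ}

/-- The span of the first `B` rows. -/
def rowSpan (B : ℕ) (w : ℕ → (κ → F) × (J → F)) : Submodule F ((κ → F) × (J → F)) :=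
  Submodule.span F (w '' Set.Iio B)

/-- The state after the first `i` of the `B` rows have been used to clear a column. -/
structure Reduced (B r : ℕ) (w₀ : ℕ → (κ → F) × (J → F)) (i : ℕ) (w : ℕ → (κ → F) × (J → F)) :
    Prop where
  span_eq : rowSpan B w = rowSpan B w₀
  sub_mem : ∀ a < r, w (B + a) - w₀ (B + a) ∈ rowSpan B w₀
  pivot : ∀ k < i, (w k).1 = 0 ∨ ∃ p, (w k).1 p ≠ 0 ∧ ∀ k' < B + r, k' ≠ k → (w k').1 p = 0

theorem reduced_zero (w : ℕ → (κ → F) × (J → F)) : Reduced B r w 0 w :=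
  ⟨rfl, fun a _ => by simp, fun k hk => absurd hk (by omega)⟩

/-- Subtracting multiples of row `i` from the other rows keeps the span of the first `B` rows and
moves the remaining rows only within it. Older pivots survive because row `i` already vanishes in
their columns. No rows are exchanged: each row looks for its own pivot. If row `i` has zero first
component, the multipliers may be arbitrary. -/
theorem Reduced.step {w₀ w w' : ℕ → (κ → F) × (J → F)} {i : ℕ} (h : Reduced B r w₀ i w)
    (hi : i < B) (f : ℕ → F)
    (hf : (w i).1 = 0 ∨
      ∃ p, (w i).1 p ≠ 0 ∧ ∀ k, f k = (w k).1 p * ((w i).1 p)⁻¹)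
    (hw' : ∀ k < B + r, w' k = if k = i then w k else w k - f k • w i) :
    Reduced B r w₀ (i + 1) w' := by
  have hwi : w' i = w i := by simp [hw' i (by omega)]
  have hmem : ∀ k < B, w k ∈ rowSpan B w := fun k hk => Submodule.subset_span ⟨k, hk, rfl⟩
  have hmem' : ∀ k < B, w' k ∈ rowSpan B w' := fun k hk => Submodule.subset_span ⟨k, hk, rfl⟩
  refine ⟨?_, ?_, ?_⟩
  · rw [← h.span_eq]
    apply le_antisymm
    · rw [rowSpan, Submodule.span_le]
      rintro _ ⟨k, hk, rfl⟩
      have hk' : k < B := hk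
      rw [hw' k (by omega)]
      split_ifs
      · exact hmem k hk
      · exact Submodule.sub_mem _ (hmem k hk) (Submodule.smul_mem _ _ (hmem i hi))
    · rw [rowSpan, Submodule.span_le]
      rintro _ ⟨k, hk, rfl⟩
      have hk' : k < B := hk
      have h1 := hmem' k hk
      by_cases hki : k = i
      · rw [hki, ← hwi]
        exact hmem' i hi
      · have h2 : w k = w' k + f k • w' i := by
          rw [hwi, hw' k (by omega), if_neg hki, sub_add_cancel]
        rw [h2]
        exact Submodule.add_mem _ h1 (Submodule.smul_mem _ _ (hmem' i hi))
  · intro a ha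
    rw [hw' _ (by omega), if_neg (by omega), sub_right_comm]
    refine Submodule.sub_mem _ (h.sub_mem a ha) (Submodule.smul_mem _ _ ?_)
    rw [← h.span_eq]
    exact hmem i hi
  · intro k hk
    by_cases hki : k = i
    · subst hki
      rw [hwi]
      rcases hf with h0 | ⟨p, hp, hf⟩
      · exact Or.inl h0
      · refine Or.inr ⟨p, hp, fun k' hk' hne => ?_⟩
        rw [hw' k' hk', if_neg hne]
        simp [hf, hp]
    -- A row with zero first component stays such: either its multiplier is zero, or row `i` has
    -- zero first component itself.
    · rcases h.pivot k (by omega) with h0 | ⟨p, hp, hz⟩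
      · left
        rw [hw' k (by omega), if_neg hki]
        rcases hf with hf | ⟨p, hp, hf⟩
        · simp [hf, h0]
        · simp [hf, h0]
      · have hip : (w i).1 p = 0 := hz i (by omega) (Ne.symm hki)
        refine Or.inr ⟨p, ?_, fun k' hk' hne => ?_⟩
        · rw [hw' k (by omega), if_neg hki]
          simpa [hip] using hp
        · rw [hw' k' hk']
          split_ifs
          · exact hz k' hk' hne
          · simp [hip, hz k' hk' hne]

theorem mem_rowSpan_iff {w : ℕ → (κ → F) × (J → F)} {x : (κ → F) × (J → F)} :
    x ∈ rowSpan B w ↔ ∃ c : ℕ → F, ∑ k ∈ Finset.range B, c k • w k = x := by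
  constructor
  · intro h
    induction h using Submodule.span_induction with
    | mem x hx =>
      obtain ⟨k, hk, rfl⟩ := hx
      have hk' : k < B := hk
      exact ⟨Pi.single k 1, by simp [Pi.single_apply, hk']⟩
    | zero => exact ⟨0, by simp⟩
    | add x y _ _ hx hy =>
      obtain ⟨c, rfl⟩ := hx
      obtain ⟨c', rfl⟩ := hy
      exact ⟨c + c', by simp [add_smul, Finset.sum_add_distrib]⟩
    | smul a x _ hx =>
      obtain ⟨c, rfl⟩ := hx
      exact ⟨a • c, by simp [Finset.smul_sum, smul_smul]⟩
  · rintro ⟨c, rfl⟩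
    exact Submodule.sum_mem _ fun k hk => Submodule.smul_mem _ _
      (Submodule.subset_span ⟨k, by simpa using hk, rfl⟩)

/-- In a reduced state a combination that vanishes at the pivots only involves zero rows. -/
theorem Reduced.coeff {w₀ w : ℕ → (κ → F) × (J → F)} (h : Reduced B r w₀ B w) {c : ℕ → F}
    (hc : ∀ k < B, ∀ p, (w k).1 p ≠ 0 → (∀ k' < B + r, k' ≠ k → (w k').1 p = 0) →
      (∑ l ∈ Finset.range B, c l • w l).1 p = 0) :
    ∀ k < B, c k = 0 ∨ (w k).1 = 0 := by
  intro k hk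
  rcases h.pivot k hk with h0 | ⟨p, hp, hz⟩
  · exact Or.inr h0
  · left
    have h1 := hc k hk p hp hz
    rw [Prod.fst_sum, Finset.sum_apply, Finset.sum_eq_single k] at h1
    · simpa [hp] using h1
    · intro l hl hlk
      simp [hz l (by simp at hl; omega) hlk]
    · intro hk'
      simp at hk'
      omega

section Solve

variable [Fintype J] {Y : Matrix (Fin B) J F} {P : Matrix J κ F} {H : Matrix (Fin r) κ F}
  {w₀ w : ℕ → (κ → F) × (J → F)}

/-- The initial state for the system `M * P = H` with the rows of `M` in the row space of `Y`. -/
structure Initial (Y : Matrix (Fin B) J F) (P : Matrix J κ F) (H : Matrix (Fin r) κ F)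
    (w₀ : ℕ → (κ → F) × (J → F)) : Prop where
  left : ∀ k : Fin B, w₀ k = (Y.row k ᵥ* P, Y.row k)
  right : ∀ a : Fin r, w₀ (B + a) = (H.row a, 0)

/-- The initial rows are points of the graph of `v ↦ v ᵥ* P`, so their span is the graph over the
row space of `Y`; the second component keeps track of the combination. -/
theorem Initial.mem_iff (h₀ : Initial Y P H w₀) {x : (κ → F) × (J → F)} :
    x ∈ rowSpan B w₀ ↔ x.1 = x.2 ᵥ* P ∧ x.2 ∈ Submodule.span F (Set.range Y.row) := by
  constructor
  · intro h
    induction h using Submodule.span_induction with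
    | mem x hx =>
      obtain ⟨k, hk, rfl⟩ := hx
      have := h₀.left ⟨k, hk⟩
      simp only at this
      rw [this]
      exact ⟨rfl, Submodule.subset_span ⟨_, rfl⟩⟩
    | zero => simp
    | add x y _ _ hx hy =>
      exact ⟨by rw [Prod.fst_add, Prod.snd_add, add_vecMul, hx.1, hy.1],
        Submodule.add_mem _ hx.2 hy.2⟩
    | smul a x _ hx =>
      exact ⟨by rw [Prod.smul_fst, Prod.smul_snd, smul_vecMul, hx.1],
        Submodule.smul_mem _ _ hx.2⟩
  · rintro ⟨h1, h2⟩
    have : x = (x.2 ᵥ* P, x.2) := Prod.ext h1 rfl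
    rw [this]
    generalize x.2 = v at h2
    induction h2 using Submodule.span_induction with
    | mem v hv =>
      obtain ⟨k, rfl⟩ := hv
      rw [← h₀.left k]
      exact Submodule.subset_span ⟨k, k.2, rfl⟩
    | zero =>
      rw [zero_vecMul]
      exact Submodule.zero_mem _
    | add u v _ _ hu hv =>
      rw [add_vecMul]
      exact Submodule.add_mem _ hu hv
    | smul a v _ hv =>
      rw [smul_vecMul]
      exact Submodule.smul_mem _ _ hv

/-- What the elimination has to find for the system to have exactly one solution. -/
def Solvable (B r : ℕ) (w : ℕ → (κ → F) × (J → F)) : Prop :=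
  (∀ k < B, (w k).1 = 0 → (w k).2 = 0) ∧ ∀ a < r, (w (B + a)).1 = 0

/-- A lower row starts as `(H_a, 0)` and changes by points of the graph. Once its first component is
cleared, the negated second component solves the equation for row `a`. -/
theorem Reduced.right_mem (h₀ : Initial Y P H w₀) (h : Reduced B r w₀ B w) (a : Fin r) :
    (w (B + a)).1 = H.row a + (w (B + a)).2 ᵥ* P ∧
      (w (B + a)).2 ∈ Submodule.span F (Set.range Y.row) := by
  have h1 := h₀.mem_iff.1 (h.sub_mem a a.2)
  rw [h₀.right] at h1
  simp only [Prod.fst_sub, Prod.snd_sub, sub_zero] at h1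
  exact ⟨by rw [← h1.1]; abel, h1.2⟩

/-- A vector `v` of the row space with zero image gives the point `(0, v)` of the span. Vanishing at
all pivots, it combines only rows with zero first component, and `hs` makes these zero. -/
theorem Reduced.eq_zero_of_vecMul_eq_zero (h₀ : Initial Y P H w₀) (h : Reduced B r w₀ B w)
    (hs : ∀ k < B, (w k).1 = 0 → (w k).2 = 0) {v : J → F}
    (hv : v ∈ Submodule.span F (Set.range Y.row)) (hv0 : v ᵥ* P = 0) : v = 0 := by
  have h1 : ((0 : κ → F), v) ∈ rowSpan B w := by
    rw [h.span_eq, h₀.mem_iff]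
    exact ⟨hv0.symm, hv⟩
  obtain ⟨c, hc⟩ := mem_rowSpan_iff.1 h1
  have h2 := h.coeff (c := c) fun k _ p _ _ => by rw [hc]; rfl
  have h3 := congrArg Prod.snd hc
  simp only at h3
  rw [← h3, Prod.snd_sum]
  refine Finset.sum_eq_zero fun k hk => ?_
  rw [Finset.mem_range] at hk
  rcases h2 k hk with h4 | h4
  · simp [h4]
  · simp [hs k hk h4]

theorem Reduced.solution (h₀ : Initial Y P H w₀) (h : Reduced B r w₀ B w)
    (hs : Solvable B r w) :
    ((∀ a, (Matrix.of fun (a : Fin r) j => -(w (B + a)).2 j).row a ∈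
      Submodule.span F (Set.range Y.row)) ∧
      (Matrix.of fun (a : Fin r) j => -(w (B + a)).2 j) * P = H) ∧
    ∀ M : Matrix (Fin r) J F, (∀ a, M.row a ∈ Submodule.span F (Set.range Y.row)) ∧ M * P = H →
      M = Matrix.of fun (a : Fin r) j => -(w (B + a)).2 j := by
  have h1 : ∀ a : Fin r, (Matrix.of fun (a : Fin r) j => -(w (B + a)).2 j).row a ∈
      Submodule.span F (Set.range Y.row) := by
    intro a
    have := Submodule.neg_mem _ (h.right_mem h₀ a).2
    exact this
  have h2 : (Matrix.of fun (a : Fin r) j => -(w (B + a)).2 j) * P = H := by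
    ext a j
    have h3 := (h.right_mem h₀ a).1
    rw [hs.2 a a.2] at h3
    have h4 := congrFun h3 j
    change ((-(w (B + a)).2) ᵥ* P) j = _
    rw [neg_vecMul, Pi.neg_apply]
    simp only [Pi.zero_apply, Pi.add_apply] at h4
    exact (eq_neg_of_add_eq_zero_left h4.symm).symm
  refine ⟨⟨h1, h2⟩, ?_⟩
  rintro M ⟨hM, hMP⟩
  ext a j
  have h5 := h.eq_zero_of_vecMul_eq_zero h₀ hs.1 (Submodule.sub_mem _ (hM a) (h1 a)) (by
    have h6 : (M - Matrix.of fun (a : Fin r) j => -(w (B + a)).2 j) * P = 0 := by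
      rw [Matrix.sub_mul, hMP, h2, sub_self]
    exact congrFun h6 a)
  exact sub_eq_zero.1 (congrFun h5 j)

/-- A row `(0, v)` with `v ≠ 0` could be added to one row of a solution, contradicting uniqueness;
this needs a row, hence `0 < r`. Given a solution, the residue of a lower row is the first component
of a point of the span and vanishes at all pivots, so it is zero. -/
theorem Reduced.solvable (h₀ : Initial Y P H w₀) (h : Reduced B r w₀ B w) (hr : 0 < r)
    (hM : ∃! M : Matrix (Fin r) J F, (∀ a, M.row a ∈ Submodule.span F (Set.range Y.row)) ∧
      M * P = H) : Solvable B r w := by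
  classical
  obtain ⟨M, ⟨h1, h2⟩, huniq⟩ := hM
  constructor
  · intro k hk hk0
    have h3 : w k ∈ rowSpan B w₀ := by
      rw [← h.span_eq]
      exact Submodule.subset_span ⟨k, hk, rfl⟩
    rw [h₀.mem_iff, hk0] at h3
    have h4 := huniq (Matrix.of fun a => M.row a + if a = ⟨0, hr⟩ then (w k).2 else 0) ⟨?_, ?_⟩
    · have h5 := congrFun h4 ⟨0, hr⟩
      have h6 : M ⟨0, hr⟩ + (if (⟨0, hr⟩ : Fin r) = ⟨0, hr⟩ then (w k).2 else 0) =
        M ⟨0, hr⟩ := h5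
      rw [if_pos rfl] at h6
      exact add_eq_left.1 h6
    · intro a
      refine Submodule.add_mem _ (h1 a) ?_
      split_ifs
      · exact h3.2
      · exact Submodule.zero_mem _
    · rw [← h2]
      ext a j
      change ((M.row a + if a = ⟨0, hr⟩ then (w k).2 else 0) ᵥ* P) j = (M.row a ᵥ* P) j
      rw [add_vecMul]
      split_ifs
      · rw [← h3.1, add_zero]
      · simp
  · intro a ha
    obtain ⟨h3, h4⟩ := h.right_mem h₀ ⟨a, ha⟩
    simp only at h3 h4
    have h5 : ((w (B + a)).1, M.row ⟨a, ha⟩ + (w (B + a)).2) ∈ rowSpan B w := by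
      rw [h.span_eq, h₀.mem_iff]
      refine ⟨?_, Submodule.add_mem _ (h1 _) h4⟩
      simp only
      rw [h3, add_vecMul, ← h2]
      rfl
    obtain ⟨c, hc⟩ := mem_rowSpan_iff.1 h5
    have h6 := h.coeff (c := c) fun k hk p _ hz => by
      rw [hc]
      exact hz (B + a) (by omega) (by omega)
    have h7 := congrArg Prod.fst hc
    simp only at h7
    rw [← h7, Prod.fst_sum]
    refine Finset.sum_eq_zero fun k hk => ?_
    rw [Finset.mem_range] at hk
    rcases h6 k hk with h8 | h8
    · simp [h8]
    · simp [h8]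

end Solve

end Elimination

/-! ### The program for linear systems -/

namespace Program

open IdxExpr

variable {F : Type} [Field F] [DecidableEq F]

/-- Raise the flag `x` if some entry of a row is nonzero. -/
def scanRow (arr : ℕ) (e a : IdxExpr) (x : ℕ) : Program :=
  forLt 6 a (ifZero ⟨arr, e, var 6⟩ skip (setIdx x (const 1)))

theorem scanRow_spec (arr : ℕ) (e a : IdxExpr) {x : ℕ} (hx : x ≠ 6) (s : Memory F)
    (he : ∀ t, Agree [6, x] [] s t → t.eval e = s.eval e) :
    ((scanRow arr e a x).exec s).idx x = 0 ↔
      s.idx x = 0 ∧ ∀ j < s.eval a, s.arr arr (s.eval e) j = 0 := by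
  refine exec_forLt_induction (fun n t => t.idx x = 0 ↔
      s.idx x = 0 ∧ ∀ j < n, s.arr arr (s.eval e) j = 0) (by simp) ?_
  intro j hj t ht hI
  have ht' : Agree [6, x] [] s (t.setIdx 6 j) :=
    (ht.mono (by simp [modIdx]) (by simp [modArr])).trans (agree_setIdx _ _ _ (by simp) _)
  have hget : (t.setIdx 6 j).get ⟨arr, e, var 6⟩ = s.arr arr (s.eval e) j := by
    rw [Memory.get, he _ ht', ht'.2 arr (by simp)]
    simp [Memory.eval, Memory.setIdx]
  rw [exec_ifZero, hget]
  simp only [Nat.lt_succ_iff_lt_or_eq, or_imp, forall_and, forall_eq]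
  split_ifs with h
  · simp [exec_skip, Memory.setIdx, hx, hI, h]
  · simp [exec_setIdx, Memory.setIdx, Memory.eval, h]

/-- The column of the last nonzero entry of row `i` (register `4`) is stored in register `5`. -/
def findPivot (eα : IdxExpr) : Program :=
  seq (setIdx 5 (const 0))
    (forLt 6 eα (ifZero ⟨10, var 4, var 6⟩ skip (setIdx 5 (var 6))))

theorem findPivot_spec {eα : IdxExpr} (hα : eα.VarsLt 4) (s : Memory F) :
    (∀ j < s.eval eα, s.arr 10 (s.idx 4) j = 0) ∧ ((findPivot eα).exec s).idx 5 = 0 ∨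
      ((findPivot eα).exec s).idx 5 < s.eval eα ∧
        s.arr 10 (s.idx 4) (((findPivot eα).exec s).idx 5) ≠ 0 := by
  rw [findPivot, exec_seq, exec_setIdx]
  have h0 : (s.setIdx 5 (s.eval (const 0))).eval eα = s.eval eα :=
    hα.eval_congr fun x hx => by simp [Memory.setIdx, show x ≠ 5 by omega]
  have key := exec_forLt_induction (x := 6) (a := eα)
    (P := ifZero ⟨10, var 4, var 6⟩ skip (setIdx 5 (var 6)))
    (s := s.setIdx 5 (s.eval (const 0)))
    (fun n t => (∀ j < n, s.arr 10 (s.idx 4) j = 0) ∧ t.idx 5 = 0 ∨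
      t.idx 5 < n ∧ s.arr 10 (s.idx 4) (t.idx 5) ≠ 0) (by simp [Memory.setIdx, Memory.eval]) ?_
  · rwa [h0] at key
  intro j hj t ht hI
  have hget : (t.setIdx 6 j).get ⟨10, var 4, var 6⟩ = s.arr 10 (s.idx 4) j := by
    have h1 := ht.1 4 (by simp [modIdx])
    have h2 := ht.2 10 (by simp [modArr])
    simp [Memory.get, Memory.eval, Memory.setIdx] at h1 h2 ⊢
    rw [h1, h2]
  rw [exec_ifZero, hget]
  simp only [Nat.lt_succ_iff_lt_or_eq, or_imp, forall_and, forall_eq]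
  split_ifs with h
  · simp only [exec_skip, Memory.setIdx]
    rcases hI with h' | h'
    · left
      simp [h', h]
      exact h'.1
    · right
      simp [h']
  · right
    simp [exec_setIdx, Memory.setIdx, Memory.eval, h]

/-- Subtract a multiple (given in `12`) of row `i` (register `4`) from row `k` (register `7`). -/
def rowOp (arr : ℕ) (e : IdxExpr) : Program :=
  forLt 8 e (seq (mul ⟨12, const 0, const 1⟩ ⟨12, const 0, const 0⟩ ⟨arr, var 4, var 8⟩)
    (sub ⟨arr, var 7, var 8⟩ ⟨arr, var 7, var 8⟩ ⟨12, const 0, const 1⟩))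

/-- The row that is subtracted differs from the target row, and the scratch array from the target
array, so the loop keeps reading the original entries. -/
theorem rowOp_spec {arr : ℕ} (harr : arr ≠ 12) (e : IdxExpr) (s : Memory F)
    (h : s.idx 7 ≠ s.idx 4) :
    ((rowOp arr e).exec s).arr arr = (fun k l => if k = s.idx 7 ∧ l < s.eval e then
      s.arr arr k l - s.arr 12 0 0 * s.arr arr (s.idx 4) l else s.arr arr k l) ∧
    ((rowOp arr e).exec s).arr 12 0 0 = s.arr 12 0 0 := by
  have harr' : (12 : ℕ) ≠ arr := harr.symm
  refine exec_forLt_induction (fun n t => t.arr arr = (fun k l => if k = s.idx 7 ∧ l < n then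
      s.arr arr k l - s.arr 12 0 0 * s.arr arr (s.idx 4) l else s.arr arr k l) ∧
      t.arr 12 0 0 = s.arr 12 0 0) (by simp) ?_
  rintro j hj t ht ⟨hI, hI'⟩
  have h4 := ht.1 4 (by simp [modIdx])
  have h7 := ht.1 7 (by simp [modIdx])
  constructor
  · funext k l
    simp only [exec_seq, exec_mul, exec_sub, Memory.set, Memory.get, Memory.eval, Memory.setIdx,
      Function.update_self, Function.update_of_ne (show (4 : ℕ) ≠ 8 by norm_num),
      Function.update_of_ne (show (7 : ℕ) ≠ 8 by norm_num), h4, h7, hI, hI']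
    by_cases hk : k = s.idx 7
    · subst hk
      rcases lt_trichotomy l j with hl | rfl | hl
      · simp [harr, hl.ne, hl, Nat.lt_succ_of_lt hl]
      · simp [harr, h.symm]
      · simp [harr, hl.ne', hl.not_gt, show ¬ l < j + 1 by omega]
    · simp [hk, harr]
  · simp [exec_seq, exec_mul, exec_sub, Memory.set, Memory.get, Memory.eval, Memory.setIdx, harr',
      hI']

/-- Clear the entry of row `k` (register `7`) in the pivot column of row `i` (register `4`). -/
def clearRow (eα en : IdxExpr) : Program :=
  seq (inv ⟨12, const 0, const 0⟩ ⟨10, var 4, var 5⟩)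
    (seq (mul ⟨12, const 0, const 0⟩ ⟨10, var 7, var 5⟩ ⟨12, const 0, const 0⟩)
      (seq (rowOp 10 eα) (rowOp 11 en)))

/-- The multiplier is stored before any row changes, since the first row operation destroys the
entry it comes from; both arrays then use the same multiplier. -/
theorem clearRow_spec {eα en : IdxExpr} (hα : eα.VarsLt 4) (hn : en.VarsLt 4) (s : Memory F)
    (h : s.idx 7 ≠ s.idx 4) :
    ((clearRow eα en).exec s).arr 10 = (fun k l => if k = s.idx 7 ∧ l < s.eval eα then
      s.arr 10 k l - s.arr 10 k (s.idx 5) * (s.arr 10 (s.idx 4) (s.idx 5))⁻¹ *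
        s.arr 10 (s.idx 4) l else s.arr 10 k l) ∧
    ((clearRow eα en).exec s).arr 11 = (fun k l => if k = s.idx 7 ∧ l < s.eval en then
      s.arr 11 k l - s.arr 10 k (s.idx 5) * (s.arr 10 (s.idx 4) (s.idx 5))⁻¹ *
        s.arr 11 (s.idx 4) l else s.arr 11 k l) := by
  rw [clearRow, exec_seq, exec_seq, exec_seq]
  generalize hs₁ : (mul ⟨12, const 0, const 0⟩ ⟨10, var 7, var 5⟩ ⟨12, const 0, const 0⟩).exec
    ((inv ⟨12, const 0, const 0⟩ ⟨10, var 4, var 5⟩).exec s) = s₁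
  have hidx : s₁.idx = s.idx := by rw [← hs₁]; rfl
  have h10 : s₁.arr 10 = s.arr 10 := by
    rw [← hs₁]
    simp [exec_mul, exec_inv, Memory.set]
  have h11 : s₁.arr 11 = s.arr 11 := by
    rw [← hs₁]
    simp [exec_mul, exec_inv, Memory.set]
  have h12 : s₁.arr 12 0 0 =
      s.arr 10 (s.idx 7) (s.idx 5) * (s.arr 10 (s.idx 4) (s.idx 5))⁻¹ := by
    rw [← hs₁]
    simp [exec_mul, exec_inv, Memory.set, Memory.get, Memory.eval]
  have hα' : s₁.eval eα = s.eval eα := hα.eval_congr fun x _ => by rw [hidx]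
  have ht := agree_exec (rowOp 10 eα) s₁
  have hn' : ((rowOp 10 eα).exec s₁).eval en = s.eval en := hn.eval_congr fun x hx => by
    rw [ht.1 x (by simp [rowOp, modIdx]; omega), hidx]
  obtain ⟨e1, e2⟩ := rowOp_spec (arr := 10) (by norm_num) eα s₁ (by rwa [hidx])
  have h4 := ht.1 4 (by simp [rowOp, modIdx])
  have h7 := ht.1 7 (by simp [rowOp, modIdx])
  have h11' := ht.2 11 (by simp [rowOp, modArr])
  obtain ⟨e3, -⟩ := rowOp_spec (arr := 11) (by norm_num) en ((rowOp 10 eα).exec s₁)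
    (by rwa [h4, h7, hidx])
  constructor
  · rw [(agree_exec (rowOp 11 en) _).2 10 (by simp [rowOp, modArr]), e1, hidx, h10, h12, hα']
    funext k l
    refine if_ctx_congr Iff.rfl (fun hk => ?_) fun _ => rfl
    rw [hk.1]
  · rw [e3, hn', e2, h12, h11', h11, h4, h7, hidx]
    funext k l
    refine if_ctx_congr Iff.rfl (fun hk => ?_) fun _ => rfl
    rw [hk.1]

/-- Clear the pivot column of row `i` (register `4`) in all other rows. -/
def clearOthers (eB er eα en : IdxExpr) : Program :=
  forLt 7 (IdxExpr.add eB er)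
    (ifLt (var 7) (var 4) (clearRow eα en) (ifLt (var 4) (var 7) (clearRow eα en) skip))

theorem clearOthers_spec {eB er eα en : IdxExpr} (hα : eα.VarsLt 4) (hn : en.VarsLt 4)
    (s : Memory F) :
    ((clearOthers eB er eα en).exec s).arr 10 =
      (fun k l => if (k < s.eval eB + s.eval er ∧ k ≠ s.idx 4) ∧ l < s.eval eα then
      s.arr 10 k l - s.arr 10 k (s.idx 5) * (s.arr 10 (s.idx 4) (s.idx 5))⁻¹ *
        s.arr 10 (s.idx 4) l else s.arr 10 k l) ∧
    ((clearOthers eB er eα en).exec s).arr 11 =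
      (fun k l => if (k < s.eval eB + s.eval er ∧ k ≠ s.idx 4) ∧ l < s.eval en then
      s.arr 11 k l - s.arr 10 k (s.idx 5) * (s.arr 10 (s.idx 4) (s.idx 5))⁻¹ *
        s.arr 11 (s.idx 4) l else s.arr 11 k l) := by
  refine exec_forLt_induction (fun m t => t.arr 10 =
      (fun k l => if (k < m ∧ k ≠ s.idx 4) ∧ l < s.eval eα then
      s.arr 10 k l - s.arr 10 k (s.idx 5) * (s.arr 10 (s.idx 4) (s.idx 5))⁻¹ *
        s.arr 10 (s.idx 4) l else s.arr 10 k l) ∧ t.arr 11 =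
      (fun k l => if (k < m ∧ k ≠ s.idx 4) ∧ l < s.eval en then
      s.arr 11 k l - s.arr 10 k (s.idx 5) * (s.arr 10 (s.idx 4) (s.idx 5))⁻¹ *
        s.arr 11 (s.idx 4) l else s.arr 11 k l)) (by simp) ?_
  rintro j hj t ht ⟨h10, h11⟩
  have hidx : ∀ x < 6, (t.setIdx 7 j).idx x = s.idx x := fun x hx => by
    rw [← ht.1 x (by simp [clearRow, rowOp, modIdx]; omega)]
    simp [Memory.setIdx, show x ≠ 7 by omega]
  have h7 : (t.setIdx 7 j).idx 7 = j := by simp [Memory.setIdx]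
  have hα' : (t.setIdx 7 j).eval eα = s.eval eα := hα.eval_congr fun x hx => hidx x (by omega)
  have hn' : (t.setIdx 7 j).eval en = s.eval en := hn.eval_congr fun x hx => hidx x (by omega)
  -- Indices can only be compared by `<`; the two tests together express that the rows are
  -- different.
  have hexec : ((ifLt (var 7) (var 4) (clearRow eα en)
      (ifLt (var 4) (var 7) (clearRow eα en) skip)).exec (t.setIdx 7 j)) =
      if j ≠ s.idx 4 then (clearRow eα en).exec (t.setIdx 7 j) else t.setIdx 7 j := by
    simp only [exec_ifLt, Memory.eval, h7, hidx 4 (by norm_num), exec_skip]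
    rcases lt_trichotomy j (s.idx 4) with h | h | h
    · simp [h, h.ne]
    · simp [h]
    · simp [h, h.ne', h.not_gt]
  rw [hexec]
  split_ifs with hj4
  · obtain ⟨e1, e2⟩ := clearRow_spec hα hn (t.setIdx 7 j) (by rwa [h7, hidx 4 (by norm_num)])
    have h10' : (t.setIdx 7 j).arr 10 = t.arr 10 := rfl
    have h11' : (t.setIdx 7 j).arr 11 = t.arr 11 := rfl
    rw [e1, e2, hα', hn', h7, hidx 4 (by norm_num), hidx 5 (by norm_num), h10', h11', h10, h11]
    constructor
    · funext k l
      by_cases hk : k = j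
      · subst hk
        simp [hj4]
      · have : k < j + 1 ↔ k < j := by omega
        simp [hk, this]
    · funext k l
      by_cases hk : k = j
      · subst hk
        simp [hj4]
      · have : k < j + 1 ↔ k < j := by omega
        simp [hk, this]
  · rw [not_not] at hj4
    change t.arr 10 = _ ∧ t.arr 11 = _
    rw [h10, h11, ← hj4]
    constructor
    · funext k l
      exact if_congr (by omega) rfl rfl
    · funext k l
      exact if_congr (by omega) rfl rfl

/-- Gaussian elimination on the rows of the arrays `10` and `11`. -/
def eliminate (eB er eα en : IdxExpr) : Program :=
  forLt 4 eB (seq (findPivot eα) (clearOthers eB er eα en))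

/-- The rows of the arrays `10` and `11`. -/
def rows {J : Type} (α : ℕ) {n : ℕ} (e : J ≃ Fin n) (s : Memory F) (k : ℕ) :
    (Fin α → F) × (J → F) :=
  (fun j => s.arr 10 k j, fun j => s.arr 11 k (e j))

theorem eliminate_spec {eB er eα en : IdxExpr} (hB : eB.VarsLt 4) (hr : er.VarsLt 4)
    (hα : eα.VarsLt 4) (hn : en.VarsLt 4) {J : Type} {B r α n : ℕ} (e : J ≃ Fin n)
    (s : Memory F) (hB' : s.eval eB = B) (hr' : s.eval er = r) (hα' : s.eval eα = α)
    (hn' : s.eval en = n) :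
    Elimination.Reduced B r (rows α e s) B (rows α e ((eliminate eB er eα en).exec s)) := by
  subst hB' hr' hα' hn'
  refine exec_forLt_induction (fun i t => Elimination.Reduced (s.eval eB) (s.eval er)
    (rows (s.eval eα) e s) i (rows (s.eval eα) e t)) (Elimination.reduced_zero _) ?_
  intro i hi t ht hI
  have hidx : ∀ x < 4, (t.setIdx 4 i).idx x = s.idx x := fun x hx => by
    rw [← ht.1 x (by simp [findPivot, clearOthers, clearRow, rowOp, modIdx]; omega)]
    simp [Memory.setIdx, show x ≠ 4 by omega]
  have hv := agree_exec (findPivot eα) (t.setIdx 4 i)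
  have hp := findPivot_spec hα (t.setIdx 4 i)
  rw [exec_seq]
  generalize (findPivot eα).exec (t.setIdx 4 i) = u at *
  have huidx : ∀ x < 4, u.idx x = s.idx x := fun x hx => by
    rw [hv.1 x (by simp [findPivot, modIdx]; omega), hidx x hx]
  have hu4 : u.idx 4 = i := by
    rw [hv.1 4 (by simp [findPivot, modIdx])]
    simp [Memory.setIdx]
  have ht4 : (t.setIdx 4 i).idx 4 = i := by simp [Memory.setIdx]
  have hu10 : u.arr 10 = t.arr 10 := hv.2 10 (by simp [findPivot, modArr])
  have hu11 : u.arr 11 = t.arr 11 := hv.2 11 (by simp [findPivot, modArr])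
  rw [hα.eval_congr hidx, ht4] at hp
  have ht10 : (t.setIdx 4 i).arr 10 = t.arr 10 := rfl
  rw [ht10] at hp
  obtain ⟨e1, e2⟩ := clearOthers_spec (eB := eB) (er := er) hα hn u
  rw [hB.eval_congr huidx, hr.eval_congr huidx, hα.eval_congr huidx, hu4, hu10] at e1
  rw [hB.eval_congr huidx, hr.eval_congr huidx, hn.eval_congr huidx, hu4, hu10, hu11] at e2
  refine hI.step hi (fun k => t.arr 10 k (u.idx 5) * (t.arr 10 i (u.idx 5))⁻¹) ?_ ?_
  -- For a zero row the pivot column is the default `0` and the multipliers are meaningless, but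
  -- harmless: `Reduced.step` does not restrict them in this case.
  · rcases hp with ⟨h0, -⟩ | ⟨h5, h0⟩
    · exact Or.inl (funext fun j => h0 j j.2)
    · exact Or.inr ⟨⟨_, h5⟩, h0, fun k => rfl⟩
  · intro k hk
    rw [rows, e1, e2]
    by_cases hki : k = i
    · simp [hki, rows]
    · rw [if_neg hki]
      refine Prod.ext ?_ ?_
      · funext j
        simp [rows, hki, hk]
      · funext j
        simp [rows, hki, hk]

end Program

/-! ### Testing for a unique solution and writing it out. -/

namespace Program

open IdxExpr

variable {F : Type} [Field F] [DecidableEq F]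

/-- Raise the flag in register `5` if row `i` (register `4`) is zero in array `10` but not in
array `11`. -/
def checkRow (eα en : IdxExpr) : Program :=
  seq (setIdx 7 (const 0)) (seq (scanRow 10 (var 4) eα 7)
    (ifLt (const 0) (var 7) skip (scanRow 11 (var 4) en 5)))

theorem checkRow_spec {eα en : IdxExpr} (hα : eα.VarsLt 4) (hn : en.VarsLt 4) (s : Memory F) :
    ((checkRow eα en).exec s).idx 5 = 0 ↔ s.idx 5 = 0 ∧
      ((∀ j < s.eval eα, s.arr 10 (s.idx 4) j = 0) →
        ∀ j < s.eval en, s.arr 11 (s.idx 4) j = 0) := by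
  rw [checkRow, exec_seq, exec_seq, exec_setIdx, exec_ifLt]
  have hα' : (s.setIdx 7 (s.eval (const 0))).eval eα = s.eval eα :=
    hα.eval_congr fun x hx => by simp [Memory.setIdx, show x ≠ 7 by omega]
  have e1 := scanRow_spec 10 (var 4) eα (x := 7) (by norm_num) (s.setIdx 7 (s.eval (const 0)))
    (fun t ht => ht.1 4 (by simp))
  have ht := agree_exec (scanRow 10 (var 4) eα 7) (s.setIdx 7 (s.eval (const 0)))
  rw [hα'] at e1
  generalize (scanRow 10 (var 4) eα 7).exec (s.setIdx 7 (s.eval (const 0))) = t at *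
  have hidx : ∀ x < 6, t.idx x = s.idx x := fun x hx => by
    rw [ht.1 x (by simp [scanRow, modIdx]; omega)]
    simp [Memory.setIdx, show x ≠ 7 by omega]
  have h4 : (s.setIdx 7 (s.eval (const 0))).eval (var 4) = s.idx 4 := by
    simp [Memory.eval, Memory.setIdx]
  have h7 : (s.setIdx 7 (s.eval (const 0))).idx 7 = 0 := by
    simp [Memory.eval, Memory.setIdx]
  have h10 : (s.setIdx 7 (s.eval (const 0))).arr 10 = s.arr 10 := rfl
  rw [h4, h7, h10] at e1
  have e2 := scanRow_spec 11 (var 4) en (x := 5) (by norm_num) t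
    (fun u hu => hu.1 4 (by simp))
  have h11 : t.arr 11 = s.arr 11 := ht.2 11 (by simp [scanRow, modArr])
  have h4' : t.eval (var 4) = s.idx 4 := hidx 4 (by norm_num)
  rw [h4', hidx 5 (by norm_num), h11, hn.eval_congr fun x hx => hidx x (by omega)] at e2
  simp only [Memory.eval, Nat.pos_iff_ne_zero, ne_eq, e1, true_and, ite_not, exec_skip]
  split_ifs with h
  · rw [e2]
    tauto
  · rw [hidx 5 (by norm_num)]
    tauto

/-- Determine whether the eliminated system has exactly one solution. -/
def check (eB er eα en : IdxExpr) : Program :=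
  seq (setIdx 5 (const 0)) (seq (forLt 4 eB (checkRow eα en))
    (forLt 4 er (scanRow 10 (IdxExpr.add eB (var 4)) eα 5)))

theorem check_spec {eB er eα en : IdxExpr} (hB : eB.VarsLt 4) (hr : er.VarsLt 4)
    (hα : eα.VarsLt 4) (hn : en.VarsLt 4) {J : Type} {B r α n : ℕ} (e : J ≃ Fin n)
    (s : Memory F) (hB' : s.eval eB = B) (hr' : s.eval er = r) (hα' : s.eval eα = α)
    (hn' : s.eval en = n) :
    ((check eB er eα en).exec s).idx 5 = 0 ↔ Elimination.Solvable B r (rows α e s) := by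
  subst hB' hr' hα' hn'
  have hsol : Elimination.Solvable (s.eval eB) (s.eval er) (rows (s.eval eα) e s) ↔
      (∀ k < s.eval eB, (∀ j < s.eval eα, s.arr 10 k j = 0) → ∀ j < s.eval en, s.arr 11 k j = 0) ∧
      ∀ a < s.eval er, ∀ j < s.eval eα, s.arr 10 (s.eval eB + a) j = 0 := by
    have h1 : ∀ k, (rows (s.eval eα) e s k).1 = 0 ↔ ∀ j < s.eval eα, s.arr 10 k j = 0 := by
      intro k
      rw [funext_iff, Fin.forall_iff]
      rfl
    have h2 : ∀ k, (rows (s.eval eα) e s k).2 = 0 ↔ ∀ j < s.eval en, s.arr 11 k j = 0 := by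
      intro k
      rw [funext_iff, ← e.symm.forall_congr_right, Fin.forall_iff]
      simp [rows]
    simp only [Elimination.Solvable, h1, h2]
  rw [hsol, check, exec_seq, exec_seq, exec_setIdx]
  set s₁ := s.setIdx 5 (s.eval (const 0)) with hs₁
  have hidx₁ : ∀ x < 4, s₁.idx x = s.idx x := fun x hx => by
    simp [hs₁, Memory.setIdx, show x ≠ 5 by omega]
  have hB₁ := hB.eval_congr hidx₁
  have f1 := agree_exec (forLt 4 eB (checkRow eα en)) s₁
  have e1 := exec_forLt_induction (x := 4) (a := eB) (P := checkRow eα en) (s := s₁)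
    (fun i t => t.idx 5 = 0 ↔ ∀ k < i, (∀ j < s.eval eα, s.arr 10 k j = 0) →
      ∀ j < s.eval en, s.arr 11 k j = 0) (by simp [hs₁, Memory.setIdx, Memory.eval]) (by
    intro i hi t ht hI
    have hidx : ∀ x < 4, (t.setIdx 4 i).idx x = s.idx x := fun x hx => by
      rw [← hidx₁ x hx, ← ht.1 x (by simp [checkRow, scanRow, modIdx]; omega)]
      simp [Memory.setIdx, show x ≠ 4 by omega]
    have h10 : (t.setIdx 4 i).arr 10 = s.arr 10 := ht.2 10 (by simp [checkRow, scanRow, modArr])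
    have h11 : (t.setIdx 4 i).arr 11 = s.arr 11 := ht.2 11 (by simp [checkRow, scanRow, modArr])
    have h4 : (t.setIdx 4 i).idx 4 = i := by simp [Memory.setIdx]
    have h5 : (t.setIdx 4 i).idx 5 = t.idx 5 := by simp [Memory.setIdx]
    rw [checkRow_spec hα hn, h10, h11, h4, h5, hI, hα.eval_congr hidx, hn.eval_congr hidx]
    simp only [Nat.lt_succ_iff_lt_or_eq, or_imp, forall_and, forall_eq])
  rw [hB₁] at e1
  generalize (forLt 4 eB (checkRow eα en)).exec s₁ = t at *
  have hidx : ∀ x < 4, t.idx x = s.idx x := fun x hx => by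
    rw [← hidx₁ x hx, ← f1.1 x (by simp [checkRow, scanRow, modIdx]; omega)]
  have h10 : t.arr 10 = s.arr 10 := f1.2 10 (by simp [checkRow, scanRow, modArr])
  have e2 := exec_forLt_induction (x := 4) (a := er)
    (P := scanRow 10 (IdxExpr.add eB (var 4)) eα 5) (s := t)
    (fun i u => u.idx 5 = 0 ↔ t.idx 5 = 0 ∧ ∀ a < i, ∀ j < s.eval eα,
      s.arr 10 (s.eval eB + a) j = 0) (by simp) (by
    intro i hi u hu hI
    have hidx' : ∀ x < 4, (u.setIdx 4 i).idx x = s.idx x := fun x hx => by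
      rw [← hidx x hx, ← hu.1 x (by simp [scanRow, modIdx]; omega)]
      simp [Memory.setIdx, show x ≠ 4 by omega]
    have h10' : (u.setIdx 4 i).arr 10 = s.arr 10 :=
      (hu.2 10 (by simp [scanRow, modArr])).trans h10
    have h4 : (u.setIdx 4 i).eval (IdxExpr.add eB (var 4)) = s.eval eB + i := by
      simp only [Memory.eval, hB.eval_congr hidx']
      simp [Memory.setIdx]
    have h5 : (u.setIdx 4 i).idx 5 = u.idx 5 := by simp [Memory.setIdx]
    rw [scanRow_spec _ _ _ (by norm_num), h10', h4, h5, hI, hα.eval_congr hidx']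
    · simp only [Nat.lt_succ_iff_lt_or_eq, or_imp, forall_and, forall_eq, and_assoc]
    · intro v hv
      simp only [Memory.eval]
      rw [hB.eval_congr fun x hx => hv.1 x (by simp; omega), hv.1 4 (by simp)])
  rw [hr.eval_congr hidx, e1] at e2
  exact e2

/-- The solution is written to array `0`. -/
def output (eB er en : IdxExpr) : Program :=
  forLt 4 er (forLt 6 en (seq (setZero ⟨0, var 4, var 6⟩) (ifLt (const 0) (var 5) skip
    (sub ⟨0, var 4, var 6⟩ ⟨0, var 4, var 6⟩ ⟨11, IdxExpr.add eB (var 4), var 6⟩))))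

/-- Negation is done as subtraction from a cell just set to zero; a raised flag in register `5`
leaves that zero as the decoder's default. -/
theorem output_spec {eB er en : IdxExpr} (hB : eB.VarsLt 4) (hn : en.VarsLt 4) (s : Memory F) :
    ((output eB er en).exec s).arr 0 = fun k l => if k < s.eval er ∧ l < s.eval en then
      (if s.idx 5 = 0 then -s.arr 11 (s.eval eB + k) l else 0) else s.arr 0 k l := by
  rw [output, exec_fill 0 0 0 (s.eval er) (s.eval en)
    (fun k l => if s.idx 5 = 0 then -s.arr 11 (s.eval eB + k) l else 0) (by norm_num)
    (by simp [modIdx]) rfl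
    (fun t ht => hn.eval_congr fun x hx => ht.1 x (by simp [modIdx]; omega))]
  · simp
  · intro t i j hi hj ht h4 h6
    have h5 : t.idx 5 = s.idx 5 := ht.1 5 (by simp [modIdx])
    have h11 : t.arr 11 = s.arr 11 := ht.2 11 (by simp [modArr])
    have hB' : t.eval eB = s.eval eB :=
      hB.eval_congr fun x hx => ht.1 x (by simp [modIdx]; omega)
    have hB'' : (t.set ⟨0, var 4, var 6⟩ 0).eval eB = s.eval eB := by
      rw [← hB']
      exact hB.eval_congr fun x hx => rfl
    simp only [exec_seq, exec_setZero, exec_ifLt, exec_skip, exec_sub]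
    funext k l
    by_cases h0 : s.idx 5 = 0
    · simp only [Memory.set, Memory.get, Memory.eval, h4, h6, h5, h0] at hB'' ⊢
      by_cases hkl : k = i ∧ l = j
      · simp [hkl, h11, hB'']
      · simp [hkl]
    · simp [Memory.set, Memory.eval, h4, h6, h5, h0, Nat.pos_of_ne_zero h0]

/-- Solve the linear system in the arrays `10` and `11`. -/
def solve (eB er eα en : IdxExpr) : Program :=
  seq (eliminate eB er eα en) (seq (check eB er eα en) (output eB er en))

open Classical in
theorem solve_spec {eB er eα en : IdxExpr} (hB : eB.VarsLt 4) (hr : er.VarsLt 4)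
    (hα : eα.VarsLt 4) (hn : en.VarsLt 4) {J : Type} [Fintype J] {B r α n : ℕ} (e : J ≃ Fin n)
    (s : Memory F) (hB' : s.eval eB = B) (hr' : s.eval er = r) (hα' : s.eval eα = α)
    (hn' : s.eval en = n) {Y : Matrix (Fin B) J F} {P : Matrix J (Fin α) F}
    {H : Matrix (Fin r) (Fin α) F} (h₀ : Elimination.Initial Y P H (rows α e s)) (a : Fin r)
    (j : J) :
    ((solve eB er eα en).exec s).arr 0 a (e j) =
      if h : ∃! M : Matrix (Fin r) J F,
        (∀ a, M.row a ∈ Submodule.span F (Set.range Y.row)) ∧ M * P = H then h.choose a j else 0 := by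
  have hred := eliminate_spec hB hr hα hn e s hB' hr' hα' hn'
  have ht := agree_exec (eliminate eB er eα en) s
  rw [solve, exec_seq, exec_seq]
  generalize (eliminate eB er eα en).exec s = t at *
  have hidx : ∀ x < 4, t.idx x = s.idx x := fun x hx =>
    ht.1 x (by simp [eliminate, findPivot, clearOthers, clearRow, rowOp, modIdx]; omega)
  have hchk := check_spec hB hr hα hn e t ((hB.eval_congr hidx).trans hB')
    ((hr.eval_congr hidx).trans hr') ((hα.eval_congr hidx).trans hα')
    ((hn.eval_congr hidx).trans hn')
  have hu := agree_exec (check eB er eα en) t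
  generalize (check eB er eα en).exec t = u at *
  have hidx' : ∀ x < 4, u.idx x = s.idx x := fun x hx =>
    (hu.1 x (by simp [check, checkRow, scanRow, modIdx]; omega)).trans (hidx x hx)
  have h11 : u.arr 11 = t.arr 11 := hu.2 11 (by simp [check, checkRow, scanRow, modArr])
  rw [output_spec hB hn, hB.eval_congr hidx', hr.eval_congr hidx', hn.eval_congr hidx', hB', hr',
    hn', h11]
  simp only [a.2, (e j).2, and_self, if_true]
  by_cases hs : Elimination.Solvable B r (rows α e t)
  · rw [if_pos (hchk.2 hs)]
    obtain ⟨h1, h2⟩ := hred.solution h₀ hs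
    have h : ∃! M : Matrix (Fin r) J F,
        (∀ a, M.row a ∈ Submodule.span F (Set.range Y.row)) ∧ M * P = H := ⟨_, h1, h2⟩
    rw [dif_pos h, h2 _ h.choose_spec.1]
    rfl
  -- The index `a : Fin r` guarantees `0 < r`, so the test is also necessary for a unique solution.
  · rw [if_neg fun h => hs (hchk.1 h),
      dif_neg fun h => hs (hred.solvable h₀ (lt_of_le_of_lt (Nat.zero_le _) a.2) h)]

end Program

/-! ### The programs for mixing, encoding and decoding -/

namespace Program

open IdxExpr

theorem ofMatrix_apply {F : Type} [Field F] {a b : ℕ} (M : Matrix (Fin a) (Fin b) F) (i : Fin a) (j : Fin b) :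
    ofMatrix M i j = M i j := by
  simp [ofMatrix]

theorem ofMatrix_mul {F : Type} [Field F] {a b c : ℕ} (G : Matrix (Fin a) (Fin b) F) (Q : Matrix (Fin b) (Fin c) F)
    {i j : ℕ} (hi : i < a) (hj : j < c) :
    ofMatrix (G * Q) i j = ∑ m ∈ Finset.range b, ofMatrix G i m * ofMatrix Q m j := by
  rw [Finset.sum_range]
  refine (ofMatrix_apply (G * Q) ⟨i, hi⟩ ⟨j, hj⟩).trans ?_
  rw [Matrix.mul_apply]
  refine Finset.sum_congr rfl fun m _ => ?_
  rw [← ofMatrix_apply G, ← ofMatrix_apply Q]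

theorem ofMatrix₂_apply {F : Type} [Field F] {a b c : ℕ} (M : Matrix (Fin a) (Fin b ⊕ Fin c) F)
    (i : Fin a) (j : Fin b ⊕ Fin c) : ofMatrix₂ M i (finSumFinEquiv j) = M i j := by
  rw [ofMatrix₂, ofMatrix_apply]
  simp

variable {F : Type} [Field F] [DecidableEq F]

/-- Copy the cell `q` to the cell `p`. -/
def copyCell (p q : Cell) : Program := seq (setZero p) (add p p q)

/-- The target is zeroed before the source is read, hence the condition that they lie in different
arrays. -/
theorem copyCell_spec {p q : Cell} (h : p.array ≠ q.array) (s : Memory F) :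
    ((copyCell p q).exec s).arr p.array = fun k l =>
      if k = s.eval p.row ∧ l = s.eval p.col then s.get q else s.arr p.array k l := by
  have hev : ∀ (e : IdxExpr) (a : F), (s.set p a).eval e = s.eval e := fun e a => by
    induction e with
    | const n => rfl
    | var x => rfl
    | add a b iha ihb => simp only [Memory.eval, iha, ihb]
    | sub a b iha ihb => simp only [Memory.eval, iha, ihb]
  funext k l
  simp only [copyCell, exec_seq, exec_setZero, exec_add]
  by_cases hkl : k = s.eval p.row ∧ l = s.eval p.col
  · rw [if_pos hkl]
    obtain ⟨rfl, rfl⟩ := hkl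
    simp only [Memory.set, true_and] at *
    simp only [Memory.get, hev, and_self, if_true, zero_add]
    simp [h.symm]
  · rw [if_neg hkl]
    simp only [Memory.set] at *
    simp only [hev, true_and, if_neg hkl]

/-- Store the sum of the products of the cells `x` and `y`, indexed by register `8`, in `p`. -/
def dotProd (p : Cell) (n : IdxExpr) (x y : Cell) : Program :=
  seq (setZero p) (forLt 8 n
    (seq (mul ⟨12, const 0, const 0⟩ x y) (add p p ⟨12, const 0, const 0⟩)))

/-- The loop changes only register `8`, the scratch array `12` and the target array. The hypotheses
ask that addresses, bound and operands be stable under such changes. -/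
theorem dotProd_spec {p : Cell} {n : IdxExpr} {x y : Cell} (hp : p.array ≠ 12) (s : Memory F)
    {ρ σ N : ℕ} {u v : ℕ → F}
    (hrow : ∀ t, Agree [8] [12, p.array] s t → t.eval p.row = ρ ∧ t.eval p.col = σ)
    (hn : ∀ t, Agree [8] [12, p.array] s t → t.eval n = N)
    (hx : ∀ t m, Agree [8] [12, p.array] s t → t.idx 8 = m → m < N →
      t.get x = u m ∧ t.get y = v m) :
    ((dotProd p n x y).exec s).arr p.array = fun k l =>
      if k = ρ ∧ l = σ then ∑ m ∈ Finset.range N, u m * v m else s.arr p.array k l := by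
  rw [dotProd, exec_seq, exec_setZero]
  have h1 : Agree [8] [12, p.array] s (s.set p 0) := agree_set _ _ _ (by simp) _
  rw [← hn _ h1]
  refine exec_forLt_induction (fun m t => t.arr p.array = fun k l =>
      if k = ρ ∧ l = σ then ∑ m ∈ Finset.range m, u m * v m else s.arr p.array k l) ?_ ?_
  · obtain ⟨hρ, hσ⟩ := hrow s (Agree.refl _ _ _)
    funext k l
    simp [Memory.set, hρ, hσ]
  · intro m hm t ht hI
    have h2 : Agree [8] [12, p.array] s (t.setIdx 8 m) :=
      (h1.trans (ht.mono (by simp [modIdx]) (by simp [modArr]))).trans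
        (agree_setIdx _ _ _ (by simp) _)
    rw [hn _ h1] at hm
    obtain ⟨hx', hy'⟩ := hx _ m h2 (by simp [Memory.setIdx]) hm
    rw [exec_seq, exec_mul, exec_add, hx', hy']
    set t' := (t.setIdx 8 m).set ⟨12, const 0, const 0⟩ (u m * v m) with ht'
    have h3 : Agree [8] [12, p.array] s t' := h2.trans (agree_set _ _ _ (by simp) _)
    obtain ⟨hρ, hσ⟩ := hrow _ h3
    have h4 : t'.arr p.array = t.arr p.array := by
      simp [ht', Memory.set, Memory.setIdx, hp]
    have h5 : t'.arr 12 0 0 = u m * v m := by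
      simp [ht', Memory.set, Memory.eval]
    funext k l
    rw [Finset.sum_range_succ]
    simp only [Memory.set, Memory.get, hρ, hσ, h4, true_and, hI, Memory.eval, h5]
    by_cases hkl : k = ρ ∧ l = σ <;> simp [hkl]

/-- Matrix multiplication. -/
def mixProgram : Program :=
  forLt 4 (var 0) (forLt 6 (var 2)
    (dotProd ⟨0, var 4, var 6⟩ (var 1) ⟨1, var 4, var 8⟩ ⟨2, var 8, var 6⟩))

theorem mixProgram_spec {a b c : ℕ} (G : Matrix (Fin a) (Fin b) F) (Q : Matrix (Fin b) (Fin c) F)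
    {i j : ℕ} (hi : i < a) (hj : j < c) :
    (mixProgram.exec (Memory.load [a, b, c] [ofMatrix G, ofMatrix Q])).arr 0 i j =
      ofMatrix (G * Q) i j := by
  have key := exec_fill (x := 4) (y := 6) (a := var 0) (b := var 2)
    (P := dotProd ⟨0, var 4, var 6⟩ (var 1) ⟨1, var 4, var 8⟩ ⟨2, var 8, var 6⟩)
    (s := Memory.load [a, b, c] [ofMatrix G, ofMatrix Q]) 0 0 0 a c
    (fun i j => ∑ m ∈ Finset.range b, ofMatrix G i m * ofMatrix Q m j) (by norm_num)
    (by simp [dotProd, modIdx]) rfl (fun t ht => ht.1 2 (by simp [dotProd, modIdx])) ?_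
  · rw [mixProgram, key]
    simp [hi, hj, ofMatrix_mul G Q hi hj]
  · intro t i j _ _ ht h4 h6
    refine dotProd_spec (by norm_num) t (fun u hu => ⟨?_, ?_⟩) (fun u hu => ?_)
      (fun u m hu h8 _ => ⟨?_, ?_⟩)
    · rw [Nat.zero_add]
      exact (hu.1 4 (by simp)).trans h4
    · rw [Nat.zero_add]
      exact (hu.1 6 (by simp)).trans h6
    · exact (hu.1 1 (by simp)).trans (ht.1 1 (by simp [dotProd, modIdx]))
    · simp only [Memory.get, Memory.eval, h8, hu.1 4 (by simp), h4, hu.2 1 (by simp),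
        ht.2 1 (by simp [dotProd, modArr])]
      rfl
    · simp only [Memory.get, Memory.eval, h8, hu.1 6 (by simp), h6, hu.2 2 (by simp),
        ht.2 2 (by simp [dotProd, modArr])]
      rfl

/-- Copy a block of an array. -/
theorem exec_copyBlock {a b : IdxExpr} (hb : b.VarsLt 4) (dst ro co : ℕ) {er ec : IdxExpr}
    {q : Cell} (hq : dst ≠ q.array) (s : Memory F) {m n : ℕ} (ha' : s.eval a = m)
    (hb' : s.eval b = n) (g : ℕ → ℕ → F)
    (h : ∀ t, Agree [4, 6] [dst] s t → t.eval er = ro + t.idx 4 ∧ t.eval ec = co + t.idx 6 ∧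
      t.get q = g (t.idx 4) (t.idx 6)) :
    ((forLt 4 a (forLt 6 b (copyCell ⟨dst, er, ec⟩ q))).exec s).arr dst =
      fun k l => if ro ≤ k ∧ k < ro + m ∧ co ≤ l ∧ l < co + n then g (k - ro) (l - co)
        else s.arr dst k l := by
  refine exec_fill dst ro co m n g (by norm_num) (by simp [copyCell, modIdx]) ha'
    (fun t ht => (hb.eval_congr fun x hx => ht.1 x (by simp [copyCell, modIdx]; omega)).trans hb')
    ?_
  intro t i j _ _ ht h4 h6
  obtain ⟨h1, h2, h3⟩ := h t (ht.mono (by simp [copyCell, modIdx]) (by simp [copyCell, modArr]))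
  rw [copyCell_spec (p := ⟨dst, er, ec⟩) hq]
  simp only [h1, h2, h3, h4, h6]

/-- The powers of the entries of the first row of an array. -/
def powers (arr : ℕ) (eα en : IdxExpr) : Program :=
  seq (forLt 4 (const 1) (forLt 6 eα (setOne ⟨13, const 0, var 6⟩)))
    (forLt 4 en (forLt 6 eα
      (mul ⟨13, IdxExpr.add (var 4) (const 1), var 6⟩ ⟨13, var 4, var 6⟩ ⟨arr, const 0, var 6⟩)))

/-- Each row arises from the previous one by a single multiplication per entry; `n` iterations fill
the rows `1` to `n` after row `0` has been set to ones. -/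
theorem powers_spec {arr : ℕ} (harr : arr ≠ 13) {eα en : IdxExpr} (hα : eα.VarsLt 4)
    (hn : en.VarsLt 4) (s : Memory F) {α n : ℕ} (hα' : s.eval eα = α) (hn' : s.eval en = n) :
    ∀ m ≤ n, ∀ j < α, ((powers arr eα en).exec s).arr 13 m j = s.arr arr 0 j ^ m := by
  subst hα' hn'
  rw [powers, exec_seq]
  -- The outer loop runs once only; it brings the initialisation into the form of `exec_fill`.
  have e1 := exec_fill (x := 4) (y := 6) (a := const 1) (b := eα)
    (P := setOne ⟨13, const 0, var 6⟩) (s := s) 13 0 0 1 (s.eval eα) (fun _ _ => 1) (by norm_num)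
    (by simp [modIdx]) rfl (fun t ht => hα.eval_congr fun x hx => ht.1 x (by simp [modIdx]; omega))
    (by
      intro t i j hi hj ht h4 h6
      funext k l
      have : i = 0 := by omega
      subst this
      simp [exec_setOne, Memory.set, Memory.eval, h6])
  have ht := agree_exec (forLt 4 (const 1) (forLt 6 eα (setOne ⟨13, const 0, var 6⟩))) s
  generalize (forLt 4 (const 1) (forLt 6 eα (setOne ⟨13, const 0, var 6⟩))).exec s = t at *
  have hidx : ∀ x < 4, t.idx x = s.idx x := fun x hx => ht.1 x (by simp [modIdx]; omega)
  have harr' : t.arr arr = s.arr arr := ht.2 arr (by simp [modArr, harr])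
  rw [← hn.eval_congr hidx]
  refine exec_forLt_induction (fun i u => ∀ m ≤ i, ∀ j < s.eval eα,
    u.arr 13 m j = s.arr arr 0 j ^ m) ?_ ?_
  · intro m hm j hj
    have : m = 0 := by omega
    subst this
    rw [e1]
    simp [hj]
  · intro i hi u hu hI
    have hidx' : ∀ x < 4, (u.setIdx 4 i).idx x = s.idx x := fun x hx => by
      rw [← hidx x hx, ← hu.1 x (by simp [modIdx]; omega)]
      simp [Memory.setIdx, show x ≠ 4 by omega]
    rw [exec_fillRow 13 (i + 1) 0 (s.eval eα) (fun j => s.arr arr 0 j ^ (i + 1))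
      (hα.eval_congr hidx')]
    · intro m hm j hj
      by_cases h : m = i + 1
      · simp [h, hj]
      · simp only [h, false_and, if_false]
        exact hI m (by omega) j hj
    · intro v j hj hv hrow
      have h4 : v.idx 4 = i := (hv.1 4 (by simp [modIdx])).trans (by simp [Memory.setIdx])
      have hv' : v.arr arr = s.arr arr :=
        (hv.2 arr (by simp [modArr, harr])).trans
          ((hu.2 arr (by simp [modArr, harr])).trans harr')
      have h13 : v.arr 13 i j = s.arr arr 0 j ^ i :=
        (hrow i j (by omega)).trans (hI i le_rfl j hj)
      funext k l
      simp [exec_mul, Memory.set, Memory.get, Memory.eval, Memory.setIdx, h4, hv', h13, pow_succ]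

/-- Decoding at a sink. -/
def decodeProgram : Program :=
  seq (powers 2 (var 2) (IdxExpr.add (var 2) (var 3)))
    (seq (forLt 4 (var 0) (forLt 6 (var 2)
        (dotProd ⟨10, var 4, var 6⟩ (IdxExpr.add (var 2) (var 3)) ⟨1, var 4, var 8⟩
          ⟨13, IdxExpr.add (var 8) (const 1), var 6⟩)))
      (seq (forLt 4 (var 0) (forLt 6 (IdxExpr.add (var 2) (var 3))
          (copyCell ⟨11, var 4, var 6⟩ ⟨1, var 4, var 6⟩)))
        (seq (forLt 4 (var 1) (forLt 6 (var 2)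
            (copyCell ⟨10, IdxExpr.add (var 0) (var 4), var 6⟩ ⟨3, var 4, var 6⟩)))
          (solve (var 0) (var 1) (var 2) (IdxExpr.add (var 2) (var 3))))))

-- Array `10` receives `Y * P` above `H`, and array `11` receives `Y` above zeros. This is the
-- initial state of the elimination.
open Classical in
theorem decodeProgram_spec {B r α d : ℕ} (Y : Matrix (Fin B) (Fin α ⊕ Fin d) F) (w : Fin α → F)
    (H : Matrix (Fin r) (Fin α) F) {i j : ℕ} (hi : i < r) (hj : j < α + d) :
    (decodeProgram.exec (Memory.load [B, r, α, d]
      [ofMatrix₂ Y, ofMatrix (Matrix.of fun _ : Fin 1 => w), ofMatrix H])).arr 0 i j =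
      ofMatrix₂ (HashCode.decode Y w H) i j := by
  set s := Memory.load [B, r, α, d]
    [ofMatrix₂ Y, ofMatrix (Matrix.of fun _ : Fin 1 => w), ofMatrix H] with hs
  have hs0 : s.idx 0 = B := rfl
  have hs1 : s.idx 1 = r := rfl
  have hs2 : s.idx 2 = α := rfl
  have hs3 : s.idx 3 = d := rfl
  have hα : (var 2).VarsLt 4 := by simp [IdxExpr.VarsLt]
  have hn : (IdxExpr.add (var 2) (var 3)).VarsLt 4 := by simp [IdxExpr.VarsLt]
  rw [decodeProgram, exec_seq, exec_seq, exec_seq, exec_seq]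
  have e1 := powers_spec (arr := 2) (by norm_num) hα hn s rfl rfl
  have f1 := agree_exec (powers 2 (var 2) (IdxExpr.add (var 2) (var 3))) s
  generalize (powers 2 (var 2) (IdxExpr.add (var 2) (var 3))).exec s = t₁ at *
  replace f1 := f1.mono (X' := [4, 6]) (A' := [13]) (by simp [powers, modIdx])
    (by simp [powers, modArr])
  -- Row `m` of the parity matrix, counted from `0`, consists of the powers with exponent `m + 1`.
  have e2 := exec_fill (x := 4) (y := 6) (a := var 0) (b := var 2)
    (P := dotProd ⟨10, var 4, var 6⟩ (IdxExpr.add (var 2) (var 3)) ⟨1, var 4, var 8⟩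
          ⟨13, IdxExpr.add (var 8) (const 1), var 6⟩) (s := t₁) 10 0 0 B α
    (fun i j => ∑ m ∈ Finset.range (α + d), s.arr 1 i m * t₁.arr 13 (m + 1) j) (by norm_num)
    (by simp [dotProd, modIdx]) (f1.1 0 (by simp))
    (fun t ht => (ht.1 2 (by simp [dotProd, modIdx])).trans (f1.1 2 (by simp))) (by
      intro t i j _ _ ht h4 h6
      refine dotProd_spec (by norm_num) t (fun u hu => ⟨?_, ?_⟩) (fun u hu => ?_)
        (fun u m hu h8 _ => ⟨?_, ?_⟩)
      · rw [Nat.zero_add]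
        exact (hu.1 4 (by simp)).trans h4
      · rw [Nat.zero_add]
        exact (hu.1 6 (by simp)).trans h6
      · simp only [Memory.eval, hu.1 2 (by simp), hu.1 3 (by simp),
          ht.1 2 (by simp [dotProd, modIdx]), ht.1 3 (by simp [dotProd, modIdx]),
          f1.1 2 (by simp), f1.1 3 (by simp), hs2, hs3]
      · simp only [Memory.get, Memory.eval, h8, hu.1 4 (by simp), h4, hu.2 1 (by simp),
          ht.2 1 (by simp [dotProd, modArr]), f1.2 1 (by simp)]
      · simp only [Memory.get, Memory.eval, h8, hu.1 6 (by simp), h6, hu.2 13 (by simp),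
          ht.2 13 (by simp [dotProd, modArr])])
  have f2 := agree_exec (forLt 4 (var 0) (forLt 6 (var 2)
    (dotProd ⟨10, var 4, var 6⟩ (IdxExpr.add (var 2) (var 3)) ⟨1, var 4, var 8⟩
          ⟨13, IdxExpr.add (var 8) (const 1), var 6⟩))) t₁
  generalize (forLt 4 (var 0) (forLt 6 (var 2)
    (dotProd ⟨10, var 4, var 6⟩ (IdxExpr.add (var 2) (var 3)) ⟨1, var 4, var 8⟩
          ⟨13, IdxExpr.add (var 8) (const 1), var 6⟩))).exec t₁ = t₂ at *
  replace f2 := (f1.mono (X' := [4, 6, 8]) (A' := [10, 12, 13]) (by simp) (by simp)).trans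
    (f2.mono (by simp [dotProd, modIdx]) (by simp [dotProd, modArr]))
  have e3 := exec_copyBlock (a := var 0) (m := B) (n := α + d) hn 11 0 0 (er := var 4) (ec := var 6)
    (q := ⟨1, var 4, var 6⟩) (by norm_num) t₂ (f2.1 0 (by simp))
    (hn.eval_congr fun x hx => f2.1 x (by simp; omega))
    (s.arr 1) (fun t ht => by
      simp [Memory.eval, Memory.get, ht.2 1 (by simp), f2.2 1 (by simp)])
  have f3 := agree_exec (forLt 4 (var 0) (forLt 6 (IdxExpr.add (var 2) (var 3))
    (copyCell ⟨11, var 4, var 6⟩ ⟨1, var 4, var 6⟩))) t₂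
  generalize (forLt 4 (var 0) (forLt 6 (IdxExpr.add (var 2) (var 3))
    (copyCell ⟨11, var 4, var 6⟩ ⟨1, var 4, var 6⟩))).exec t₂ = t₃ at *
  have g3 : t₃.arr 10 = t₂.arr 10 := f3.2 10 (by simp [copyCell, modArr])
  replace f3 := (f2.mono (X' := [4, 6, 8]) (A' := [10, 11, 12, 13]) (by simp) (by simp)).trans
    (f3.mono (by simp [copyCell, modIdx]) (by simp [copyCell, modArr]))
  have e4 := exec_copyBlock (a := var 1) (m := r) (n := α) hα 10 B 0 (er := IdxExpr.add (var 0) (var 4))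
    (ec := var 6) (q := ⟨3, var 4, var 6⟩) (by norm_num) t₃ (f3.1 1 (by simp))
    (f3.1 2 (by simp)) (s.arr 3) (fun t ht => by
      simp [Memory.eval, Memory.get, ht.2 3 (by simp), ht.1 0 (by simp), f3.2 3 (by simp),
        f3.1 0 (by simp), hs0])
  have f4 := agree_exec (forLt 4 (var 1) (forLt 6 (var 2)
    (copyCell ⟨10, IdxExpr.add (var 0) (var 4), var 6⟩ ⟨3, var 4, var 6⟩))) t₃
  generalize (forLt 4 (var 1) (forLt 6 (var 2)
    (copyCell ⟨10, IdxExpr.add (var 0) (var 4), var 6⟩ ⟨3, var 4, var 6⟩))).exec t₃ = t₄ at *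
  have g4 : t₄.arr 11 = t₃.arr 11 := f4.2 11 (by simp [copyCell, modArr])
  replace f4 := f3.trans (f4.mono (by simp [copyCell, modIdx]) (by simp [copyCell, modArr]))
  have hw : ∀ l : Fin α, s.arr 2 0 l = w l := fun l =>
    ofMatrix_apply (Matrix.of fun _ : Fin 1 => w) 0 l
  have h₀ : Elimination.Initial Y (HashCode.parity d w) H
      (rows α (finSumFinEquiv (m := α) (n := d)) t₄) := by
    constructor
    · intro k
      refine Prod.ext ?_ ?_
      · funext l
        change t₄.arr 10 k l = _
        rw [e4, g3, e2]
        simp only [k.2, l.2, show ¬ B ≤ (k : ℕ) by omega, false_and, if_false, Nat.zero_le,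
          Nat.zero_add, and_self, if_true, Nat.sub_zero]
        rw [HashCode.vecMul_parity_apply, Finset.sum_range,
          ← Equiv.sum_comp (finSumFinEquiv (m := α) (n := d))]
        refine Finset.sum_congr rfl fun m _ => ?_
        rw [e1 _ (finSumFinEquiv m).2 l l.2, hw]
        congr 1
        exact ofMatrix₂_apply Y k m
      · funext m
        change t₄.arr 11 k (finSumFinEquiv m) = _
        rw [g4, e3]
        simp only [k.2, Nat.zero_le, Nat.zero_add, true_and, Nat.sub_zero]
        rw [if_pos (finSumFinEquiv m).2]
        exact ofMatrix₂_apply Y k m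
    · intro a
      refine Prod.ext ?_ ?_
      · funext l
        change t₄.arr 10 (B + a) l = _
        rw [e4]
        simp only [a.2, l.2, Nat.le_add_right, Nat.add_lt_add_iff_left, Nat.zero_le, Nat.zero_add,
          and_self, if_true, Nat.sub_zero, Nat.add_sub_cancel_left]
        exact ofMatrix_apply H a l
      · funext m
        change t₄.arr 11 (B + a) (finSumFinEquiv m) = _
        rw [g4, e3]
        simp only [Nat.zero_add, show ¬ B + (a : ℕ) < B by omega, false_and, and_false, if_false]
        -- Below row `B` array `11` has not been written, and memory starts at zero.
        rw [f2.2 11 (by simp)]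
        rfl
  have key := solve_spec (eB := var 0) (er := var 1) (B := B) (r := r) (α := α) (by simp [IdxExpr.VarsLt])
    (by simp [IdxExpr.VarsLt]) hα hn (finSumFinEquiv (m := α) (n := d)) t₄ (f4.1 0 (by simp))
    (f4.1 1 (by simp)) (f4.1 2 (by simp))
    (hn.eval_congr fun x hx => f4.1 x (by simp; omega)) h₀ ⟨i, hi⟩
    (finSumFinEquiv.symm ⟨j, hj⟩)
  have hout := ofMatrix₂_apply (HashCode.decode Y w H) ⟨i, hi⟩ (finSumFinEquiv.symm ⟨j, hj⟩)
  rw [Equiv.apply_symm_apply] at key hout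
  refine key.trans (Eq.trans ?_ hout.symm)
  rw [HashCode.decode]
  split_ifs <;> rfl

end Program

/-! ### Encoding as a linear system. -/

namespace HashCode

open Classical in
/-- The check packets solve the linear system in which all packets are allowed. -/
theorem mul_inv_eq_solution {F : Type} [Field F] {r α : ℕ} (V : Matrix (Fin α) (Fin α) F)
    (H : Matrix (Fin r) (Fin α) F) (a : Fin r) (j : Fin α) :
    (if h : ∃! M : Matrix (Fin r) (Fin α) F,
      (∀ a, M.row a ∈ Submodule.span F (Set.range (1 : Matrix (Fin α) (Fin α) F).row)) ∧
        M * V = H then h.choose a j else 0) = (H * V⁻¹) a j := by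
  have hspan : ∀ v : Fin α → F,
      v ∈ Submodule.span F (Set.range (1 : Matrix (Fin α) (Fin α) F).row) := by
    intro v
    have : v = ∑ i, v i • (1 : Matrix (Fin α) (Fin α) F).row i := by
      funext k
      simp [Matrix.row, Matrix.one_apply]
    rw [this]
    exact Submodule.sum_mem _ fun i _ =>
      Submodule.smul_mem _ _ (Submodule.subset_span ⟨i, rfl⟩)
  by_cases hV : IsUnit V.det
  · have huniq : ∀ M : Matrix (Fin r) (Fin α) F, M * V = H → M = H * V⁻¹ := by
      rintro M rfl
      rw [Matrix.mul_assoc, mul_nonsing_inv _ hV, Matrix.mul_one]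
    have h : ∃! M : Matrix (Fin r) (Fin α) F,
        (∀ a, M.row a ∈ Submodule.span F (Set.range (1 : Matrix (Fin α) (Fin α) F).row)) ∧
          M * V = H :=
      ⟨H * V⁻¹, ⟨fun a => hspan _, by rw [Matrix.mul_assoc, nonsing_inv_mul _ hV, Matrix.mul_one]⟩,
        fun M hM => huniq M hM.2⟩
    rw [dif_pos h, huniq _ h.choose_spec.1.2]
  -- For a singular block the inverse is zero by convention. Any solution stays one when a left
  -- kernel vector is added to its rows, and row `a` exists, so uniqueness fails and the default is
  -- zero too.
  · rw [nonsing_inv_apply_not_isUnit _ hV, Matrix.mul_zero, dif_neg]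
    · rfl
    rintro ⟨M, ⟨-, hM⟩, huniq⟩
    rw [isUnit_iff_ne_zero, not_not] at hV
    obtain ⟨v, hv, hv0⟩ := Matrix.exists_vecMul_eq_zero_iff.2 hV
    refine hv ?_
    have h1 := huniq (Matrix.of fun a => M.row a + v) ⟨fun a => hspan _, ?_⟩
    · exact add_eq_left.1 (congrFun h1 a)
    · rw [← hM]
      ext b k
      change ((M.row b + v) ᵥ* V) k = (M.row b ᵥ* V) k
      rw [add_vecMul, hv0, add_zero]

end HashCode

namespace Program

open IdxExpr

variable {F : Type} [Field F] [DecidableEq F]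

/-- Encoding at a source. -/
def encodeProgram : Program :=
  seq (powers 1 (var 1) (IdxExpr.add (var 1) (var 2)))
    (seq (forLt 4 (var 1) (forLt 6 (var 1)
        (copyCell ⟨10, var 4, var 6⟩ ⟨13, IdxExpr.add (var 4) (const 1), var 6⟩)))
      (seq (forLt 4 (var 1) (forLt 6 (var 1)
          (ifLt (var 4) (var 6) (setZero ⟨11, var 4, var 6⟩)
            (ifLt (var 6) (var 4) (setZero ⟨11, var 4, var 6⟩) (setOne ⟨11, var 4, var 6⟩)))))
        (seq (forLt 4 (var 0) (forLt 6 (var 1)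
            (seq (dotProd ⟨14, const 0, const 0⟩ (var 2) ⟨3, var 4, var 8⟩
                ⟨13, IdxExpr.add (IdxExpr.add (var 1) (var 8)) (const 1), var 6⟩)
              (sub ⟨10, IdxExpr.add (var 1) (var 4), var 6⟩ ⟨2, var 4, var 6⟩
                ⟨14, const 0, const 0⟩))))
          (seq (solve (var 1) (var 0) (var 1) (var 1))
            (forLt 4 (var 0) (forLt 6 (var 2)
              (copyCell ⟨0, var 4, IdxExpr.add (var 1) (var 6)⟩ ⟨3, var 4, var 6⟩)))))))

/-- The check block solves `L * V = H - X * V'`, where `V` and `V'` are the upper and lower parts of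
the parity matrix. With the identity in place of the received packets every `L` is admissible, so
the decoder's solver applies; it fills the first `α` columns and the data are copied behind them. -/
theorem encodeProgram_spec {r α d : ℕ} (w : Fin α → F)
    (H : Matrix (Fin r) (Fin α) F) (X : Matrix (Fin r) (Fin d) F) {i j : ℕ} (hi : i < r)
    (hj : j < α + d) :
    (encodeProgram.exec (Memory.load [r, α, d]
      [ofMatrix (Matrix.of fun _ : Fin 1 => w), ofMatrix H, ofMatrix X])).arr 0 i j =
      ofMatrix₂ (HashCode.encode w H X) i j := by
  set s := Memory.load [r, α, d]
    [ofMatrix (Matrix.of fun _ : Fin 1 => w), ofMatrix H, ofMatrix X] with hs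
  have hs0 : s.idx 0 = r := rfl
  have hs1 : s.idx 1 = α := rfl
  have hs2 : s.idx 2 = d := rfl
  have hr : (var 0).VarsLt 4 := by simp [IdxExpr.VarsLt]
  have hα : (var 1).VarsLt 4 := by simp [IdxExpr.VarsLt]
  have hd : (var 2).VarsLt 4 := by simp [IdxExpr.VarsLt]
  have hn : (IdxExpr.add (var 1) (var 2)).VarsLt 4 := by simp [IdxExpr.VarsLt]
  have hw : ∀ l : Fin α, s.arr 1 0 l = w l := fun l =>
    ofMatrix_apply (Matrix.of fun _ : Fin 1 => w) 0 l
  rw [encodeProgram, exec_seq, exec_seq, exec_seq, exec_seq, exec_seq]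
  have e1 := powers_spec (arr := 1) (α := α) (n := α + d) (by norm_num) hα hn s rfl rfl
  have f1 := agree_exec (powers 1 (var 1) (IdxExpr.add (var 1) (var 2))) s
  generalize (powers 1 (var 1) (IdxExpr.add (var 1) (var 2))).exec s = t₁ at *
  have g1 : t₁.arr 11 = s.arr 11 := f1.2 11 (by simp [powers, modArr])
  replace f1 := f1.mono (X' := [4, 6, 8]) (A' := [10, 11, 12, 13, 14]) (by simp [powers, modIdx])
    (by simp [powers, modArr])
  have e2 := exec_copyBlock (a := var 1) (m := α) (n := α) hα 10 0 0 (er := var 4) (ec := var 6)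
    (q := ⟨13, IdxExpr.add (var 4) (const 1), var 6⟩) (by norm_num) t₁ (f1.1 1 (by simp))
    (f1.1 1 (by simp)) (fun i j => t₁.arr 13 (i + 1) j) (fun t ht => by
      simp [Memory.eval, Memory.get, ht.2 13 (by simp)])
  have f2 := agree_exec (forLt 4 (var 1) (forLt 6 (var 1)
    (copyCell ⟨10, var 4, var 6⟩ ⟨13, IdxExpr.add (var 4) (const 1), var 6⟩))) t₁
  generalize (forLt 4 (var 1) (forLt 6 (var 1)
    (copyCell ⟨10, var 4, var 6⟩ ⟨13, IdxExpr.add (var 4) (const 1), var 6⟩))).exec t₁ = t₂ at *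
  have g2 : t₂.arr 13 = t₁.arr 13 := f2.2 13 (by simp [copyCell, modArr])
  have g2' : t₂.arr 11 = t₁.arr 11 := f2.2 11 (by simp [copyCell, modArr])
  replace f2 := f1.trans (f2.mono (by simp [copyCell, modIdx]) (by simp [copyCell, modArr]))
  have e3 := exec_fill (x := 4) (y := 6) (a := var 1) (b := var 1)
    (P := ifLt (var 4) (var 6) (setZero ⟨11, var 4, var 6⟩)
      (ifLt (var 6) (var 4) (setZero ⟨11, var 4, var 6⟩) (setOne ⟨11, var 4, var 6⟩)))
    (s := t₂) 11 0 0 α α (fun i j => if i = j then 1 else 0) (by norm_num)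
    (by simp [modIdx]) (f2.1 1 (by simp))
    (fun t ht => (ht.1 1 (by simp [modIdx])).trans (f2.1 1 (by simp))) (by
      intro t i j _ _ ht h4 h6
      simp only [exec_ifLt, exec_setZero, exec_setOne, Memory.eval, h4, h6]
      rcases lt_trichotomy i j with h | h | h
      · simp [h, h.ne, Memory.set, Memory.eval, h4, h6]
      · simp [h, Memory.set, Memory.eval, h4, h6]
      · simp [h, h.ne', h.not_gt, Memory.set, Memory.eval, h4, h6])
  have f3 := agree_exec (forLt 4 (var 1) (forLt 6 (var 1)
    (ifLt (var 4) (var 6) (setZero ⟨11, var 4, var 6⟩)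
      (ifLt (var 6) (var 4) (setZero ⟨11, var 4, var 6⟩) (setOne ⟨11, var 4, var 6⟩))))) t₂
  generalize (forLt 4 (var 1) (forLt 6 (var 1)
    (ifLt (var 4) (var 6) (setZero ⟨11, var 4, var 6⟩)
      (ifLt (var 6) (var 4) (setZero ⟨11, var 4, var 6⟩)
        (setOne ⟨11, var 4, var 6⟩))))).exec t₂ = t₃ at *
  have g3 : t₃.arr 13 = t₁.arr 13 := (f3.2 13 (by simp [modArr])).trans g2
  have g3' : t₃.arr 10 = t₂.arr 10 := f3.2 10 (by simp [modArr])
  replace f3 := f2.trans (f3.mono (by simp [modIdx]) (by simp [modArr]))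
  have e4 := exec_fill (x := 4) (y := 6) (a := var 0) (b := var 1)
    (P := seq (dotProd ⟨14, const 0, const 0⟩ (var 2) ⟨3, var 4, var 8⟩
        ⟨13, IdxExpr.add (IdxExpr.add (var 1) (var 8)) (const 1), var 6⟩)
      (sub ⟨10, IdxExpr.add (var 1) (var 4), var 6⟩ ⟨2, var 4, var 6⟩ ⟨14, const 0, const 0⟩))
    (s := t₃) 10 α 0 r α
    (fun i j => s.arr 2 i j - ∑ m ∈ Finset.range d, s.arr 3 i m * t₁.arr 13 (α + m + 1) j)
    (by norm_num) (by simp [dotProd, modIdx]) (f3.1 0 (by simp))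
    (fun t ht => (ht.1 1 (by simp [dotProd, modIdx])).trans (f3.1 1 (by simp))) (by
      intro t i j _ _ ht h4 h6
      have h1 : t.idx 1 = α := (ht.1 1 (by simp [dotProd, modIdx])).trans (f3.1 1 (by simp))
      have h14 := dotProd_spec (p := ⟨14, const 0, const 0⟩) (n := var 2) (x := ⟨3, var 4, var 8⟩)
        (y := ⟨13, IdxExpr.add (IdxExpr.add (var 1) (var 8)) (const 1), var 6⟩) (by norm_num) t
        (ρ := 0) (σ := 0) (N := d) (u := s.arr 3 i) (v := fun m => t₁.arr 13 (α + m + 1) j)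
        (fun u hu => ⟨rfl, rfl⟩)
        (fun u hu => (hu.1 2 (by simp)).trans
          ((ht.1 2 (by simp [dotProd, modIdx])).trans (f3.1 2 (by simp))))
        (fun u m hu h8 _ => ⟨by
          simp only [Memory.get, Memory.eval, h8, hu.1 4 (by simp), h4, hu.2 3 (by simp),
            ht.2 3 (by simp [dotProd, modArr]), f3.2 3 (by simp)], by
          simp only [Memory.get, Memory.eval, h8, hu.1 6 (by simp), h6, hu.1 1 (by simp), h1,
            hu.2 13 (by simp), ht.2 13 (by simp [dotProd, modArr]), g3]⟩)
      have hv := agree_exec (dotProd ⟨14, const 0, const 0⟩ (var 2) ⟨3, var 4, var 8⟩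
        ⟨13, IdxExpr.add (IdxExpr.add (var 1) (var 8)) (const 1), var 6⟩) t
      rw [exec_seq, exec_sub]
      generalize (dotProd ⟨14, const 0, const 0⟩ (var 2) ⟨3, var 4, var 8⟩
        ⟨13, IdxExpr.add (IdxExpr.add (var 1) (var 8)) (const 1), var 6⟩).exec t = v at *
      have i1 : v.idx 1 = α := (hv.1 1 (by simp [dotProd, modIdx])).trans h1
      have i4 : v.idx 4 = i := (hv.1 4 (by simp [dotProd, modIdx])).trans h4
      have i6 : v.idx 6 = j := (hv.1 6 (by simp [dotProd, modIdx])).trans h6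
      have a2 : v.arr 2 = s.arr 2 := (hv.2 2 (by simp [dotProd, modArr])).trans
        ((ht.2 2 (by simp [dotProd, modArr])).trans (f3.2 2 (by simp)))
      have a10 : v.arr 10 = t.arr 10 := hv.2 10 (by simp [dotProd, modArr])
      simp only at h14
      funext k l
      simp only [Memory.set, Memory.get, Memory.eval, i1, i4, i6, a2, a10, h14, true_and,
        and_self, if_true, Nat.zero_add])
  have f4 := agree_exec (forLt 4 (var 0) (forLt 6 (var 1)
    (seq (dotProd ⟨14, const 0, const 0⟩ (var 2) ⟨3, var 4, var 8⟩
        ⟨13, IdxExpr.add (IdxExpr.add (var 1) (var 8)) (const 1), var 6⟩)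
      (sub ⟨10, IdxExpr.add (var 1) (var 4), var 6⟩ ⟨2, var 4, var 6⟩
        ⟨14, const 0, const 0⟩)))) t₃
  generalize (forLt 4 (var 0) (forLt 6 (var 1)
    (seq (dotProd ⟨14, const 0, const 0⟩ (var 2) ⟨3, var 4, var 8⟩
        ⟨13, IdxExpr.add (IdxExpr.add (var 1) (var 8)) (const 1), var 6⟩)
      (sub ⟨10, IdxExpr.add (var 1) (var 4), var 6⟩ ⟨2, var 4, var 6⟩
        ⟨14, const 0, const 0⟩)))).exec t₃ = t₄ at *
  have g4 : t₄.arr 11 = t₃.arr 11 := f4.2 11 (by simp [dotProd, modArr])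
  replace f4 := f3.trans (f4.mono (by simp [dotProd, modIdx]) (by simp [dotProd, modArr]))
  have h₀ : Elimination.Initial (1 : Matrix (Fin α) (Fin α) F) (HashCode.parity d w).toRows₁
      (H - X * (HashCode.parity d w).toRows₂) (rows α (Equiv.refl (Fin α)) t₄) := by
    constructor
    · intro k
      refine Prod.ext ?_ ?_
      · funext l
        change t₄.arr 10 k l =
          ((1 : Matrix (Fin α) (Fin α) F) * (HashCode.parity d w).toRows₁ : Matrix _ _ F) k l
        rw [e4, g3', e2, Matrix.one_mul]
        simp only [k.2, l.2, show ¬ α ≤ (k : ℕ) by omega, false_and, if_false, Nat.zero_le,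
          Nat.zero_add, and_self, if_true, Nat.sub_zero]
        rw [e1 _ (by omega) l l.2, hw]
        simp [HashCode.parity]
      · funext m
        change t₄.arr 11 k m = _
        rw [g4, e3]
        simp [Matrix.row, Matrix.one_apply, Fin.ext_iff]
    · intro a
      refine Prod.ext ?_ ?_
      · funext l
        change t₄.arr 10 (α + a) l =
          (H - X * (HashCode.parity d w).toRows₂ : Matrix (Fin r) (Fin α) F) a l
        rw [e4]
        simp only [a.2, l.2, Nat.le_add_right, Nat.add_lt_add_iff_left, Nat.zero_le, Nat.zero_add,
          and_self, if_true, Nat.sub_zero, Nat.add_sub_cancel_left]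
        rw [Matrix.sub_apply, Matrix.mul_apply, Finset.sum_range]
        congr 1
        · exact ofMatrix_apply H a l
        · refine Finset.sum_congr rfl fun m _ => ?_
          rw [e1 _ (by omega) l l.2, hw]
          congr 1
          · exact ofMatrix_apply X a m
      · funext m
        change t₄.arr 11 (α + a) m = _
        rw [g4, e3]
        simp only [Nat.zero_add, show ¬ α + (a : ℕ) < α by omega, false_and, and_false, if_false]
        rw [g2', g1]
        rfl
  have key := solve_spec (eB := var 1) (er := var 0) (B := α) (r := r) (α := α) (n := α) hα hr hα hα
    (Equiv.refl (Fin α)) t₄ (f4.1 1 (by simp)) (f4.1 0 (by simp)) (f4.1 1 (by simp))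
    (f4.1 1 (by simp)) h₀ ⟨i, hi⟩
  simp only [HashCode.mul_inv_eq_solution] at key
  have f5 := agree_exec (solve (var 1) (var 0) (var 1) (var 1)) t₄
  generalize (solve (var 1) (var 0) (var 1) (var 1)).exec t₄ = t₅ at *
  replace f5 := (f4.mono (X' := [4, 5, 6, 7, 8]) (A' := [0, 10, 11, 12, 13, 14]) (by simp)
    (by simp)).trans (f5.mono
      (by simp [solve, eliminate, check, output, findPivot, clearOthers, clearRow, rowOp, checkRow,
        scanRow, modIdx])
      (by simp [solve, eliminate, check, output, findPivot, clearOthers, clearRow, rowOp, checkRow,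
        scanRow, modArr]))
  have e6 := exec_copyBlock (a := var 0) (m := r) (n := d) hd 0 0 α (er := var 4)
    (ec := IdxExpr.add (var 1) (var 6)) (q := ⟨3, var 4, var 6⟩) (by norm_num) t₅
    (f5.1 0 (by simp)) (f5.1 2 (by simp)) (s.arr 3) (fun t ht => by
      simp [Memory.eval, Memory.get, ht.2 3 (by simp), ht.1 1 (by simp), f5.2 3 (by simp),
        f5.1 1 (by simp), hs1])
  rw [e6]
  obtain ⟨j', hj'⟩ : ∃ j' : Fin α ⊕ Fin d, (finSumFinEquiv j' : ℕ) = j :=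
    ⟨finSumFinEquiv.symm ⟨j, hj⟩, by simp⟩
  subst hj'
  refine Eq.trans ?_ (ofMatrix₂_apply (HashCode.encode w H X) ⟨i, hi⟩ j').symm
  rcases j' with j' | j'
  · simp only [finSumFinEquiv_apply_left, Fin.val_castAdd, show ¬ α ≤ (j' : ℕ) by omega,
      false_and, and_false, if_false]
    exact key j'
  · simp only [finSumFinEquiv_apply_right, Fin.val_natAdd, Nat.zero_le, Nat.zero_add, hi,
      Nat.le_add_right, Nat.add_lt_add_iff_left, j'.2, and_self, if_true, Nat.sub_zero,
      Nat.add_sub_cancel_left]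
    exact ofMatrix_apply X ⟨i, hi⟩ j'

/-! ### Running times. -/

theorem bounded_encodeProgram : encodeProgram.Bounded 4 := by
  simp [encodeProgram, powers, copyCell, dotProd, solve, eliminate, check, output, findPivot,
    clearOthers, clearRow, rowOp, checkRow, scanRow, Bounded, IdxExpr.VarsLt]

theorem bounded_decodeProgram : decodeProgram.Bounded 4 := by
  simp [decodeProgram, powers, copyCell, dotProd, solve, eliminate, check, output, findPivot,
    clearOthers, clearRow, rowOp, checkRow, scanRow, Bounded, IdxExpr.VarsLt]

theorem bounded_mixProgram : mixProgram.Bounded 4 := by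
  simp [mixProgram, dotProd, Bounded, IdxExpr.VarsLt]

end Program

/-- The registers below `4` hold the sizes or zero, so all of them are bounded by the sum of the
sizes; adding constants and exponents gives common ones for the three programs. -/
theorem HashCode.polynomialTime : HashCode.PolynomialTime := by
  obtain ⟨C₁, k₁, h₁⟩ := Program.bounded_encodeProgram.exists_run_le
  obtain ⟨C₂, k₂, h₂⟩ := Program.bounded_mixProgram.exists_run_le
  obtain ⟨C₃, k₃, h₃⟩ := Program.bounded_decodeProgram.exists_run_le
  have hle : ∀ C k n : ℕ, C ≤ C₁ + C₂ + C₃ → k ≤ k₁ + k₂ + k₃ →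
      C * (n + 1) ^ k ≤ (C₁ + C₂ + C₃) * (n + 1) ^ (k₁ + k₂ + k₃) := fun C k n hC hk =>
    Nat.mul_le_mul hC (Nat.pow_le_pow_right (by omega) hk)
  refine ⟨Program.encodeProgram, Program.mixProgram, Program.decodeProgram, C₁ + C₂ + C₃,
    k₁ + k₂ + k₃, fun F _ _ _ => ⟨?_, ?_, ?_⟩⟩
  · intro r α d w H X
    refine ⟨fun i hi j hj => Program.encodeProgram_spec w H X hi hj,
      (h₁ F _ (r + α + d) fun x hx => ?_).trans (hle _ _ _ (by omega) (by omega))⟩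
    interval_cases x <;> simp [Memory.load] <;> omega
  · intro a b c G Q
    refine ⟨fun i hi j hj => Program.mixProgram_spec G Q hi hj,
      (h₂ F _ (a + b + c) fun x hx => ?_).trans (hle _ _ _ (by omega) (by omega))⟩
    interval_cases x <;> simp [Memory.load] <;> omega
  · intro B r α d Y w H
    refine ⟨fun i hi j hj => Program.decodeProgram_spec Y w H hi hj,
      (h₃ F _ (B + r + α + d) fun x hx => ?_).trans (hle _ _ _ (by omega) (by omega))⟩
    interval_cases x <;> simp [Memory.load] <;> omega

theorem theorem1 (K : Type) [Field K] [Finite K] (ι : Type) [Fintype ι] (z : ℕ) :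
    -- the capacity region
    (∀ (V E τ : Type) [Fintype V] [DecidableEq V] [Fintype E] [Fintype τ] [Nonempty τ]
      (N : Network V E ι τ), (∀ i, z ≤ N.minCut {i}) → N.capacityRegion K z = N.rateRegion z) ∧
    -- encoding, network coding and decoding for the hash code take polynomial time
    HashCode.PolynomialTime ∧
    -- hash codes whose parameters do not depend on the network attain all points of the region
    (∀ (R : ι → ℝ) (m : ℕ), ∃ T d k : ℕ → ℕ,
      ∀ (V E τ : Type) [Fintype V] [DecidableEq V] [Fintype E] [Fintype τ] [Nonempty τ]
        (N : Network V E ι τ), N.minCut Finset.univ = m → R ∈ N.rateRegion z →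
      ∀ ε > (0 : ℝ), ∀ δ > (0 : ℝ), ∃ L : ℕ, ∀ ℓ > L,
        0 < T ℓ ∧ 0 < k ℓ ∧ T ℓ * (((T ℓ * m) ^ 2 + 1) + d ℓ) * k ℓ ≤ ℓ ∧
        ∀ (F : Type) [Field F] [Finite F], Nat.card F = Nat.card K ^ k ℓ →
          let c := HashCode.code N F (T ℓ) ((T ℓ * m) ^ 2 + 1) (d ℓ)
            (fun i => ⌊(T ℓ : ℝ) * R i⌋₊)
          (∀ i, R i - ε ≤ Real.logb (Nat.card K) (Nat.card (c.Msg i)) / ℓ) ∧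
          ∀ (w : ∀ i, c.Msg i) (a : c.Attack), a.Adaptive z → c.errorProb w a < δ) := by
  -- The packet number `T` and the field degree `k` are both the integer fifth root of `ℓ`.
  refine ⟨fun V E τ _ _ _ _ _ N hz => N.capacityRegion_eq K z hz, HashCode.polynomialTime,
    fun R m => ⟨HashCode.fifthRoot, HashCode.dataLength m, HashCode.fifthRoot,
      fun V E τ _ _ _ _ _ N hm hR ε hε δ hδ => HashCode.exists_bound (K := K) N hm hR hε hδ⟩⟩
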